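/- **Setting.** Let $N\ge 0$ and $\eta,\xi_1,\dots,\xi_N\in\mathbb C$. On $\mathbb C^2\otimes\mathbb C^2$ let $R(\lambda)$ be the 6-vertex matrix with diagonal $(\sinh(\lambda+\eta),\sinh\lambda,\sinh\lambda,\sinh(\lambda+\eta))$, with entries $(2,3)$ and $(3,2)$ equal to $\sinh\eta$, and all other entries $0$. For $\zeta,\kappa,\tau\in\mathbb C$ let $$K(\lambda;\zeta,\kappa,\tau)=\frac1{\sinh\zeta}\begin{pmatrix}\sinh(\lambda-\frac\eta2+\zeta)&\kappa e^{\tau}\sinh(2\lambda-\eta)\\ \kappa e^{-\tau}\sinh(2\lambda-\eta)&\sinh(\zeta-\lambda+\frac\eta2)\end{pmatrix},$$ $K_-(\lambda)=K(\lambda;\zeta_-,\kappa_-,\tau_-)$, $K_+(\lambda)=K(\lambda+\eta;\zeta_+,\kappa_+,\tau_+)$. On $\mathbb C^2\otimes\mathcal H$ (auxiliary space $0$, and $\mathcal H=(\mathbb C^2)^{\otimes N}$) put $M(\lambda)=R_{0N}(\lambda-\xi_N-\frac\eta2)\cdots R_{01}(\lambda-\xi_1-\frac\eta2)$, $\hat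 M(\lambda)=(-1)^N\sigma_0^yM^{t_0}(-\lambda)\sigma_0^y$, $\mathcal U_-(\lambda)=M(\lambda)K_-(\lambda)\hat M(\lambda)$. The transfer matrix is $\mathcal T(\lambda)=\mathrm{tr}_0\,K_+(\lambda)\,\mathcal U_-(\lambda)$. For gauge parameters $\alpha,\beta\in\mathbb C$ let $\tilde G(\lambda|\beta)=\begin{pmatrix}e^{-[\lambda+(\alpha+\beta+1)\eta]}&e^{-[\lambda+(\alpha-\beta+1)\eta]}\\1&1\end{pmatrix}$ and $$e^{-\lambda+\eta/2}\,\tilde G^{-1}(\lambda-\tfrac\eta2|\beta)\,\mathcal U_-(\lambda)\,\tilde G(\tfrac\eta2-\lambda|\beta)=\begin{pmatrix}\mathcal A_-(\lambda|\beta+2)&\mathcal B_-(\lambda|\beta)\\ \mathcal C_-(\lambda|\beta+2)&\mathcal D_-(\lambda|\beta)\end{pmatrix}.$$ Let $\alpha_\pm,\beta_\pm$ satisfy $\sinh\alpha_\pm\cosh\beta_\pm=\frac{\sinh\zeta_\pm}{2\kappa_\pm}$ and $\cosh\alpha_\pm\sinh\beta_\pm=\frac{\cosh\zeta_\pm}{2\kappa_\pm}$,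 and put $g_\pm(\lambda)=\frac{\sinh(\lambda+\alpha_\pm-\eta/2)\cosh(\lambda+\beta_\pm-\eta/2)}{\sinh\alpha_\pm\cosh\beta_\pm}$, $a(\lambda)=\prod_n\sinh(\lambda-\xi_n+\frac\eta2)$, $d(\lambda)=a(\lambda-\eta)$, $\mathsf A_-(\lambda)=g_-(\lambda)a(\lambda)d(-\lambda)$, $\det_qK_+(\lambda)=-\sinh(2\lambda+2\eta)g_+(\lambda+\frac\eta2)g_+(-\lambda+\frac\eta2)$, $\det_q\mathcal U_-(\lambda)=\sinh(2\lambda-2\eta)\mathsf A_-(\lambda+\frac\eta2)\mathsf A_-(-\lambda+\frac\eta2)$. For $h\in\{0,1\}$ let $\zeta_a^{(h)}=\xi_a+(h-\frac12)\eta$ and $\eta_a^{(h)}=\cosh2\zeta_a^{(h)}$. Let $\langle\beta|=\bigotimes_{n=1}^N(-1,\,e^{-\alpha\eta+(N-n+\beta)\eta-\xi_n})$ and $|\beta\rangle=\bigotimes_{n=1}^N\begin{pmatrix}e^{-\alpha\eta-(N-n+\beta)\eta-\xi_n}\\1\end{pmatrix}$. For $\mathbf h\in\{0,1\}^N$ the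 $\mathcal B_-$-pseudo-eigenstates are (products in increasing order of $n$) $$\langle\beta,\mathbf h|=\langle\beta|\prod_{n=1}^N\Big(\frac{\mathcal A_-(\frac\eta2-\xi_n|\beta+2)}{\mathsf A_-(\frac\eta2-\xi_n)}\Big)^{h_n},\qquad |\beta,\mathbf h\rangle=\prod_{n=1}^N\Big(\frac{\mathcal D_-(\xi_n+\frac\eta2|\beta)}{f_n\,\mathsf A_-(\frac\eta2-\xi_n)}\Big)^{1-h_n}|-\beta+2\rangle,\qquad f_n=\frac{\sinh(2\xi_n+\eta)}{\sinh(2\xi_n-\eta)},$$ and $$Z(\beta)=\prod_{1\le b<a\le N}(\eta_a^{(1)}-\eta_b^{(1)})\;\langle\beta,1,\dots,1|-\beta\rangle .$$ **Assumptions.** $\sinh\zeta_-\ne0$ and $\kappa_-\ne0$; the $2N$ numbers $\eta_a^{(h)}$ are pairwise distinct; for every $n$, $\mathsf A_-(\frac\eta2-\xi_n)\neq0$ and $\sinh(2\xi_n+\eta)\ne0$; $\sinh\beta\eta\ne0$ and $\sinh(\beta-2)\eta\neq0$. **Proposition (scalar products).** (1) For all functions $\omega_a,\rho_a:\mathbb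 C\to\mathbb C$ ($1\le a\le N$), the covector and vector of separate form $$\langle\omega|=\sum_{\mathbf h}\prod_{a}\omega_a(\zeta_a^{(h_a)})\prod_{b<a}(\eta_a^{(h_a)}-\eta_b^{(h_b)})\,\langle\beta-2,\mathbf h|,\qquad |\rho\rangle=\sum_{\mathbf h}\prod_{a}\rho_a(\zeta_a^{(h_a)})\prod_{b<a}(\eta_a^{(h_a)}-\eta_b^{(h_b)})\,|\beta,\mathbf h\rangle$$ satisfy $$\langle\omega|\rho\rangle=Z(\beta-2)\,\det_{1\le a,b\le N}\Big[\sum_{h=0}^1\omega_a(\zeta_a^{(h)})\,\rho_a(\zeta_a^{(h)})\,(\eta_a^{(h)})^{b-1}\Big].$$ (2) In particular this applies to transfer matrix eigenstates. Suppose moreover that $N\ge1$; that $\sinh\zeta_+\ne0$ and $\kappa_+\neq0$; that for some $k\in\mathbb Z$ $$(\alpha-\beta+2)\eta=-\tau_++(-1)^k(\alpha_+-\beta_+)+i\pi k;$$ that for all $0\le j\le N-1$ and $k\in\mathbb Z$ $$(\alpha-\beta+2+2j)\eta\ne(N-1)\eta-\tau_--(-1)^k(\alpha_-+\beta_-)+i\pi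 k;$$ and that $\det_qK_+(\xi_n)\det_q\mathcal U_-(\xi_n)\ne0$ for all $n$. Let $\langle w|$ and $|v\rangle$ be nonzero left and right eigenstates of all $\mathcal T(\lambda)$, $\lambda\in\mathbb C$ (with possibly different eigenvalue functions). Then there are functions $\omega_a,\rho_a$ such that $\langle w|=\langle\omega|$ and $|v\rangle=|\rho\rangle$ are of the separate form above, and hence $\langle w|v\rangle$ is given by the determinant formula. -/

import Mathlib

open Complex

noncomputable section

namespace OpenXXZ

/-- The algebra of operators on the quantum space `(ℂ²)^{⊗N}`, written in the spin basis:
`s : Fin N → Fin 2`, with `s n = 0` for spin up `(1,0)ᵀ` and `s n = 1` for spin down `(0,1)ᵀ`. -/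
abbrev Op (N : ℕ) := Matrix (Fin N → Fin 2) (Fin N → Fin 2) ℂ

/-- Vectors and covectors of `(ℂ²)^{⊗N}`, by their components in the spin basis (or its dual). -/
abbrev Vec (N : ℕ) := (Fin N → Fin 2) → ℂ

/-- Operators on (auxiliary space `ℂ²`) `⊗` (quantum space), as 2×2 matrices of operators. -/
abbrev AuxOp (N : ℕ) := Matrix (Fin 2) (Fin 2) (Op N)

/-- Parameters of one boundary: `ζ, κ, τ` enter the boundary matrix, and `a, b` are the
alternative parameters usually written `α_±, β_±` (see `Boundary.Admissible`). -/
structure Boundary where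
  ζ : ℂ
  κ : ℂ
  τ : ℂ
  a : ℂ
  b : ℂ

/-- The boundary matrix is well defined (`sinh ζ ≠ 0`), it is not diagonal (`κ ≠ 0`), and
`a, b` solve `sinh a cosh b = sinh ζ / (2κ)`, `cosh a sinh b = cosh ζ / (2κ)`. -/
def Boundary.Admissible (B : Boundary) : Prop :=
  sinh B.ζ ≠ 0 ∧ B.κ ≠ 0 ∧
    sinh B.a * cosh B.b = sinh B.ζ / (2 * B.κ) ∧
    cosh B.a * sinh B.b = cosh B.ζ / (2 * B.κ)

/-- Data of the inhomogeneous open XXZ chain with `N` sites: crossing parameter `η`,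
inhomogeneities `ξ`, the two boundaries, and the gauge parameter `α`
(the second gauge parameter `β` is an argument of the gauge-transformed objects). -/
structure Chain (N : ℕ) where
  η : ℂ
  ξ : Fin N → ℂ
  minus : Boundary
  plus : Boundary
  α : ℂ

/-- The 6-vertex `R`-matrix on `ℂ² ⊗ ℂ²`; the first index is the auxiliary one. -/
def Rmat (η lam : ℂ) : Matrix (Fin 2 × Fin 2) (Fin 2 × Fin 2) ℂ :=
  Matrix.of fun p q =>
    if p = q then (if p.1 = p.2 then sinh (lam + η) else sinh lam)
    else if p.1 = q.2 ∧ p.2 = q.1 then sinh η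
    else 0

/-- A 2×2 matrix acting on the `n`-th tensor factor of the quantum space. -/
def site {N : ℕ} (n : Fin N) (m : Matrix (Fin 2) (Fin 2) ℂ) : Op N :=
  Matrix.of fun s t => if ∀ k, k ≠ n → s k = t k then m (s n) (t n) else 0

/-- `R_{0n}(λ)`, acting on the auxiliary space and the `n`-th site. -/
def R0 {N : ℕ} (η : ℂ) (n : Fin N) (lam : ℂ) : AuxOp N :=
  Matrix.of fun i j => site n (Matrix.of fun s t => Rmat η lam (i, s) (j, t))

/-- A scalar 2×2 matrix acting on the auxiliary space. -/
def aux (N : ℕ) (K : Matrix (Fin 2) (Fin 2) ℂ) : AuxOp N := K.map (algebraMap ℂ (Op N))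

/-- The scalar solution `K(λ; ζ, κ, τ)` of the reflection equation. -/
def Kmat (η : ℂ) (B : Boundary) (lam : ℂ) : Matrix (Fin 2) (Fin 2) ℂ :=
  (sinh B.ζ)⁻¹ •
    !![sinh (lam - η / 2 + B.ζ), B.κ * exp B.τ * sinh (2 * lam - η);
       B.κ * exp (-B.τ) * sinh (2 * lam - η), sinh (B.ζ - lam + η / 2)]

def sigmaY : Matrix (Fin 2) (Fin 2) ℂ := !![0, -I; I, 0]

namespace Chain

variable {N : ℕ} (c : Chain N)

/-- Bulk monodromy matrix `M(λ) = R_{0N}(λ - ξ_N - η/2) ⋯ R_{01}(λ - ξ_1 - η/2)`. -/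
def M (lam : ℂ) : AuxOp N :=
  (List.ofFn fun n : Fin N => R0 c.η n (lam - c.ξ n - c.η / 2)).reverse.prod

/-- `M̂(λ) = (-1)^N σ^y M^{t₀}(-λ) σ^y`, with the transposition in the auxiliary space only. -/
def Mhat (lam : ℂ) : AuxOp N :=
  (-1 : ℂ) ^ N • (aux N sigmaY * (c.M (-lam)).transpose * aux N sigmaY)

def Kminus (lam : ℂ) : Matrix (Fin 2) (Fin 2) ℂ := Kmat c.η c.minus lam

def Kplus (lam : ℂ) : Matrix (Fin 2) (Fin 2) ℂ := Kmat c.η c.plus (lam + c.η)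

/-- Boundary monodromy matrix `U_-(λ) = M(λ) K_-(λ) M̂(λ)`. -/
def Uminus (lam : ℂ) : AuxOp N := c.M lam * aux N (c.Kminus lam) * c.Mhat lam

/-- Transfer matrix `T(λ) = tr₀ (K_+(λ) U_-(λ))`. -/
def transfer (lam : ℂ) : Op N := Matrix.trace (aux N (c.Kplus lam) * c.Uminus lam)

/-- The columns `X(λ|β)` and `Y(λ|β)` of the gauge matrices. -/
def X (lam β : ℂ) : Fin 2 → ℂ := ![exp (-(lam + (c.α + β) * c.η)), 1]

def Y (lam β : ℂ) : Fin 2 → ℂ := ![exp (-(lam + (c.α - β) * c.η)), 1]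

/-- `G̃(λ|β) = (X(λ|β+1), Y(λ|β-1))`. It is invertible iff `sinh (βη) ≠ 0`. -/
def Gtilde (lam β : ℂ) : Matrix (Fin 2) (Fin 2) ℂ :=
  (Matrix.of ![c.X lam (β + 1), c.Y lam (β - 1)]).transpose

/-- Gauge-transformed boundary monodromy matrix
`U_-(λ|β) = e^{-λ+η/2} G̃⁻¹(λ-η/2|β) U_-(λ) G̃(η/2-λ|β)`; its entries are
`A_-(λ|β+2)`, `B_-(λ|β)`, `C_-(λ|β+2)`, `D_-(λ|β)`. -/
def Ugauge (lam β : ℂ) : AuxOp N :=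
  exp (-lam + c.η / 2) •
    (aux N (c.Gtilde (lam - c.η / 2) β)⁻¹ * c.Uminus lam * aux N (c.Gtilde (c.η / 2 - lam) β))

/-- The operator `A_-(λ|β)`: the `(1,1)` entry of `U_-(λ|β-2)`. -/
def opA (lam β : ℂ) : Op N := c.Ugauge lam (β - 2) 0 0

/-- The operator `D_-(λ|β)`: the `(2,2)` entry of `U_-(λ|β)`. -/
def opD (lam β : ℂ) : Op N := c.Ugauge lam β 1 1

/-- `a(λ) = ∏ₙ sinh (λ - ξₙ + η/2)`, and `d(λ) = a(λ - η)`. -/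
def aFun (lam : ℂ) : ℂ := ∏ n, sinh (lam - c.ξ n + c.η / 2)

def dFun (lam : ℂ) : ℂ := c.aFun (lam - c.η)

/-- `g_±(λ)` for the boundary `B`. -/
def g (B : Boundary) (lam : ℂ) : ℂ :=
  sinh (lam + B.a - c.η / 2) * cosh (lam + B.b - c.η / 2) / (sinh B.a * cosh B.b)

/-- The scalar function `A_-(λ) = g_-(λ) a(λ) d(-λ)`. -/
def AFun (lam : ℂ) : ℂ := c.g c.minus lam * c.aFun lam * c.dFun (-lam)

/-- Quantum determinant of `U_-`: `sinh (2λ-2η) A_-(λ+η/2) A_-(-λ+η/2)`. -/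
def qdetUminus (lam : ℂ) : ℂ :=
  sinh (2 * lam - 2 * c.η) * c.AFun (lam + c.η / 2) * c.AFun (-lam + c.η / 2)

/-- Quantum determinant of `K_+`: `-sinh (2λ+2η) g_+(λ+η/2) g_+(-λ+η/2)`. -/
def qdetKplus (lam : ℂ) : ℂ :=
  -sinh (2 * lam + 2 * c.η) * c.g c.plus (lam + c.η / 2) * c.g c.plus (-lam + c.η / 2)

/-- `ζ_a^{(h)} = ξ_a + (h - 1/2) η`. -/
def zetaPt (a : Fin N) (h : Fin 2) : ℂ := c.ξ a + (((h : ℕ) : ℂ) - 1 / 2) * c.η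

/-- `η_a^{(h)} = cosh (2 ζ_a^{(h)})`. -/
def etaPt (a : Fin N) (h : Fin 2) : ℂ := cosh (2 * c.zetaPt a h)

/-- Left reference state `⟨β| = ⊗ₙ (-1, e^{-αη + (N-n+β)η - ξₙ})`, sites being numbered from 1
(so that the site of index `n : Fin N` is number `n + 1`). -/
def leftRef (β : ℂ) : Vec N := fun s =>
  ∏ n : Fin N,
    (![-1, exp (-c.α * c.η + ((N : ℂ) - (((n : ℕ) : ℂ) + 1) + β) * c.η - c.ξ n)] :
      Fin 2 → ℂ) (s n)

/-- Right reference state `|β⟩ = ⊗ₙ (e^{-αη - (N-n+β)η - ξₙ}, 1)ᵀ`. -/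
def rightRef (β : ℂ) : Vec N := fun s =>
  ∏ n : Fin N,
    (![exp (-c.α * c.η - ((N : ℂ) - (((n : ℕ) : ℂ) + 1) + β) * c.η - c.ξ n), 1] :
      Fin 2 → ℂ) (s n)

/-- Left pseudo-eigenstates of `B_-(λ|β)`:
`⟨β,h| = ⟨β| ∏ₙ (A_-(η/2-ξₙ|β+2) / A_-(η/2-ξₙ))^{hₙ}` (factors in increasing order of `n`). -/
def leftState (β : ℂ) (h : Fin N → Fin 2) : Vec N :=
  Matrix.vecMul (c.leftRef β)
    (List.ofFn fun n : Fin N =>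
      ((c.AFun (c.η / 2 - c.ξ n))⁻¹ • c.opA (c.η / 2 - c.ξ n) (β + 2)) ^ (h n : ℕ)).prod

/-- Normalization constants of the right states: `fₙ = sinh (2ξₙ+η) / sinh (2ξₙ-η)`. -/
def fConst (n : Fin N) : ℂ := sinh (2 * c.ξ n + c.η) / sinh (2 * c.ξ n - c.η)

/-- Right pseudo-eigenstates of `B_-(λ|β)`:
`|β,h⟩ = ∏ₙ (D_-(ξₙ+η/2|β) / (fₙ A_-(η/2-ξₙ)))^{1-hₙ} |-β+2⟩` (same order of the factors). -/
def rightState (β : ℂ) (h : Fin N → Fin 2) : Vec N :=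
  Matrix.mulVec
    (List.ofFn fun n : Fin N =>
      ((c.fConst n * c.AFun (c.η / 2 - c.ξ n))⁻¹ • c.opD (c.ξ n + c.η / 2) β) ^
        (1 - (h n : ℕ))).prod
    (c.rightRef (-β + 2))

/-- `∏_{b<a} (η_a^{(h_a)} - η_b^{(h_b)})`. -/
def vdm (h : Fin N → Fin 2) : ℂ :=
  ∏ a : Fin N, ∏ b ∈ Finset.Iio a, (c.etaPt a (h a) - c.etaPt b (h b))

/-- The normalization constant
`Z(β) = ∏_{b<a} (η_a^{(1)} - η_b^{(1)}) ⟨β| ∏ₙ A_-(η/2-ξₙ|β+2) / A_-(η/2-ξₙ) |-β⟩`. -/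
def Z (β : ℂ) : ℂ := c.vdm (fun _ => 1) * (c.leftState β (fun _ => 1) ⬝ᵥ c.rightRef (-β))

/-- Covector of separate form, with wave functions `ω_a`, in the states `⟨β,h|`. -/
def sepCovector (β : ℂ) (ω : Fin N → ℂ → ℂ) : Vec N :=
  ∑ h : Fin N → Fin 2, ((∏ a, ω a (c.zetaPt a (h a))) * c.vdm h) • c.leftState β h

/-- Vector of separate form, with wave functions `ρ_a`, in the states `|β,h⟩`. -/
def sepVector (β : ℂ) (ρ : Fin N → ℂ → ℂ) : Vec N :=
  ∑ h : Fin N → Fin 2, ((∏ a, ρ a (c.zetaPt a (h a))) * c.vdm h) • c.rightState β h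

/-- The matrix `∑_h ω_a(ζ_a^{(h)}) ρ_a(ζ_a^{(h)}) (η_a^{(h)})^{b-1}`, `1 ≤ a, b ≤ N`. -/
def scalarMatrix (ω ρ : Fin N → ℂ → ℂ) : Matrix (Fin N) (Fin N) ℂ :=
  Matrix.of fun a b =>
    ∑ h : Fin 2, ω a (c.zetaPt a h) * ρ a (c.zetaPt a h) * c.etaPt a h ^ (b : ℕ)

/-- `v` is a right eigenstate of the commuting family `T(λ)`, `λ ∈ ℂ`. -/
def IsRightEigenstate (v : Vec N) : Prop :=
  v ≠ 0 ∧ ∃ t : ℂ → ℂ, ∀ lam, Matrix.mulVec (c.transfer lam) v = t lam • v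

/-- `w` is a left eigenstate of the commuting family `T(λ)`, `λ ∈ ℂ`. -/
def IsLeftEigenstate (w : Vec N) : Prop :=
  w ≠ 0 ∧ ∃ t : ℂ → ℂ, ∀ lam, Matrix.vecMul w (c.transfer lam) = t lam • w

/-- The states `⟨β,h|`, `|β,h⟩` are well defined: the boundary `K_-` is admissible, the numbers
`η_a^{(h)}` are pairwise distinct (simple pseudo-spectrum), and no normalization vanishes. -/
def GenericMinus : Prop :=
  c.minus.Admissible ∧
    (Function.Injective fun p : Fin N × Fin 2 => c.etaPt p.1 p.2) ∧
    ∀ n, c.AFun (c.η / 2 - c.ξ n) ≠ 0 ∧ sinh (2 * c.ξ n + c.η) ≠ 0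

/-- Conditions under which the states `⟨β-2,h|` and the states `|β,h⟩` form bases: none of
the pseudo-eigenvalues of `B_-` met along the shifts of the gauge parameter vanishes. -/
def NonNilpotent (β : ℂ) : Prop :=
  ∀ j : Fin N, ∀ k : ℤ,
    (c.α - β + 2 + 2 * ((j : ℕ) : ℂ)) * c.η ≠
      ((N : ℂ) - 1) * c.η - c.minus.τ - (-1 : ℂ) ^ k * (c.minus.a + c.minus.b)
        + I * (Real.pi : ℂ) * (k : ℂ)

/-- The gauge condition which makes `K_+` triangular. -/
def TriangularGauge (β : ℂ) : Prop :=
  ∃ k : ℤ, (c.α - β + 2) * c.η =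
    -c.plus.τ + (-1 : ℂ) ^ k * (c.plus.a - c.plus.b) + I * (Real.pi : ℂ) * (k : ℂ)

end Chain

end OpenXXZ

end

/-! The argument is separation of variables for a gauge-transformed entry of the boundary monodromy
matrix. All gauge dependence is carried by one nonzero number y (`gaugeY`), and `opB` is the row (1,
-y e^{η-λ}) times U(λ) times the column (y e^λ, 1). The shift β → β - 2 is y → y e^{-2η}. Covectors
are stored as operators with equal rows (`rowOp`), so that identities in the operator algebra apply
to them by multiplication.

Three structural facts about U come from dressing the boundary matrix with one site at a time: the
reflection equation, a relation between U(λ) and U(-λ), and the fact that U(λ) U(η-λ) is a scalar. A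
product covector with geometrically spaced parameters is mapped by `opB` to a multiple of its
shifted copy (`refState_opB`). Multiplying it by `rowP` at the points η/2 - ξ_n gives 2^N covectors
with the same property (`leftSt_opB`), since the unwanted terms of the exchange relation vanish at
these points. The eigenvalue vanishes exactly enough to read off the label: its factor at site a is
cosh 2λ - η_a^{(h_a)}. Right states need no separate theory. The full transpose of U is the
monodromy matrix of the chain with ξ → -ξ and τ → -τ, so they are transposed left states of that
chain.

Placing `opB` between a left and a right state gives orthogonality (`pairing_eq_zero`), and placing
an exchange relation there compares neighbouring diagonal products (`pairing_step`). Both arguments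
divide by a boundary factor that may vanish. It is a nonzero quadratic polynomial in y while the
scalar products are continuous in y, so its roots are harmless and no condition of non-nilpotency is
needed here. The diagonal products times Vandermonde factors are then all equal to Z
(`vdm_mul_dotProduct`), and the remaining sum over labels is a determinant by multilinearity in the
rows.

For eigenstates, non-nilpotency enters through `Z_ne_zero`. Successive actions of `opB` at suitable
points isolate any one coefficient of a linear relation between the left states, and these states
are nonzero because U is invertible at the relevant points. Hence the two families are dual bases up
to diagonal factors (`expansion`). When K_+ is triangular in the chosen gauge, the transfer matrix
at η/2 - ξ_n sends a left state to a multiple of the state with site n added (`leftSt_transfer`).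
The components of an eigenvector thus factorize over the sites, and the dual chain gives the same
for left eigenvectors. -/

noncomputable section

namespace OpenXXZ

/-! ### Two auxiliary spaces and the local Yang–Baxter relations -/

section

section TensorLegs

variable {A : Type*} [Ring A]

/-- A matrix acting on the first of two auxiliary spaces. -/
def inOne (X : Matrix (Fin 2) (Fin 2) A) : Matrix (Fin 2 × Fin 2) (Fin 2 × Fin 2) A :=
  Matrix.of fun p q => if p.2 = q.2 then X p.1 q.1 else 0

/-- A matrix acting on the second of two auxiliary spaces. -/
def inTwo (X : Matrix (Fin 2) (Fin 2) A) : Matrix (Fin 2 × Fin 2) (Fin 2 × Fin 2) A :=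
  Matrix.of fun p q => if p.1 = q.1 then X p.2 q.2 else 0

lemma inOne_mul (X Y : Matrix (Fin 2) (Fin 2) A) : inOne (X * Y) = inOne X * inOne Y := by
  ext ⟨i, j⟩ ⟨k, l⟩
  simp only [inOne, Matrix.of_apply, Matrix.mul_apply, Fintype.sum_prod_type, Fin.sum_univ_two]
  fin_cases j <;> fin_cases l <;> simp

lemma inTwo_mul (X Y : Matrix (Fin 2) (Fin 2) A) : inTwo (X * Y) = inTwo X * inTwo Y := by
  ext ⟨i, j⟩ ⟨k, l⟩
  simp only [inTwo, Matrix.of_apply, Matrix.mul_apply, Fintype.sum_prod_type, Fin.sum_univ_two]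
  fin_cases i <;> fin_cases k <;> simp

lemma inOne_inTwo_comm {X Y : Matrix (Fin 2) (Fin 2) A}
    (h : ∀ i j k l, Commute (X i j) (Y k l)) : inOne X * inTwo Y = inTwo Y * inOne X := by
  ext ⟨i, j⟩ ⟨k, l⟩
  simp only [inOne, inTwo, Matrix.of_apply, Matrix.mul_apply, Fintype.sum_prod_type,
    Fin.sum_univ_two]
  fin_cases i <;> fin_cases j <;> fin_cases k <;> fin_cases l <;> simp [(h _ _ _ _).eq]

variable [Algebra ℂ A]

variable (A) in
/-- A scalar matrix, with entries in the algebra `A`. -/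
def scalarMap {ι : Type*} (X : Matrix ι ι ℂ) : Matrix ι ι A := X.map (algebraMap ℂ A)

variable {B : Type*} [Ring B] [Algebra ℂ B]

lemma inOne_map (f : A →ₐ[ℂ] B) (X : Matrix (Fin 2) (Fin 2) A) :
    inOne (X.map f) = (inOne X).map f := by
  ext ⟨i, j⟩ ⟨k, l⟩
  simp only [inOne, Matrix.of_apply, Matrix.map_apply]
  split_ifs <;> simp

lemma inTwo_map (f : A →ₐ[ℂ] B) (X : Matrix (Fin 2) (Fin 2) A) :
    inTwo (X.map f) = (inTwo X).map f := by
  ext ⟨i, j⟩ ⟨k, l⟩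
  simp only [inTwo, Matrix.of_apply, Matrix.map_apply]
  split_ifs <;> simp

lemma scalarMap_map {ι : Type*} (f : A →ₐ[ℂ] B) (X : Matrix ι ι ℂ) :
    (scalarMap A X).map f = scalarMap B X := by
  ext i j
  simp [scalarMap]

end TensorLegs

/-- The `R`-matrix of one site, as a matrix on the auxiliary space with entries acting on the
site. -/
def ell (η u : ℂ) : Matrix (Fin 2) (Fin 2) (Matrix (Fin 2) (Fin 2) ℂ) :=
  Matrix.of fun i j => Matrix.of fun s t => Rmat η u (i, s) (j, t)

lemma ell_eq (η u : ℂ) : ell η u =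
    !![!![sinh (u + η), 0; 0, sinh u], !![0, 0; sinh η, 0];
      !![0, sinh η; 0, 0], !![sinh u, 0; 0, sinh (u + η)]] := by
  ext i j s t
  fin_cases i <;> fin_cases j <;> fin_cases s <;> fin_cases t <;> simp [ell, Rmat]

lemma scalarMap_Rmat_eq (η u : ℂ) :
    scalarMap (Matrix (Fin 2) (Fin 2) ℂ) (Rmat η u) = Matrix.of fun p q =>
      if p = q then (if p.1 = p.2 then !![sinh (u + η), 0; 0, sinh (u + η)]
        else !![sinh u, 0; 0, sinh u])
      else if p.1 = q.2 ∧ p.2 = q.1 then !![sinh η, 0; 0, sinh η] else 0 := by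
  ext p q s t
  simp only [scalarMap, Rmat, Matrix.map_apply, Matrix.of_apply, Matrix.algebraMap_matrix_apply]
  split_ifs <;> fin_cases s <;> fin_cases t <;> simp_all

set_option maxHeartbeats 4000000 in
lemma ybe_local (η u v : ℂ) :
    scalarMap _ (Rmat η (u - v)) * inOne (ell η u) * inTwo (ell η v) =
      inTwo (ell η v) * inOne (ell η u) * scalarMap _ (Rmat η (u - v)) := by
  rw [ell_eq, ell_eq, scalarMap_Rmat_eq]
  ext ⟨i, j⟩ ⟨k, l⟩ s t
  simp only [inOne, inTwo, Matrix.of_apply, Matrix.mul_apply, Fintype.sum_prod_type,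
    Fin.sum_univ_two]
  fin_cases i <;> fin_cases j <;> fin_cases k <;> fin_cases l <;> fin_cases s <;> fin_cases t <;>
    simp <;>
    (simp only [Complex.sinh, exp_add, exp_sub, exp_neg, neg_add, neg_sub]; field_simp) <;> ring

set_option maxHeartbeats 4000000 in
lemma ybe_crossed_local (η u w : ℂ) :
    inOne (ell η u) * scalarMap _ (Rmat η (u + w)) * inTwo (ell η w) =
      inTwo (ell η w) * scalarMap _ (Rmat η (u + w)) * inOne (ell η u) := by
  rw [ell_eq, ell_eq, scalarMap_Rmat_eq]
  ext ⟨i, j⟩ ⟨k, l⟩ s t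
  simp only [inOne, inTwo, Matrix.of_apply, Matrix.mul_apply, Fintype.sum_prod_type,
    Fin.sum_univ_two]
  fin_cases i <;> fin_cases j <;> fin_cases k <;> fin_cases l <;> fin_cases s <;> fin_cases t <;>
    simp <;>
    (simp only [Complex.sinh, exp_add, exp_neg, neg_add]; field_simp) <;> ring

end

/-! ### Operators acting on a single site -/

section

section Sites

variable {N : ℕ}

lemma sum_eq_sum_update {M : Type*} [AddCommMonoid M] (n : Fin N) (s : Fin N → Fin 2)
    (f : (Fin N → Fin 2) → M) (hf : ∀ u, (∃ k, k ≠ n ∧ s k ≠ u k) → f u = 0) :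
    ∑ u, f u = ∑ x : Fin 2, f (Function.update s n x) := by
  symm
  refine Finset.sum_of_injOn (fun x => Function.update s n x) ?_ (by simp) ?_ (by simp)
  · intro x _ y _ h
    simpa using congrFun h n
  · intro u _ hu
    apply hf
    by_contra! h
    refine hu ⟨u n, by simp, ?_⟩
    funext k
    by_cases hk : k = n
    · subst hk; simp
    · simp [hk, h k hk]

lemma site_apply (n : Fin N) (m : Matrix (Fin 2) (Fin 2) ℂ) (s t : Fin N → Fin 2) :
    site n m s t = if ∀ k, k ≠ n → s k = t k then m (s n) (t n) else 0 := rfl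

lemma site_mul_apply (n : Fin N) (m : Matrix (Fin 2) (Fin 2) ℂ) (X : Op N)
    (s t : Fin N → Fin 2) :
    (site n m * X) s t = ∑ x, m (s n) x * X (Function.update s n x) t := by
  rw [Matrix.mul_apply, sum_eq_sum_update n s]
  · refine Finset.sum_congr rfl fun x _ => ?_
    rw [site_apply, if_pos]
    · simp
    · intro k hk; simp [hk]
  · rintro u ⟨k, hk, hne⟩
    rw [site_apply, if_neg, zero_mul]
    exact fun h => hne (h k hk)

lemma site_mul (n : Fin N) (m m' : Matrix (Fin 2) (Fin 2) ℂ) :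
    site n (m * m') = site n m * site n m' := by
  ext s t
  rw [site_mul_apply, site_apply, Matrix.mul_apply]
  have : ∀ x, (∀ k, k ≠ n → Function.update s n x k = t k) ↔ ∀ k, k ≠ n → s k = t k := fun x =>
    forall₂_congr fun k hk => by simp [hk]
  simp only [site_apply, this]
  split_ifs <;> simp

lemma site_one (n : Fin N) : site n (1 : Matrix (Fin 2) (Fin 2) ℂ) = 1 := by
  ext s t
  rw [site_apply, Matrix.one_apply, Matrix.one_apply]
  by_cases h : s = t
  · simp [h]
  · rw [if_neg h]
    split_ifs with h1 h2
    · exact absurd (funext fun k => by by_cases hk : k = n; exacts [hk ▸ h2, h1 k hk]) h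
    · rfl
    · rfl

/-- The embedding of the operators of one site. -/
def siteHom (n : Fin N) : Matrix (Fin 2) (Fin 2) ℂ →ₐ[ℂ] Op N :=
  AlgHom.ofLinearMap
    { toFun := site n
      map_add' := fun a b => by
        ext s t; simp only [site_apply, Matrix.add_apply]; split_ifs <;> simp
      map_smul' := fun a b => by
        ext s t; simp only [site_apply, Matrix.smul_apply, RingHom.id_apply]; split_ifs <;> simp }
    (site_one n) (site_mul n)

lemma siteHom_apply (n : Fin N) (m : Matrix (Fin 2) (Fin 2) ℂ) : siteHom n m = site n m := rfl

lemma site_commute {n k : Fin N} (h : n ≠ k) (m m' : Matrix (Fin 2) (Fin 2) ℂ) :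
    Commute (site n m) (site k m') := by
  have key : ∀ {n k : Fin N} (_ : n ≠ k) (m m' : Matrix (Fin 2) (Fin 2) ℂ) (s t : Fin N → Fin 2),
      (site n m * site k m') s t =
        if ∀ j, j ≠ n → j ≠ k → s j = t j then m (s n) (t n) * m' (s k) (t k) else 0 := by
    intro n k h m m' s t
    rw [site_mul_apply, Finset.sum_eq_single (t n)]
    · have : (∀ j, j ≠ k → Function.update s n (t n) j = t j) ↔
          ∀ j, j ≠ n → j ≠ k → s j = t j := by
        constructor
        · intro hh j hj hk; simpa [hj] using hh j hk
        · intro hh j hk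
          by_cases hj : j = n
          · subst hj; simp
          · simpa [hj] using hh j hj hk
      rw [site_apply]
      simp only [this]
      simp [h.symm]
    · intro x _ hx
      rw [site_apply, if_neg, mul_zero]
      intro hh
      exact hx (by simpa using hh n h)
    · simp
  ext s t
  rw [key h, key h.symm, mul_comm]
  congr 1
  exact propext ⟨fun hh j a b => hh j b a, fun hh j a b => hh j b a⟩

lemma R0_eq_map (η : ℂ) (n : Fin N) (u : ℂ) : R0 η n u = (ell η u).map (siteHom n) := rfl

lemma R0_ybe (η : ℂ) (n : Fin N) (u v : ℂ) :
    scalarMap _ (Rmat η (u - v)) * inOne (R0 η n u) * inTwo (R0 η n v) =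
      inTwo (R0 η n v) * inOne (R0 η n u) * scalarMap _ (Rmat η (u - v)) := by
  simp only [R0_eq_map, inOne_map, inTwo_map, ← scalarMap_map (siteHom n), ← Matrix.map_mul,
    ybe_local]

lemma R0_ybe_crossed (η : ℂ) (n : Fin N) (u w : ℂ) :
    inOne (R0 η n u) * scalarMap _ (Rmat η (u + w)) * inTwo (R0 η n w) =
      inTwo (R0 η n w) * scalarMap _ (Rmat η (u + w)) * inOne (R0 η n u) := by
  simp only [R0_eq_map, inOne_map, inTwo_map, ← scalarMap_map (siteHom n), ← Matrix.map_mul,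
    ybe_crossed_local]

/-- A product covector. -/
def prodState (φ : Fin N → Fin 2 → ℂ) : Vec N := fun s => ∏ n, φ n (s n)

lemma vecMul_prodState_site (φ : Fin N → Fin 2 → ℂ) (n : Fin N) (m : Matrix (Fin 2) (Fin 2) ℂ) :
    Matrix.vecMul (prodState φ) (site n m) =
      prodState (Function.update φ n (Matrix.vecMul (φ n) m)) := by
  funext t
  simp only [Matrix.vecMul, dotProduct, prodState]
  rw [sum_eq_sum_update n t]
  · rw [Fintype.prod_eq_mul_prod_compl n]
    simp only [Function.update_self, Matrix.vecMul, dotProduct, Finset.sum_mul]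
    refine Finset.sum_congr rfl fun x _ => ?_
    rw [Fintype.prod_eq_mul_prod_compl n, site_apply, if_pos]
    · simp only [Function.update_self]
      rw [mul_right_comm]
      congr 1
      refine Finset.prod_congr rfl fun k hk => ?_
      have : k ≠ n := by simpa using hk
      simp [this]
    · intro k hk; simp [hk]
  · rintro u ⟨k, hk, hne⟩
    rw [site_apply, if_neg, mul_zero]
    exact fun h => hne (h k hk).symm

end Sites

end

/-! ### Dressing the reflection equation and the parity relation -/

section

section Reflection

variable {A : Type*} [Ring A] [Algebra ℂ A]

/-- The reflection equation. -/
def ReflectionEq (η : ℂ) (U : ℂ → Matrix (Fin 2) (Fin 2) A) : Prop :=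
  ∀ lam mu, scalarMap A (Rmat η (lam - mu)) * inOne (U lam) *
      scalarMap A (Rmat η (lam + mu - η)) * inTwo (U mu) =
    inTwo (U mu) * scalarMap A (Rmat η (lam + mu - η)) * inOne (U lam) *
      scalarMap A (Rmat η (lam - mu))

/-- Four times the projector on the antisymmetric vector of the two auxiliary spaces. -/
def singlet : Matrix (Fin 2 × Fin 2) (Fin 2 × Fin 2) ℂ :=
  Matrix.of fun p q =>
    if p.1 = p.2 then 0 else if p = q then 1 else if p.1 = q.2 ∧ p.2 = q.1 then -1 else 0

/-- The relation between `U(λ)` and `U(-λ)`. -/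
def ParityRel (η : ℂ) (U : ℂ → Matrix (Fin 2) (Fin 2) A) : Prop :=
  ∀ lam, scalarMap A singlet * inOne (U lam) * scalarMap A (Rmat η (2 * lam)) =
    sinh (2 * lam - η) • (scalarMap A singlet * inTwo (U (-lam)))

/-- Sklyanin's dressing argument: the entries of L commute with those of U, so the factors of the
two auxiliary spaces can be moved past each other. The relations `hL` and `hL'` exchange L with the
two scalar R-matrices, one with the difference and one with the sum of the spectral parameters. -/
lemma ReflectionEq.dress {η : ℂ} {U : ℂ → Matrix (Fin 2) (Fin 2) A} (hU : ReflectionEq η U)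
    {L : ℂ → Matrix (Fin 2) (Fin 2) A} (hc : ∀ lam mu i j k l, Commute (U lam i j) (L mu k l))
    (hL : ∀ u v, scalarMap A (Rmat η (u - v)) * inOne (L u) * inTwo (L v) =
      inTwo (L v) * inOne (L u) * scalarMap A (Rmat η (u - v)))
    (hL' : ∀ u w, inOne (L u) * scalarMap A (Rmat η (u + w)) * inTwo (L w) =
      inTwo (L w) * scalarMap A (Rmat η (u + w)) * inOne (L u)) (ξ : ℂ) :
    ReflectionEq η fun lam => L (lam - ξ - η / 2) * U lam * L (lam + ξ - η / 2) := by
  intro lam mu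
  have c1 : ∀ u w, inOne (U u) * inTwo (L w) = inTwo (L w) * inOne (U u) := fun u w =>
    inOne_inTwo_comm fun i j k l => hc _ _ _ _ _ _
  have c2 : ∀ u w, inOne (L u) * inTwo (U w) = inTwo (U w) * inOne (L u) := fun u w =>
    inOne_inTwo_comm fun i j k l => (hc _ _ _ _ _ _).symm
  have h1 := hL (lam - ξ - η / 2) (mu - ξ - η / 2)
  have h2 := hL (lam + ξ - η / 2) (mu + ξ - η / 2)
  have h3 := hL' (lam + ξ - η / 2) (mu - ξ - η / 2)
  have h4 := hL' (lam - ξ - η / 2) (mu + ξ - η / 2)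
  rw [show lam - ξ - η / 2 - (mu - ξ - η / 2) = lam - mu by ring] at h1
  rw [show lam + ξ - η / 2 - (mu + ξ - η / 2) = lam - mu by ring] at h2
  rw [show lam + ξ - η / 2 + (mu - ξ - η / 2) = lam + mu - η by ring] at h3
  rw [show lam - ξ - η / 2 + (mu + ξ - η / 2) = lam + mu - η by ring] at h4
  have h0 := hU lam mu
  simp only [inOne_mul, inTwo_mul]
  have d1 := c1 lam (mu - ξ - η / 2)
  have d2 := c2 (lam + ξ - η / 2) mu
  have d3 := c1 lam (mu + ξ - η / 2)
  have d4 := c2 (lam - ξ - η / 2) mu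
  generalize inOne (L (lam - ξ - η / 2)) = l1 at *
  generalize inOne (L (lam + ξ - η / 2)) = l1' at *
  generalize inTwo (L (mu - ξ - η / 2)) = l2 at *
  generalize inTwo (L (mu + ξ - η / 2)) = l2' at *
  generalize inOne (U lam) = u1 at *
  generalize inTwo (U mu) = u2 at *
  generalize scalarMap A (Rmat η (lam - mu)) = r at *
  generalize scalarMap A (Rmat η (lam + mu - η)) = s at *
  calc r * (l1 * u1 * l1') * s * (l2 * u2 * l2')
      = r * l1 * u1 * (l1' * s * l2) * u2 * l2' := by simp only [mul_assoc]
    _ = r * l1 * (u1 * l2) * s * (l1' * u2) * l2' := by rw [h3]; simp only [mul_assoc]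
    _ = (r * l1 * l2) * u1 * s * u2 * l1' * l2' := by rw [d1, d2]; simp only [mul_assoc]
    _ = l2 * l1 * (r * u1 * s * u2) * l1' * l2' := by rw [h1]; simp only [mul_assoc]
    _ = l2 * (l1 * u2) * s * u1 * (r * l1' * l2') := by rw [h0]; simp only [mul_assoc]
    _ = l2 * u2 * l1 * s * (u1 * l2') * l1' * r := by rw [h2, d4]; simp only [mul_assoc]
    _ = l2 * u2 * (l1 * s * l2') * u1 * l1' * r := by rw [d3]; simp only [mul_assoc]
    _ = l2 * u2 * l2' * s * (l1 * u1 * l1') * r := by rw [h4]; simp only [mul_assoc]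

/-- The antisymmetric vector transfers L(u) from the first auxiliary space to -L(-u-η) in the
second. The two transfers needed here produce two signs, which cancel. -/
lemma ParityRel.dress {η : ℂ} {U : ℂ → Matrix (Fin 2) (Fin 2) A} (hU : ParityRel η U)
    {L : ℂ → Matrix (Fin 2) (Fin 2) A} (hc : ∀ lam mu i j k l, Commute (U lam i j) (L mu k l))
    (hL : ∀ u v, scalarMap A (Rmat η (u - v)) * inOne (L u) * inTwo (L v) =
      inTwo (L v) * inOne (L u) * scalarMap A (Rmat η (u - v)))
    (hE : ∀ u, scalarMap A singlet * inOne (L u) = -(scalarMap A singlet * inTwo (L (-u - η))))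
    (ξ : ℂ) :
    ParityRel η fun lam => L (lam - ξ - η / 2) * U lam * L (lam + ξ - η / 2) := by
  intro lam
  have c1 : ∀ u w, inOne (U u) * inTwo (L w) = inTwo (L w) * inOne (U u) := fun u w =>
    inOne_inTwo_comm fun i j k l => hc _ _ _ _ _ _
  have c2 : ∀ u w, inOne (L u) * inTwo (U w) = inTwo (U w) * inOne (L u) := fun u w =>
    inOne_inTwo_comm fun i j k l => (hc _ _ _ _ _ _).symm
  have h1 := hL (lam + ξ - η / 2) (-lam + ξ - η / 2)
  rw [show lam + ξ - η / 2 - (-lam + ξ - η / 2) = 2 * lam by ring] at h1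
  have h0 := hU lam
  have e1 := hE (lam - ξ - η / 2)
  have e2 := hE (lam + ξ - η / 2)
  rw [show -(lam - ξ - η / 2) - η = -lam + ξ - η / 2 by ring] at e1
  rw [show -(lam + ξ - η / 2) - η = -lam - ξ - η / 2 by ring] at e2
  have d1 := c1 lam (-lam + ξ - η / 2)
  have d2 := c2 (lam + ξ - η / 2) (-lam)
  simp only [inOne_mul, inTwo_mul]
  generalize inOne (L (lam - ξ - η / 2)) = l1 at *
  generalize inOne (L (lam + ξ - η / 2)) = l1' at *
  generalize inTwo (L (-lam - ξ - η / 2)) = l2 at *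
  generalize inTwo (L (-lam + ξ - η / 2)) = l2' at *
  generalize inOne (U lam) = u1 at *
  generalize inTwo (U (-lam)) = u2 at *
  generalize scalarMap A (Rmat η (2 * lam)) = r at *
  generalize scalarMap A singlet = E at *
  calc E * (l1 * u1 * l1') * r
      = (E * l1) * u1 * l1' * r := by simp only [mul_assoc]
    _ = -(E * (l2' * u1) * l1' * r) := by rw [e1]; simp only [mul_assoc, neg_mul]
    _ = -(E * u1 * (l2' * l1' * r)) := by rw [← d1]; simp only [mul_assoc]
    _ = -((E * u1 * r) * l1' * l2') := by rw [← h1]; simp only [mul_assoc]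
    _ = sinh (2 * lam - η) • -(E * (u2 * l1') * l2') := by
        rw [h0]; simp only [mul_assoc, smul_mul_assoc, smul_neg]
    _ = sinh (2 * lam - η) • -((E * l1') * u2 * l2') := by rw [← d2]; simp only [mul_assoc]
    _ = sinh (2 * lam - η) • (E * (l2 * u2 * l2')) := by
        rw [e2]; simp only [mul_assoc, neg_mul, neg_neg]

end Reflection

lemma singlet_ell_local (η u : ℂ) :
    scalarMap _ singlet * inOne (ell η u) = -(scalarMap _ singlet * inTwo (ell η (-u - η))) := by
  rw [ell_eq, ell_eq]
  ext ⟨i, j⟩ ⟨k, l⟩ s t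
  simp only [inOne, inTwo, scalarMap, singlet, Matrix.of_apply, Matrix.mul_apply,
    Fintype.sum_prod_type, Fin.sum_univ_two, Matrix.map_apply, Matrix.neg_apply]
  fin_cases i <;> fin_cases j <;> fin_cases k <;> fin_cases l <;> fin_cases s <;> fin_cases t <;>
    simp [show -u - η = -(u + η) by ring, show -(u + η) + η = -u by ring, -neg_add_rev]

lemma ell_mul_ell_neg (η u : ℂ) :
    ell η u * ell η (-u) = (sinh (η + u) * sinh (η - u)) • 1 := by
  rw [ell_eq, ell_eq]
  ext i j s t
  fin_cases i <;> fin_cases j <;> fin_cases s <;> fin_cases t <;>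
    simp [Matrix.mul_apply, Fin.sum_univ_two] <;>
    (simp only [Complex.sinh, exp_add, exp_neg, neg_add, exp_sub, neg_sub]; field_simp) <;> ring

/-- The transposition in the auxiliary space, conjugated by `σʸ`. -/
def crossing {A : Type*} [Ring A] (X : Matrix (Fin 2) (Fin 2) A) : Matrix (Fin 2) (Fin 2) A :=
  !![X 1 1, -X 0 1; -X 1 0, X 0 0]

lemma crossing_ell (η u : ℂ) : crossing (ell η u) = -ell η (-u - η) := by
  rw [ell_eq, ell_eq]
  ext i j s t
  fin_cases i <;> fin_cases j <;> fin_cases s <;> fin_cases t <;>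
    simp [crossing, show -u - η = -(u + η) by ring, show -(u + η) + η = -u by ring, -neg_add_rev]

/-- `crossing` is the adjugate of a 2×2 matrix, hence reverses products as soon as entries of
different factors commute. -/
lemma crossing_mul {A : Type*} [Ring A] {X Y : Matrix (Fin 2) (Fin 2) A}
    (h : ∀ i j k l, Commute (X i j) (Y k l)) : crossing (X * Y) = crossing Y * crossing X := by
  ext i j
  fin_cases i <;> fin_cases j <;>
    simp [crossing, Matrix.mul_apply, Fin.sum_univ_two, (h _ _ _ _).eq] <;> abel

lemma sigmaY_conj {N : ℕ} (X : AuxOp N) :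
    aux N sigmaY * X.transpose * aux N sigmaY = crossing X := by
  ext i j : 2
  fin_cases i <;> fin_cases j <;>
    simp [crossing, Matrix.mul_apply, Fin.sum_univ_two, aux, sigmaY,
      Algebra.algebraMap_eq_smul_one, smul_smul]

end

/-! ### The scalar boundary matrix -/

section

section ScalarK

set_option maxHeartbeats 4000000 in
lemma Kmat_reflection_complex (η : ℂ) (B : Boundary) :
    ReflectionEq η (Kmat η B) := by
  intro lam mu
  unfold Kmat
  generalize (sinh B.ζ)⁻¹ = c
  ext ⟨i, j⟩ ⟨k, l⟩
  simp only [inOne, inTwo, Matrix.of_apply, Matrix.mul_apply, Fintype.sum_prod_type,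
    Fin.sum_univ_two, scalarMap, Rmat, Matrix.map_apply]
  have hh : ∀ x : ℂ, exp (x * 2) = exp x * exp x := fun x => by rw [mul_two, exp_add]
  have hη : exp η = exp (η / 2) * exp (η / 2) := by rw [← exp_add]; ring_nf
  fin_cases i <;> fin_cases j <;> fin_cases k <;> fin_cases l <;>
    simp <;>
    (simp only [Complex.sinh, exp_add, exp_sub, exp_neg, neg_add, neg_sub, mul_comm (2 : ℂ), hh,
      hη]; field_simp) <;> ring

lemma Kmat_parity_complex (η : ℂ) (B : Boundary) :
    ParityRel η (Kmat η B) := by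
  intro lam
  unfold Kmat
  generalize (sinh B.ζ)⁻¹ = c
  ext ⟨i, j⟩ ⟨k, l⟩
  simp only [inOne, inTwo, Matrix.of_apply, Matrix.mul_apply, Fintype.sum_prod_type,
    Fin.sum_univ_two, scalarMap, Rmat, Matrix.map_apply, singlet, Matrix.smul_apply]
  have hh : ∀ x : ℂ, exp (x * 2) = exp x * exp x := fun x => by rw [mul_two, exp_add]
  have hη : exp η = exp (η / 2) * exp (η / 2) := by rw [← exp_add]; ring_nf
  fin_cases i <;> fin_cases j <;> fin_cases k <;> fin_cases l <;>
    simp <;>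
    (simp only [Complex.sinh, exp_add, exp_sub, exp_neg, neg_sub, mul_comm (2 : ℂ), hh,
      hη]; field_simp) <;> ring

lemma Kmat_inverse_complex (η : ℂ) (B : Boundary) (lam : ℂ) :
    Kmat η B lam * Kmat η B (η - lam) =
      ((sinh (B.ζ + (lam - η / 2)) * sinh (B.ζ - (lam - η / 2)) -
        B.κ ^ 2 * sinh (2 * lam - η) ^ 2) / sinh B.ζ ^ 2) • 1 := by
  have h1 : η - lam - η / 2 = -(lam - η / 2) := by ring
  have h2 : 2 * (η - lam) - η = -(2 * lam - η) := by ring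
  have h3 : B.ζ - (η - lam) + η / 2 = B.ζ + (lam - η / 2) := by ring
  have h4 : B.ζ - lam + η / 2 = B.ζ - (lam - η / 2) := by ring
  unfold Kmat
  rw [h1, h2, h3, h4, show -(lam - η / 2) + B.ζ = B.ζ - (lam - η / 2) by ring,
    add_comm (lam - η / 2) B.ζ, div_eq_mul_inv _ (sinh B.ζ ^ 2), ← inv_pow,
    Complex.sinh_neg]
  generalize sinh (2 * lam - η) = x
  generalize (sinh B.ζ)⁻¹ = c
  have he : exp B.τ * exp (-B.τ) = 1 := by rw [← exp_add]; simp
  ext i j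
  fin_cases i <;> fin_cases j <;> simp [Matrix.mul_apply, Fin.sum_univ_two]
  · linear_combination (-c ^ 2 * B.κ ^ 2 * x ^ 2) * he
  · ring
  · ring
  · linear_combination (-c ^ 2 * B.κ ^ 2 * x ^ 2) * he

end ScalarK

end

/-! ### Reflection, parity, unitarity and transposition for the full monodromy matrix -/

section

variable {N : ℕ}

lemma Kmat_reflection (η : ℂ) (B : Boundary) :
    ReflectionEq η fun lam => aux N (Kmat η B lam) := by
  intro lam mu
  have h := congrArg (fun X => X.map (Algebra.ofId ℂ (Op N))) (Kmat_reflection_complex η B lam mu)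
  simp only [Matrix.map_mul, ← inOne_map, ← inTwo_map, scalarMap_map] at h
  exact h

lemma Kmat_parity (η : ℂ) (B : Boundary) : ParityRel η fun lam => aux N (Kmat η B lam) := by
  intro lam
  have h := congrArg (fun X => X.map (Algebra.ofId ℂ (Op N))) (Kmat_parity_complex η B lam)
  have hs : ∀ (k : ℂ) (X : Matrix (Fin 2 × Fin 2) (Fin 2 × Fin 2) ℂ),
      (k • X).map (Algebra.ofId ℂ (Op N)) = k • X.map (Algebra.ofId ℂ (Op N)) := fun k X => by
    ext i j : 1
    rw [Matrix.map_apply, Matrix.smul_apply, Matrix.smul_apply, Matrix.map_apply, map_smul]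
  simp only [hs, Matrix.map_mul, ← inOne_map, ← inTwo_map, scalarMap_map] at h
  exact h

lemma R0_singlet (η : ℂ) (n : Fin N) (u : ℂ) :
    scalarMap (Op N) singlet * inOne (R0 η n u) =
      -(scalarMap (Op N) singlet * inTwo (R0 η n (-u - η))) := by
  have h := congrArg (fun X => X.map (siteHom n)) (singlet_ell_local η u)
  have hs : ∀ (X : Matrix (Fin 2 × Fin 2) (Fin 2 × Fin 2) (Matrix (Fin 2) (Fin 2) ℂ)),
      (-X).map (siteHom n) = -X.map (siteHom n) := fun X => by
    ext i j : 1
    simp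
  simp only [hs, Matrix.map_mul, ← inOne_map, ← inTwo_map, scalarMap_map] at h
  exact h

lemma R0_mul_R0_neg (η : ℂ) (n : Fin N) (u : ℂ) :
    R0 η n u * R0 η n (-u) = (sinh (η + u) * sinh (η - u)) • 1 := by
  have h := congrArg (fun X => X.map (siteHom n)) (ell_mul_ell_neg η u)
  simp only [Matrix.map_mul] at h
  rw [R0_eq_map, R0_eq_map, h]
  ext i j : 1
  by_cases hij : i = j
  · subst hij; simp
  · simp [hij]

lemma crossing_R0 (η : ℂ) (n : Fin N) (u : ℂ) : crossing (R0 η n u) = -R0 η n (-u - η) := by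
  have h := crossing_ell η u
  ext i j : 1
  have hij := congrArg (siteHom n) (congrFun (congrFun h i) j)
  fin_cases i <;> fin_cases j <;> simpa [crossing, R0_eq_map] using hij

lemma R0_commute_site (η : ℂ) {n k : Fin N} (h : n ≠ k) (u : ℂ) (i j : Fin 2)
    (m : Matrix (Fin 2) (Fin 2) ℂ) : Commute (R0 η n u i j) (site k m) :=
  site_commute h _ _

lemma site_transpose (n : Fin N) (m : Matrix (Fin 2) (Fin 2) ℂ) :
    (site n m).transpose = site n m.transpose := by
  ext s t
  simp only [Matrix.transpose_apply, site_apply]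
  congr 1
  exact propext (forall₂_congr fun k _ => eq_comm)

/-- The transposition in all spaces. -/
def fullTranspose (X : AuxOp N) : AuxOp N := Matrix.of fun i j => (X j i).transpose

lemma fullTranspose_apply (X : AuxOp N) (i j : Fin 2) :
    fullTranspose X i j = (X j i).transpose := rfl

lemma fullTranspose_mul (X Y : AuxOp N) :
    fullTranspose (X * Y) = fullTranspose Y * fullTranspose X := by
  ext i j : 1
  simp [fullTranspose, Matrix.mul_apply, Matrix.transpose_mul]

lemma fullTranspose_R0 (η : ℂ) (n : Fin N) (u : ℂ) : fullTranspose (R0 η n u) = R0 η n u := by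
  ext i j : 1
  rw [fullTranspose_apply, R0_eq_map, Matrix.map_apply, Matrix.map_apply, siteHom_apply,
    siteHom_apply, site_transpose]
  congr 1
  rw [ell_eq]
  ext s t
  fin_cases i <;> fin_cases j <;> fin_cases s <;> fin_cases t <;> simp

lemma fullTranspose_aux (K : Matrix (Fin 2) (Fin 2) ℂ) :
    fullTranspose (aux N K) = aux N K.transpose := by
  ext i j : 1
  simp [fullTranspose, aux, Algebra.algebraMap_eq_smul_one]

namespace Chain

/-- The chain whose monodromy matrix is the full transpose of that of `c`. -/
def dual (c : Chain N) : Chain N where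
  η := c.η
  ξ := fun n => -c.ξ n
  minus := { c.minus with τ := -c.minus.τ }
  plus := { c.plus with τ := -c.plus.τ }
  α := c.α

variable (c : Chain N)

/-- The boundary monodromy matrix of the sites in a list, the outermost site coming first. -/
def Upart : List (Fin N) → ℂ → AuxOp N
  | [], lam => aux N (c.Kminus lam)
  | n :: l, lam =>
    R0 c.η n (lam - c.ξ n - c.η / 2) * Upart l lam * R0 c.η n (lam + c.ξ n - c.η / 2)

lemma Upart_commute_site {l : List (Fin N)} {n : Fin N} (hn : n ∉ l) (lam : ℂ) (i j : Fin 2)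
    (m : Matrix (Fin 2) (Fin 2) ℂ) : Commute (c.Upart l lam i j) (site n m) := by
  induction l generalizing i j with
  | nil => exact Algebra.commutes (R := ℂ) (c.Kminus lam i j) (site n m)
  | cons k l ih =>
    rw [List.mem_cons, not_or] at hn
    simp only [Upart, Matrix.mul_apply, Finset.sum_mul]
    refine Commute.sum_left _ _ _ fun a _ => Commute.sum_left _ _ _ fun b _ => ?_
    exact ((R0_commute_site _ (Ne.symm hn.1) _ _ _ _).mul_left (ih hn.2 _ _)).mul_left
      (R0_commute_site _ (Ne.symm hn.1) _ _ _ _)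

lemma Upart_reflection {l : List (Fin N)} (hl : l.Nodup) : ReflectionEq c.η (c.Upart l) := by
  induction l with
  | nil => exact Kmat_reflection _ _
  | cons n l ih =>
    rw [List.nodup_cons] at hl
    exact (ih hl.2).dress (L := R0 c.η n) (fun _ _ _ _ _ _ => c.Upart_commute_site hl.1 _ _ _ _)
      (R0_ybe _ _) (R0_ybe_crossed _ _) (c.ξ n)

lemma Upart_parity {l : List (Fin N)} (hl : l.Nodup) : ParityRel c.η (c.Upart l) := by
  induction l with
  | nil => exact Kmat_parity _ _
  | cons n l ih =>
    rw [List.nodup_cons] at hl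
    exact (ih hl.2).dress (L := R0 c.η n) (fun _ _ _ _ _ _ => c.Upart_commute_site hl.1 _ _ _ _)
      (R0_ybe _ _) (R0_singlet _ _) (c.ξ n)

/-- The scalar `U(λ) U(η - λ)`. -/
def unitarityFactor (l : List (Fin N)) (lam : ℂ) : ℂ :=
  (sinh (c.minus.ζ + (lam - c.η / 2)) * sinh (c.minus.ζ - (lam - c.η / 2)) -
      c.minus.κ ^ 2 * sinh (2 * lam - c.η) ^ 2) / sinh c.minus.ζ ^ 2 *
    (l.map fun n => sinh (c.η + (lam - c.ξ n - c.η / 2)) * sinh (c.η - (lam - c.ξ n - c.η / 2)) *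
      (sinh (c.η + (lam + c.ξ n - c.η / 2)) * sinh (c.η - (lam + c.ξ n - c.η / 2)))).prod

lemma Upart_mul_Upart (l : List (Fin N)) (lam : ℂ) :
    c.Upart l lam * c.Upart l (c.η - lam) = c.unitarityFactor l lam • 1 := by
  induction l with
  | nil =>
    have h := congrArg (fun X => X.map (Algebra.ofId ℂ (Op N)))
      (Kmat_inverse_complex c.η c.minus lam)
    simp only [Matrix.map_mul] at h
    refine Eq.trans h ?_
    ext i j : 1
    by_cases hij : i = j
    · subst hij
      simp [unitarityFactor, Algebra.ofId_apply, Algebra.algebraMap_eq_smul_one]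
    · simp [hij]
  | cons n l ih =>
    simp only [Upart]
    rw [show c.η - lam - c.ξ n - c.η / 2 = -(lam + c.ξ n - c.η / 2) by ring,
      show c.η - lam + c.ξ n - c.η / 2 = -(lam - c.ξ n - c.η / 2) by ring]
    calc R0 c.η n (lam - c.ξ n - c.η / 2) * c.Upart l lam * R0 c.η n (lam + c.ξ n - c.η / 2) *
          (R0 c.η n (-(lam + c.ξ n - c.η / 2)) * c.Upart l (c.η - lam) *
            R0 c.η n (-(lam - c.ξ n - c.η / 2)))
        = R0 c.η n (lam - c.ξ n - c.η / 2) * (c.Upart l lam * ((R0 c.η n (lam + c.ξ n - c.η / 2) *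
          R0 c.η n (-(lam + c.ξ n - c.η / 2))) * c.Upart l (c.η - lam))) *
            R0 c.η n (-(lam - c.ξ n - c.η / 2)) := by simp only [mul_assoc]
      _ = _ := by
        rw [R0_mul_R0_neg, smul_mul_assoc, one_mul, mul_smul_comm, ih, smul_smul, mul_smul_comm,
          mul_one, smul_mul_assoc, R0_mul_R0_neg, smul_smul]
        simp only [unitarityFactor, List.map_cons, List.prod_cons]
        congr 1
        ring

lemma Kminus_dual (lam : ℂ) : c.dual.Kminus lam = (c.Kminus lam).transpose := by
  ext i j
  fin_cases i <;> fin_cases j <;> simp [Kminus, dual, Kmat]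

lemma Kplus_dual (lam : ℂ) : c.dual.Kplus lam = (c.Kplus lam).transpose := by
  ext i j
  fin_cases i <;> fin_cases j <;> simp [Kplus, dual, Kmat]

lemma Upart_dual (l : List (Fin N)) (lam : ℂ) :
    c.dual.Upart l lam = fullTranspose (c.Upart l lam) := by
  induction l with
  | nil => simp only [Upart, fullTranspose_aux, Kminus_dual]
  | cons n l ih =>
    simp only [Upart, fullTranspose_mul, fullTranspose_R0, ih]
    simp only [dual, sub_neg_eq_add, ← sub_eq_add_neg, mul_assoc]

lemma prod_R0_commute {l : List (Fin N)} {n : Fin N} (hn : n ∉ l) (f : Fin N → ℂ)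
    (m : Matrix (Fin 2) (Fin 2) ℂ) (i j : Fin 2) :
    Commute (site n m) ((l.map fun n => R0 c.η n (f n)).prod i j) := by
  induction l generalizing i j with
  | nil =>
    by_cases hij : i = j
    · subst hij; simp
    · simp [hij]
  | cons k l ih =>
    rw [List.mem_cons, not_or] at hn
    simp only [List.map_cons, List.prod_cons, Matrix.mul_apply]
    exact Commute.sum_right _ _ _ fun a _ => (site_commute hn.1 _ _).mul_right (ih hn.2 _ _)

/-- Every factor contributes a sign and u → -u-η, and the order is reversed. This absorbs the
prefactor (-1)^N of `Mhat` and turns it into a plain product of R-matrices, which is what makes U a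
nested dressing. -/
lemma crossing_prod_R0 {l : List (Fin N)} (hl : l.Nodup) (f : Fin N → ℂ) :
    (-1 : ℂ) ^ l.length • crossing (l.map fun n => R0 c.η n (f n)).prod =
      (l.reverse.map fun n => R0 c.η n (-f n - c.η)).prod := by
  induction l with
  | nil =>
    ext i j : 1
    fin_cases i <;> fin_cases j <;> simp [crossing]
  | cons n l ih =>
    rw [List.nodup_cons] at hl
    have hcom : ∀ i j k m, Commute (R0 c.η n (f n) i j)
        ((l.map fun n => R0 c.η n (f n)).prod k m) :=
      fun i j k m => c.prod_R0_commute hl.1 f _ _ _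
    rw [List.map_cons, List.prod_cons, crossing_mul hcom,
      List.reverse_cons, List.map_append, List.prod_append, ← ih hl.2, crossing_R0]
    simp [pow_succ]

lemma Upart_eq_prod (l : List (Fin N)) (lam : ℂ) :
    c.Upart l lam = (l.map fun n => R0 c.η n (lam - c.ξ n - c.η / 2)).prod *
      aux N (c.Kminus lam) * (l.reverse.map fun n => R0 c.η n (lam + c.ξ n - c.η / 2)).prod := by
  induction l with
  | nil => simp [Upart]
  | cons n l ih => simp [Upart, ih, mul_assoc]

/-- All sites, the last one coming first. -/
def sites (N : ℕ) : List (Fin N) := (List.finRange N).reverse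

lemma sites_nodup : (sites N).Nodup := List.nodup_reverse.2 (List.nodup_finRange N)

lemma mem_sites (n : Fin N) : n ∈ sites N := by simp [sites]

lemma Uminus_eq_Upart (lam : ℂ) : c.Uminus lam = c.Upart (sites N) lam := by
  have hM : ∀ x, c.M x = ((sites N).map fun n => R0 c.η n (x - c.ξ n - c.η / 2)).prod := by
    intro x
    rw [M, sites, List.map_reverse, List.ofFn_eq_map]
  have hlen : (sites N).length = N := by simp [sites]
  rw [Upart_eq_prod, Uminus, Mhat, sigmaY_conj, hM, hM]
  congr 1
  have h := c.crossing_prod_R0 (sites_nodup (N := N)) fun n => -lam - c.ξ n - c.η / 2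
  rw [hlen] at h
  rw [h]
  congr 2
  funext n
  congr 1
  ring

lemma Uminus_reflection : ReflectionEq c.η c.Uminus := by
  rw [show c.Uminus = c.Upart (sites N) from funext c.Uminus_eq_Upart]
  exact c.Upart_reflection sites_nodup

lemma Uminus_parity : ParityRel c.η c.Uminus := by
  rw [show c.Uminus = c.Upart (sites N) from funext c.Uminus_eq_Upart]
  exact c.Upart_parity sites_nodup

lemma Uminus_dual (lam : ℂ) (i j : Fin 2) :
    c.dual.Uminus lam i j = (c.Uminus lam j i).transpose := by
  rw [Uminus_eq_Upart, Uminus_eq_Upart, Upart_dual, fullTranspose_apply]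

lemma Uminus_mul_Uminus (lam : ℂ) :
    c.Uminus lam * c.Uminus (c.η - lam) = c.unitarityFactor (sites N) lam • 1 := by
  rw [Uminus_eq_Upart, Uminus_eq_Upart, Upart_mul_Upart]

lemma transfer_dual (lam : ℂ) : c.dual.transfer lam = (c.transfer lam).transpose := by
  simp only [transfer, Kplus_dual, Matrix.trace, Matrix.diag, Fin.sum_univ_two, Matrix.mul_apply,
    Uminus_dual, aux, Matrix.map_apply, Matrix.transpose_apply, Algebra.algebraMap_eq_smul_one,
    smul_mul_assoc, one_mul, Matrix.transpose_add, Matrix.transpose_smul]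
  abel

lemma continuous_Uminus : Continuous c.Uminus := by
  have hR : ∀ (n : Fin N) (f : ℂ → ℂ), Continuous f → Continuous fun x => R0 c.η n (f x) := by
    intro n f hf
    refine continuous_matrix fun i j => continuous_matrix fun s t => ?_
    simp only [R0, site, Rmat, Matrix.of_apply]
    split_ifs <;> fun_prop
  have : ∀ l, Continuous (c.Upart l) := by
    intro l
    induction l with
    | nil =>
      refine continuous_matrix fun i j => ?_
      simp only [Upart, aux, Matrix.map_apply, Algebra.algebraMap_eq_smul_one]
      have h : Continuous fun x => c.Kminus x i j := by
        fin_cases i <;> fin_cases j <;> simp [Kminus, Kmat] <;> fun_prop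
      exact h.smul continuous_const
    | cons n l ih =>
      exact ((hR n (fun x => x - c.ξ n - c.η / 2) (by fun_prop)).matrix_mul ih).matrix_mul
        (hR n (fun x => x + c.ξ n - c.η / 2) (by fun_prop))
  rw [show c.Uminus = c.Upart (sites N) from funext c.Uminus_eq_Upart]
  exact this _

end Chain

end

/-! ### Exchange relations in the gauge with parameter y -/

section

section Exchange

variable {A : Type*} [Ring A] [Algebra ℂ A]

/-- The row `(1, -y e^{-λ})` times `U(λ)`. -/
def rowP (U : ℂ → Matrix (Fin 2) (Fin 2) A) (y lam : ℂ) (j : Fin 2) : A :=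
  U lam 0 j - (y * exp (-lam)) • U lam 1 j

/-- The gauge transformed operator `B`, without its normalization. -/
def opB (η : ℂ) (U : ℂ → Matrix (Fin 2) (Fin 2) A) (y lam : ℂ) : A :=
  (y * exp lam) • rowP U (y * exp η) lam 0 + rowP U (y * exp η) lam 1

/-- The second component of `U(λ)` times the column `(y e^λ, 1)`. -/
def colD (U : ℂ → Matrix (Fin 2) (Fin 2) A) (y lam : ℂ) : A :=
  (y * exp lam) • U lam 1 0 + U lam 1 1

set_option maxHeartbeats 1000000 in
-- This drives every later computation: moving `opB` past `rowP` shifts the gauge of `rowP`, and the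
-- error terms all have `opB y mu` on the left, so they disappear on a left state whose eigenvalue
-- vanishes at mu.
lemma ReflectionEq.exchange_opB_rowP {η : ℂ} {U : ℂ → Matrix (Fin 2) (Fin 2) A}
    (hU : ReflectionEq η U) (y lam mu : ℂ) :
    (sinh (lam - mu + η) * sinh (lam + mu - η)) • (opB η U y lam * rowP U (y * exp (-η)) mu 0) =
      (sinh (lam + mu) * sinh (lam - mu)) • (rowP U (y * exp η) mu 0 * opB η U y lam) +
      opB η U y mu * ((sinh η * sinh (lam - mu)) • colD U y lam +
        (sinh η * sinh (lam + mu - η)) • rowP U (y * exp (-η)) lam 0) := by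
  have re := fun i j k l => congrFun (congrFun (hU lam mu) (i, j)) (k, l)
  simp only [inOne, inTwo, scalarMap, Rmat, Matrix.mul_apply, Fintype.sum_prod_type,
    Fin.sum_univ_two, Matrix.of_apply, Matrix.map_apply] at re
  have h00 := re 0 0 0 0
  have h01 := re 0 1 0 0
  have h10 := re 1 0 0 0
  have h11 := re 1 1 0 0
  have g00 := re 0 0 1 0
  have g01 := re 0 1 1 0
  have g10 := re 1 0 1 0
  have g11 := re 1 1 1 0
  clear re hU
  simp [Algebra.algebraMap_eq_smul_one] at h00 h01 h10 h11 g00 g01 g10 g11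
  -- The reflection equation is contracted with the row (1, -y e^{-λ}) ⊗ (1, -y e^{η-μ}) on the left
  -- and with the column (y e^{λ-η}, 1) ⊗ (1, 0) on the right.
  linear_combination (norm := skip) (y * exp (-η) * exp lam) • h00 +
    (y * exp (-η) * exp lam * -(y * exp η * exp (-mu))) • h01 +
    (y * exp (-η) * exp lam * -(y * exp (-lam))) • h10 +
    (y * exp (-η) * exp lam * (y * y * exp η * exp (-lam) * exp (-mu))) • h11 +
    g00 + (-(y * exp η * exp (-mu))) • g01 + (-(y * exp (-lam))) • g10 +
    (y * y * exp η * exp (-lam) * exp (-mu)) • g11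
  clear h00 h01 h10 h11 g00 g01 g10 g11
  simp only [opB, rowP, colD, mul_add, add_mul, sub_mul, mul_sub, smul_mul_assoc, mul_smul_comm,
    smul_add, smul_sub, smul_smul, mul_assoc]
  match_scalars <;>
    (simp only [Complex.sinh, exp_add, exp_sub, exp_neg, neg_add, neg_sub]; field_simp) <;> ring

/-- The same left contraction as in `exchange_opB_rowP`, with the column (1, 0) ⊗ (1, 0). On a left
state where `opB` vanishes at both points the two `rowP` commute, up to scalars to be cancelled. -/
lemma ReflectionEq.exchange_rowP_rowP {η : ℂ} {U : ℂ → Matrix (Fin 2) (Fin 2) A}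
    (hU : ReflectionEq η U) (y lam mu : ℂ) :
    sinh (lam - mu + η) • (sinh (lam + mu) •
        (rowP U (y * exp η) lam 0 * rowP U (y * exp η) mu 0) +
          sinh η • (opB η U y lam * U mu 1 0)) =
      sinh (lam - mu + η) • (sinh (lam + mu) •
        (rowP U (y * exp η) mu 0 * rowP U (y * exp η) lam 0) +
          sinh η • (opB η U y mu * U lam 1 0)) := by
  have re := fun i j => congrFun (congrFun (hU lam mu) (i, j)) (0, 0)
  simp only [inOne, inTwo, scalarMap, Rmat, Matrix.mul_apply, Fintype.sum_prod_type,
    Fin.sum_univ_two, Matrix.of_apply, Matrix.map_apply] at re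
  have h00 := re 0 0
  have h01 := re 0 1
  have h10 := re 1 0
  have h11 := re 1 1
  clear re hU
  simp [Algebra.algebraMap_eq_smul_one] at h00 h01 h10 h11
  linear_combination (norm := skip) h00 + (-(y * exp η * exp (-mu))) • h01 +
    (-(y * exp (-lam))) • h10 + (y * y * exp η * exp (-lam) * exp (-mu)) • h11
  clear h00 h01 h10 h11
  simp only [opB, rowP, add_mul, sub_mul, mul_sub, smul_mul_assoc, mul_smul_comm,
    smul_add, smul_sub, smul_smul, mul_assoc]
  match_scalars <;>
    (simp only [Complex.sinh, exp_add, exp_sub, exp_neg, neg_add, neg_sub]; field_simp) <;> ring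

/-- The row (0, 1) of the parity relation, with the column (v e^λ, 1) in the first auxiliary space
and (1, 0) in the second. It lets `colD` be replaced by `rowP` wherever `rowP` at -λ vanishes. -/
lemma ParityRel.rowP_neg {η : ℂ} {U : ℂ → Matrix (Fin 2) (Fin 2) A}
    (hU : ParityRel η U) (v lam : ℂ) :
    sinh (2 * lam - η) • rowP U v (-lam) 0 =
      sinh (2 * lam) • colD U (v * exp η) lam - sinh η • rowP U v lam 0 := by
  have re := fun k l => congrFun (congrFun (hU lam) (0, 1)) (k, l)
  simp only [inOne, inTwo, scalarMap, Rmat, Matrix.mul_apply, Fintype.sum_prod_type,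
    Fin.sum_univ_two, Matrix.of_apply, Matrix.map_apply, singlet, Matrix.smul_apply] at re
  have h00 := re 0 0
  have h10 := re 1 0
  clear re hU
  simp [Algebra.algebraMap_eq_smul_one] at h00 h10
  linear_combination (norm := skip) (v * exp lam) • h00 + h10
  clear h00 h10
  simp only [rowP, colD, smul_add, smul_sub, smul_smul, neg_neg]
  have hh : exp (lam * 2) = exp lam * exp lam := by rw [mul_two, exp_add]
  match_scalars <;>
    (simp only [Complex.sinh, exp_add, exp_sub, exp_neg, neg_add, neg_sub, mul_comm (2 : ℂ), hh];
     field_simp) <;> ring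

end Exchange

end

/-! ### Gauge vectors passing through the sites: the reference covector -/

section

variable {N : ℕ}

section Dressing

variable {A : Type*} [Ring A] [Algebra ℂ A]

/-- One site of the left half of the dressing: if the local factor L carries the gauge row of slope
w to that of slope w', the row for the dressed matrix reduces to the row for the inner matrix V. -/
lemma dress_row {Z Z1 : A} {L V L' : Matrix (Fin 2) (Fin 2) A} {w w' a : ℂ}
    (h0 : Z * (L 0 0 - w • L 1 0) = a • Z1) (h1 : Z * (L 0 1 - w • L 1 1) = (a * -w') • Z1)
    (j : Fin 2) :
    Z * ((L * V * L') 0 j - w • (L * V * L') 1 j) =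
      a • (Z1 * (V 0 0 - w' • V 1 0) * L' 0 j + Z1 * (V 0 1 - w' • V 1 1) * L' 1 j) := by
  simp only [Matrix.mul_apply, Fin.sum_univ_two]
  have p0 := congrArg (fun X => X * V 0 0 * L' 0 j + X * V 0 1 * L' 1 j) h0
  have p1 := congrArg (fun X => X * V 1 0 * L' 0 j + X * V 1 1 * L' 1 j) h1
  linear_combination (norm := skip) p0 + p1
  simp only [mul_add, add_mul, sub_mul, mul_sub, smul_mul_assoc, mul_smul_comm, smul_add,
    mul_assoc, smul_sub, smul_smul]
  module

/-- The right half of the dressing. The inner row entries commute with L', so L' can first act on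
the covector, where it turns the gauge column into the one of the inner matrix. -/
lemma dress_col {Z Z' P0 P1 : A} {L' : Matrix (Fin 2) (Fin 2) A} {s s' b : ℂ}
    (hc0 : ∀ k m, P0 * L' k m = L' k m * P0) (hc1 : ∀ k m, P1 * L' k m = L' k m * P1)
    (h0 : Z * (s • L' 0 0 + L' 0 1) = (b * s') • Z') (h1 : Z * (s • L' 1 0 + L' 1 1) = b • Z') :
    s • (Z * P0 * L' 0 0 + Z * P1 * L' 1 0) + (Z * P0 * L' 0 1 + Z * P1 * L' 1 1) =
      b • (Z' * (s' • P0 + P1)) := by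
  simp only [mul_assoc, hc0, hc1]
  have p0 := congrArg (fun X => X * P0) h0
  have p1 := congrArg (fun X => X * P1) h1
  linear_combination (norm := skip) p0 + p1
  simp only [mul_add, add_mul, smul_mul_assoc, mul_smul_comm, smul_add, mul_assoc, smul_smul]
  module

end Dressing

/-- The operator all of whose rows are the covector `ℓ`. -/
def rowOp (ℓ : Vec N) : Op N := Matrix.of fun _ t => ℓ t

lemma rowOp_mul (ℓ : Vec N) (X : Op N) : rowOp ℓ * X = rowOp (Matrix.vecMul ℓ X) := by
  ext s t
  simp [rowOp, Matrix.mul_apply, Matrix.vecMul, dotProduct]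

lemma rowOp_smul (a : ℂ) (ℓ : Vec N) : rowOp (a • ℓ) = a • rowOp ℓ := by
  ext s t
  simp [rowOp]

namespace Chain

variable (c : Chain N)

/-- Product covector with components `(1, -zₙ e^{-(ξₙ+η/2)})`. -/
def zState (z : Fin N → ℂ) : Vec N :=
  prodState fun n => ![1, -(z n * exp (-(c.ξ n + c.η / 2)))]

lemma zState_site (z : Fin N → ℂ) (n : Fin N) (w a : ℂ) (m : Matrix (Fin 2) (Fin 2) ℂ)
    (h0 : m 0 0 - z n * exp (-(c.ξ n + c.η / 2)) * m 1 0 = a)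
    (h1 : m 0 1 - z n * exp (-(c.ξ n + c.η / 2)) * m 1 1 =
      -(a * (w * exp (-(c.ξ n + c.η / 2))))) :
    rowOp (c.zState z) * site n m = a • rowOp (c.zState (Function.update z n w)) := by
  rw [rowOp_mul, zState, vecMul_prodState_site, ← rowOp_smul]
  congr 1
  funext s
  simp only [zState, prodState, Pi.smul_apply, smul_eq_mul]
  rw [Fintype.prod_eq_mul_prod_compl n,
    Fintype.prod_eq_mul_prod_compl n (fun i => ![1, -(Function.update z n w i *
      exp (-(c.ξ i + c.η / 2)))] (s i)), ← mul_assoc]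
  congr 1
  · simp only [Function.update_self]
    generalize s n = x
    fin_cases x
    · simpa [Matrix.vecMul, dotProduct, Fin.sum_univ_two, sub_eq_add_neg] using h0
    · simpa [Matrix.vecMul, dotProduct, Fin.sum_univ_two, sub_eq_add_neg] using h1
  · refine Finset.prod_congr rfl fun k hk => ?_
    have : k ≠ n := by simpa using hk
    simp [this]

/-- The local intertwining of vertex and face type: on a site tuned to parameter w e^η the gauge row
passes through R with its own parameter multiplied by e^η, while the parameter of the site drops to
w. -/
lemma zState_row (z : Fin N → ℂ) (n : Fin N) (w lam : ℂ) (hz : z n = w * exp c.η) (j : Fin 2) :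
    rowOp (c.zState z) * (R0 c.η n (lam - c.ξ n - c.η / 2) 0 j -
        (w * exp (-lam)) • R0 c.η n (lam - c.ξ n - c.η / 2) 1 j) =
      (sinh (lam - c.ξ n + c.η / 2) * ![1, -(w * exp c.η * exp (-lam))] j) •
        rowOp (c.zState (Function.update z n w)) := by
  rw [R0_eq_map, Matrix.map_apply, Matrix.map_apply, ← map_smul, ← map_sub, siteHom_apply]
  have e : exp c.η = exp (c.η / 2) * exp (c.η / 2) := by rw [← exp_add]; ring_nf
  apply zState_site <;> rw [ell_eq, hz] <;> fin_cases j <;> simp <;>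
    (simp only [Complex.sinh, exp_add, exp_sub, exp_neg, neg_sub, e]; field_simp) <;> ring

lemma zState_col (z : Fin N → ℂ) (n : Fin N) (y lam : ℂ) (hz : z n = y * exp c.η) (i : Fin 2) :
    rowOp (c.zState z) * ((y * exp lam) • R0 c.η n (lam + c.ξ n - c.η / 2) i 0 +
        R0 c.η n (lam + c.ξ n - c.η / 2) i 1) =
      (sinh (lam + c.ξ n - c.η / 2) * ![y * exp c.η * exp lam, 1] i) •
        rowOp (c.zState (Function.update z n y)) := by
  rw [R0_eq_map, Matrix.map_apply, Matrix.map_apply, ← map_smul, ← map_add, siteHom_apply]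
  have e : exp c.η = exp (c.η / 2) * exp (c.η / 2) := by rw [← exp_add]; ring_nf
  apply zState_site <;> rw [ell_eq, hz] <;> fin_cases i <;> simp <;>
    (simp only [Complex.sinh, exp_add, exp_sub, exp_neg, neg_add, neg_sub, e]; field_simp) <;> ring

/-- The parameters of the sites in `l` are `y q², y q³, …` with `q = e^η`. -/
def IsStaircase (z : Fin N → ℂ) : ℂ → List (Fin N) → Prop
  | _, [] => True
  | y, n :: l => z n = y * exp c.η * exp c.η ∧ IsStaircase z (y * exp c.η) l

lemma IsStaircase.congr {z z' : Fin N → ℂ} {y : ℂ} {l : List (Fin N)} (h : c.IsStaircase z y l)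
    (hz : ∀ n ∈ l, z' n = z n) : c.IsStaircase z' y l := by
  induction l generalizing y with
  | nil => trivial
  | cons n l ih =>
    exact ⟨(hz n (by simp)).trans h.1, ih h.2 fun k hk => hz k (by simp [hk])⟩

/-- The eigenvalue factor of the boundary matrix. -/
def boundaryFactor (Y : ℂ) : ℂ :=
  (c.minus.κ * exp c.minus.τ - c.minus.κ * (Y * exp (c.η / 2)) ^ 2 * exp (-c.minus.τ) +
    Y * exp (c.η / 2) * exp c.minus.ζ) / sinh c.minus.ζ

lemma opB_aux (Y lam : ℂ) : opB c.η (c.Upart []) Y lam =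
    (sinh (2 * lam - c.η) * c.boundaryFactor Y) • (1 : Op N) := by
  simp only [opB, rowP, Upart, aux, Matrix.map_apply, Algebra.algebraMap_eq_smul_one, Kminus, Kmat,
    boundaryFactor, div_eq_mul_inv _ (sinh c.minus.ζ)]
  generalize (sinh c.minus.ζ)⁻¹ = k
  have e : exp c.η = exp (c.η / 2) * exp (c.η / 2) := by rw [← exp_add]; ring_nf
  have hh : exp (lam * 2) = exp lam * exp lam := by rw [mul_two, exp_add]
  simp
  match_scalars
  simp only [Complex.sinh, exp_add, exp_sub, exp_neg, neg_add, neg_sub, mul_comm (2 : ℂ), hh, e]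
  field_simp
  ring

/-- Only the prefactor matters: it vanishes at λ = ξ_m - η/2 for every site m in l, so the gauge row
annihilates the reference covector there. -/
lemma zState_rowP {l : List (Fin N)} (hl : l.Nodup) (z : Fin N → ℂ) (y lam : ℂ)
    (hz : c.IsStaircase z y l) : ∃ Q : Fin 2 → Op N, ∀ j,
    rowOp (c.zState z) * rowP (c.Upart l) (y * exp c.η) lam j =
      (l.map fun n => sinh (lam - c.ξ n + c.η / 2)).prod • Q j := by
  induction l generalizing z y with
  | nil => exact ⟨fun j => rowOp (c.zState z) * rowP (c.Upart []) (y * exp c.η) lam j, by simp⟩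
  | cons n l ih =>
    rw [List.nodup_cons] at hl
    obtain ⟨Q, hQ⟩ := ih hl.2 (Function.update z n (y * exp c.η)) (y * exp c.η)
      (hz.2.congr c fun k hk => Function.update_of_ne (by rintro rfl; exact hl.1 hk) _ _)
    refine ⟨fun j => Q 0 * R0 c.η n (lam + c.ξ n - c.η / 2) 0 j +
      Q 1 * R0 c.η n (lam + c.ξ n - c.η / 2) 1 j, fun j => ?_⟩
    have r0 := c.zState_row z n (y * exp c.η) lam hz.1 0
    have r1 := c.zState_row z n (y * exp c.η) lam hz.1 1
    have d := dress_row (V := c.Upart l lam) (L' := R0 c.η n (lam + c.ξ n - c.η / 2))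
      (a := sinh (lam - c.ξ n + c.η / 2)) (by simpa using r0) (by simpa using r1) j
    refine d.trans ?_
    have q0 := hQ 0
    have q1 := hQ 1
    simp only [rowP] at q0 q1
    rw [q0, q1]
    simp only [List.map_cons, List.prod_cons, smul_mul_assoc, ← smul_add, smul_smul]

/-- Each site is met twice, by the gauge row and by the gauge column, and its parameter falls by
e^{-η} each time. The gauge seen by the inner layers grows by e^η per site, which is the reason for
the staircase condition and for the argument of `boundaryFactor`. -/
lemma zState_opB {l : List (Fin N)} (hl : l.Nodup) (z : Fin N → ℂ) (y lam : ℂ)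
    (hz : c.IsStaircase z y l) :
    rowOp (c.zState z) * opB c.η (c.Upart l) y lam =
      (sinh (2 * lam - c.η) * c.boundaryFactor (y * exp c.η ^ l.length) *
        (l.map fun n => sinh (lam - c.ξ n + c.η / 2) * sinh (lam + c.ξ n - c.η / 2)).prod) •
      rowOp (c.zState fun n => if n ∈ l then z n * exp (-(2 * c.η)) else z n) := by
  induction l generalizing z y with
  | nil => simp [opB_aux]
  | cons n l ih =>
    rw [List.nodup_cons] at hl
    have hz2 : c.IsStaircase (Function.update z n y)
        (y * exp c.η) l := by
      refine hz.2.congr c fun k hk => ?_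
      have : k ≠ n := by rintro rfl; exact hl.1 hk
      simp [this]
    have h0 := ih hl.2 _ _ hz2
    have r0 := c.zState_row z n (y * exp c.η) lam hz.1 0
    have r1 := c.zState_row z n (y * exp c.η) lam hz.1 1
    -- By now the row has lowered the parameter of site n to y e^η, exactly the value the column
    -- needs.
    have s0 := c.zState_col (Function.update z n (y * exp c.η)) n y lam (by simp) 0
    have s1 := c.zState_col (Function.update z n (y * exp c.η)) n y lam (by simp) 1
    rw [Function.update_idem] at s0 s1
    have hcomm : ∀ i j k m, c.Upart l lam i j * R0 c.η n (lam + c.ξ n - c.η / 2) k m =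
        R0 c.η n (lam + c.ξ n - c.η / 2) k m * c.Upart l lam i j :=
      fun i j k m => c.Upart_commute_site hl.1 _ _ _ _
    have hfin : (fun k => if k ∈ l then Function.update z n y k *
        exp (-(2 * c.η)) else Function.update z n y k) =
        fun k => if k ∈ n :: l then z k * exp (-(2 * c.η)) else z k := by
      funext k
      by_cases hk : k = n
      · subst hk
        have e : exp (-(2 * c.η)) * (exp c.η * exp c.η) = 1 := by
          rw [← exp_add, ← exp_add]; ring_nf; simp
        simp only [hl.1, if_false, Function.update_self, List.mem_cons, true_or, if_true, hz.1]
        linear_combination (-y) * e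
      · simp [hk]
    rw [hfin, mul_assoc y, ← pow_succ'] at h0
    have d := dress_row (V := c.Upart l lam) (L' := R0 c.η n (lam + c.ξ n - c.η / 2))
      (a := sinh (lam - c.ξ n + c.η / 2)) (by simpa using r0) (by simpa using r1)
    have d0 := d 0
    have d1 := d 1
    have hP : ∀ j k m, (c.Upart l lam 0 j - (y * exp c.η * exp c.η * exp (-lam)) •
        c.Upart l lam 1 j) * R0 c.η n (lam + c.ξ n - c.η / 2) k m =
        R0 c.η n (lam + c.ξ n - c.η / 2) k m * (c.Upart l lam 0 j -
          (y * exp c.η * exp c.η * exp (-lam)) • c.Upart l lam 1 j) := fun j k m => by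
      rw [sub_mul, mul_sub, smul_mul_assoc, mul_smul_comm, hcomm, hcomm]
    have e := dress_col (b := sinh (lam + c.ξ n - c.η / 2)) (hP 0) (hP 1) (by simpa using s0)
      (by simpa using s1)
    simp only [opB, rowP] at h0
    rw [h0] at e
    simp only [opB, rowP, Upart, mul_add, mul_smul_comm]
    rw [d0, d1, smul_comm (y * exp lam), ← smul_add, e]
    simp only [List.map_cons, List.prod_cons, List.length_cons, smul_smul]
    congr 1
    ring

end Chain

end

/-! ### Left pseudo-eigenstates of B -/

section

lemma two_mul_sinh_mul_sinh (x y : ℂ) :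
    2 * (sinh (x + y) * sinh (x - y)) = cosh (2 * x) - cosh (2 * y) := by
  rw [Complex.sinh_add, Complex.sinh_sub, Complex.cosh_two_mul, Complex.cosh_two_mul]
  linear_combination (2 * cosh x ^ 2 - 1) * Complex.cosh_sq y - (2 * cosh y ^ 2 - 1) *
    Complex.cosh_sq x

/-- A zero of `sinh` is isolated, so that it can be cancelled from identities between continuous
functions. -/
lemma eq_zero_of_sinh_mul {f : ℂ → ℂ} (hf : Continuous f) {a : ℂ} (ha : a ≠ 0) (b : ℂ)
    (h : ∀ z, sinh (a * z + b) * f z = 0) (z : ℂ) : f z = 0 := by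
  by_contra hz
  have h1 : ∀ᶠ w in nhds z, f w ≠ 0 := hf.continuousAt.eventually_ne hz
  have h2 : (fun w => sinh (a * w + b)) =ᶠ[nhds z] fun _ => 0 := by
    filter_upwards [h1] with w hw
    exact (mul_eq_zero.1 (h w)).resolve_right hw
  have h3 : HasDerivAt (fun w => sinh (a * w + b)) (cosh (a * z + b) * (a * 1)) z :=
    (((hasDerivAt_id z).const_mul a).add_const b).csinh
  have h4 : cosh (a * z + b) * (a * 1) = 0 :=
    (h3.congr_of_eventuallyEq h2.symm).unique (hasDerivAt_const z 0)
  have h5 : sinh (a * z + b) = 0 := h2.self_of_nhds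
  have h6 := Complex.cosh_sq (a * z + b)
  rw [h5] at h6
  rcases mul_eq_zero.1 h4 with h7 | h7
  · rw [h7] at h6; norm_num at h6
  · exact ha (by simpa using h7)

variable {N : ℕ}

lemma op_eq_zero_of_sinh_mul {f : ℂ → Op N} (hf : Continuous f) {a : ℂ} (ha : a ≠ 0) (b : ℂ)
    (h : ∀ z, sinh (a * z + b) • f z = 0) (z : ℂ) : f z = 0 := by
  ext s t
  refine eq_zero_of_sinh_mul (f := fun z => f z s t) (hf.matrix_elem s t) ha b (fun z => ?_) z
  exact congrFun (congrFun (h z) s) t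

namespace Chain

variable (c : Chain N)

/-- The pseudo-spectrum is simple. -/
def SimpleSpectrum : Prop := Function.Injective fun p : Fin N × Fin 2 => c.etaPt p.1 p.2

/-- The point `η/2 - ξₙ`. -/
def node (n : Fin N) : ℂ := c.η / 2 - c.ξ n

/-- The parameters of the reference state. -/
def refZ (y : ℂ) (n : Fin N) : ℂ := y * exp c.η ^ (N + 1 - (n : ℕ))

lemma isStaircase_of_getElem (z : Fin N → ℂ) (l : List (Fin N)) (y : ℂ)
    (h : ∀ (i : ℕ) (hi : i < l.length), z l[i] = y * exp c.η ^ (i + 2)) :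
    c.IsStaircase z y l := by
  induction l generalizing y with
  | nil => trivial
  | cons n l ih =>
    refine ⟨?_, ih _ fun i hi => ?_⟩
    · have := h 0 (by simp)
      rw [List.getElem_cons_zero] at this
      rw [this]
      ring
    · have := h (i + 1) (by simpa using hi)
      rw [List.getElem_cons_succ] at this
      rw [this]
      ring

lemma refZ_isStaircase (y : ℂ) : c.IsStaircase (c.refZ y) y (sites N) := by
  refine c.isStaircase_of_getElem _ _ _ fun i hi => ?_
  have hi' : i < N := by simpa [sites] using hi
  simp only [sites, List.getElem_reverse, List.length_finRange, List.getElem_finRange, refZ]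
  congr 2
  simp
  omega

lemma prod_sites (f : Fin N → ℂ) : ((sites N).map f).prod = ∏ n, f n := by
  rw [Fin.prod_univ_def, sites]
  exact ((List.reverse_perm _).map f).prod_eq

/-- The pseudo-eigenvalue of `B` on the left state labelled by the set of sites in `S`. -/
def eigB (y : ℂ) (S : List (Fin N)) (lam : ℂ) : ℂ :=
  sinh (2 * lam - c.η) * c.boundaryFactor (y * exp c.η ^ N) *
    ∏ n, ((cosh (2 * lam) - c.etaPt n (if n ∈ S then 1 else 0)) / 2)

/-- The left reference state. -/
def refState (y : ℂ) : Op N := rowOp (c.zState (c.refZ y))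

lemma etaPt_zero (n : Fin N) : c.etaPt n 0 = cosh (2 * c.ξ n - c.η) := by
  simp only [etaPt, zetaPt]; congr 1; simp; ring

lemma etaPt_one (n : Fin N) : c.etaPt n 1 = cosh (2 * c.ξ n + c.η) := by
  simp only [etaPt, zetaPt]; congr 1; simp; ring

lemma cosh_two_node (n : Fin N) : cosh (2 * c.node n) = c.etaPt n 0 := by
  rw [etaPt_zero, ← Complex.cosh_neg, node]; congr 1; ring

lemma cosh_two_neg_node (n : Fin N) : cosh (2 * -c.node n) = c.etaPt n 0 := by
  rw [← cosh_two_node, ← Complex.cosh_neg]; congr 1; ring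

lemma refState_opB (y lam : ℂ) : c.refState y * opB c.η c.Uminus y lam =
    c.eigB y [] lam • c.refState (y * exp (-(2 * c.η))) := by
  rw [show c.Uminus = c.Upart (sites N) from funext c.Uminus_eq_Upart, refState,
    c.zState_opB sites_nodup _ _ _ (c.refZ_isStaircase y), prod_sites]
  congr 1
  · rw [eigB]
    congr 1
    · simp [sites]
    · refine Finset.prod_congr rfl fun n _ => ?_
      have := two_mul_sinh_mul_sinh lam (c.ξ n - c.η / 2)
      rw [show 2 * (c.ξ n - c.η / 2) = 2 * c.ξ n - c.η by ring, ← etaPt_zero,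
        show lam + (c.ξ n - c.η / 2) = lam + c.ξ n - c.η / 2 by ring,
        show lam - (c.ξ n - c.η / 2) = lam - c.ξ n + c.η / 2 by ring] at this
      simp only [List.not_mem_nil, if_false]
      linear_combination this / 2
  · rw [refState]
    congr 2
    funext n
    rw [if_pos (mem_sites n), refZ, refZ]
    ring

/-- The left states, labelled by lists of sites. -/
def leftSt (y : ℂ) : List (Fin N) → Op N
  | [] => c.refState y
  | n :: S => leftSt y S * rowP c.Uminus (y * exp c.η) (c.node n) 0

lemma eigB_eq_zero {S : List (Fin N)} {n : Fin N} {y lam : ℂ}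
    (h : cosh (2 * lam) = c.etaPt n (if n ∈ S then 1 else 0)) : c.eigB y S lam = 0 := by
  rw [eigB, Finset.prod_eq_zero (Finset.mem_univ n) (by rw [h, sub_self, zero_div]), mul_zero]

lemma eigB_node {S : List (Fin N)} {n : Fin N} (hn : n ∉ S) (y : ℂ) :
    c.eigB y S (c.node n) = 0 :=
  c.eigB_eq_zero (n := n) (by rw [if_neg hn, cosh_two_node])

lemma eigB_neg_node {S : List (Fin N)} {n : Fin N} (hn : n ∉ S) (y : ℂ) :
    c.eigB y S (-c.node n) = 0 :=
  c.eigB_eq_zero (n := n) (by rw [if_neg hn, cosh_two_neg_node])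

lemma exp_shift (y η : ℂ) : y * exp (-(2 * η)) * exp η = y * exp (-η) := by
  rw [mul_assoc, ← exp_add]; congr 2; ring

/-- Adding m changes a single factor of the eigenvalue, from cosh 2λ - η_m^{(0)} to cosh 2λ -
η_m^{(1)}. Both factor into products of sinh, namely those occurring in the exchange relation. -/
lemma eigB_cons {S : List (Fin N)} {m : Fin N} (hm : m ∉ S) (y lam : ℂ) :
    sinh (lam - c.node m + c.η) * sinh (lam + c.node m - c.η) * c.eigB y S lam =
      sinh (lam + c.node m) * sinh (lam - c.node m) * c.eigB y (m :: S) lam := by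
  have h1 := two_mul_sinh_mul_sinh lam (c.node m)
  have h2 := two_mul_sinh_mul_sinh lam (c.η - c.node m)
  rw [cosh_two_node] at h1
  rw [show 2 * (c.η - c.node m) = 2 * c.ξ m + c.η by rw [node]; ring, ← etaPt_one,
    show lam + (c.η - c.node m) = lam - c.node m + c.η by ring,
    show lam - (c.η - c.node m) = lam + c.node m - c.η by ring] at h2
  have h3 : ∏ n ∈ {m}ᶜ, ((cosh (2 * lam) - c.etaPt n (if n ∈ m :: S then 1 else 0)) / 2) =
      ∏ n ∈ {m}ᶜ, ((cosh (2 * lam) - c.etaPt n (if n ∈ S then 1 else 0)) / 2) := by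
    refine Finset.prod_congr rfl fun n hn => ?_
    have : n ≠ m := by simpa using hn
    simp [this]
  rw [eigB, eigB, Fintype.prod_eq_mul_prod_compl m, Fintype.prod_eq_mul_prod_compl m, h3]
  simp only [hm, if_false, List.mem_cons, true_or, if_true]
  generalize (∏ n ∈ {m}ᶜ, ((cosh (2 * lam) - c.etaPt n (if n ∈ S then 1 else 0)) / 2)) = p
  generalize sinh (lam - c.node m + c.η) * sinh (lam + c.node m - c.η) = u at *
  generalize sinh (lam + c.node m) * sinh (lam - c.node m) = v at *
  rw [← h1, ← h2]
  ring

lemma continuous_rowP (f g : ℂ → ℂ) (hf : Continuous f) (hg : Continuous g) (j : Fin 2) :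
    Continuous fun x => rowP c.Uminus (f x) (g x) j := by
  have h := fun i k => ((c.continuous_Uminus.comp hg).matrix_elem i k)
  exact (h 0 j).sub
    ((show Continuous fun x => f x * exp (-g x) by fun_prop).smul (h 1 j))

lemma continuous_opB (f g : ℂ → ℂ) (hf : Continuous f) (hg : Continuous g) :
    Continuous fun x => opB c.η c.Uminus (f x) (g x) :=
  have hf' : Continuous fun x => f x * exp c.η := by fun_prop
  ((show Continuous fun x => f x * exp (g x) by fun_prop).smul
    (c.continuous_rowP _ g hf' hg 0)).add (c.continuous_rowP _ g hf' hg 1)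

lemma continuous_eigB (y : ℂ) (S : List (Fin N)) : Continuous fun x => c.eigB y S x := by
  unfold eigB
  fun_prop

/-- The left states are pseudo-eigenstates of `B`. -/
theorem leftSt_opB {S : List (Fin N)} (hS : S.Nodup) (y lam : ℂ) :
    c.leftSt y S * opB c.η c.Uminus y lam =
      c.eigB y S lam • c.leftSt (y * exp (-(2 * c.η))) S := by
  induction S generalizing lam with
  | nil => exact c.refState_opB y lam
  | cons m S ih =>
    rw [List.nodup_cons] at hS
    have ih := ih hS.2
    rw [← sub_eq_zero]
    set f : ℂ → Op N := fun x => c.leftSt y (m :: S) * opB c.η c.Uminus y x -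
      c.eigB y (m :: S) x • c.leftSt (y * exp (-(2 * c.η))) (m :: S) with hf
    have hfc : Continuous f :=
      (Continuous.matrix_mul continuous_const (c.continuous_opB _ _ continuous_const
        continuous_id)).sub ((c.continuous_eigB y (m :: S)).smul continuous_const)
    -- Exchange relation at μ = η/2 - ξ_m: as m is not in S, `opB` at μ annihilates the state and
    -- only the wanted term survives. The sinh factors are then cancelled by continuity in x.
    have key : ∀ x, (sinh (x + c.node m) * sinh (x - c.node m)) • f x = 0 := by
      intro x
      have h := congrArg (fun X => c.leftSt y S * X)
        (c.Uminus_reflection.exchange_opB_rowP y x (c.node m))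
      simp only [mul_add, mul_smul_comm, ← mul_assoc, ih x, ih (c.node m),
        c.eigB_node hS.1 y, zero_smul, zero_mul, smul_zero, add_zero, smul_mul_assoc, smul_smul]
        at h
      rw [c.eigB_cons hS.1, ← exp_shift y c.η] at h
      simp only [hf, leftSt, smul_sub, smul_smul]
      rw [← h, sub_self]
    have key1 : ∀ x, sinh (x - c.node m) • f x = 0 := by
      refine op_eq_zero_of_sinh_mul (a := 1) ((show Continuous fun x => sinh (x - c.node m) by fun_prop).smul hfc) one_ne_zero
        (c.node m) fun x => ?_
      rw [one_mul, smul_smul, key]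
    exact op_eq_zero_of_sinh_mul (a := 1) hfc one_ne_zero (-c.node m)
      (fun x => by rw [one_mul, ← sub_eq_add_neg, key1]) lam

/-- Where `opB` annihilates the state, the two entries of the gauge row act proportionally, so every
contraction with a column reduces to the first entry. -/
lemma leftSt_rowP_one {S : List (Fin N)} (hS : S.Nodup) {y lam : ℂ} (h : c.eigB y S lam = 0) :
    c.leftSt y S * rowP c.Uminus (y * exp c.η) lam 1 =
      -((y * exp lam) • (c.leftSt y S * rowP c.Uminus (y * exp c.η) lam 0)) := by
  have h1 := c.leftSt_opB hS y lam
  rw [h, zero_smul, opB, mul_add, mul_smul_comm] at h1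
  exact eq_neg_of_add_eq_zero_right h1

/-- These are the factors of η_m^{(1)} - η_k^{(0)} and η_m^{(0)} - η_k^{(0)}. -/
lemma SimpleSpectrum.sinh_ne {c : Chain N} (hc : c.SimpleSpectrum) {m k : Fin N} (hmk : m ≠ k) :
    sinh (c.ξ m + c.ξ k) ≠ 0 ∧ sinh (c.ξ m - c.ξ k) ≠ 0 ∧ sinh (c.ξ m + c.ξ k - c.η) ≠ 0 ∧
      sinh (c.ξ m - c.ξ k + c.η) ≠ 0 := by
  have h1 : c.etaPt m 0 ≠ c.etaPt k 0 := fun h => hmk (congrArg Prod.fst (@hc (m, 0) (k, 0) h))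
  have h2 : c.etaPt m 1 ≠ c.etaPt k 0 := fun h => hmk (congrArg Prod.fst (@hc (m, 1) (k, 0) h))
  have e1 := two_mul_sinh_mul_sinh (c.ξ m - c.η / 2) (c.ξ k - c.η / 2)
  have e2 := two_mul_sinh_mul_sinh (c.ξ m + c.η / 2) (c.ξ k - c.η / 2)
  rw [show 2 * (c.ξ m - c.η / 2) = 2 * c.ξ m - c.η by ring,
    show 2 * (c.ξ k - c.η / 2) = 2 * c.ξ k - c.η by ring, ← etaPt_zero, ← etaPt_zero,
    show c.ξ m - c.η / 2 + (c.ξ k - c.η / 2) = c.ξ m + c.ξ k - c.η by ring,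
    show c.ξ m - c.η / 2 - (c.ξ k - c.η / 2) = c.ξ m - c.ξ k by ring] at e1
  rw [show 2 * (c.ξ m + c.η / 2) = 2 * c.ξ m + c.η by ring,
    show 2 * (c.ξ k - c.η / 2) = 2 * c.ξ k - c.η by ring, ← etaPt_zero, ← etaPt_one,
    show c.ξ m + c.η / 2 + (c.ξ k - c.η / 2) = c.ξ m + c.ξ k by ring,
    show c.ξ m + c.η / 2 - (c.ξ k - c.η / 2) = c.ξ m - c.ξ k + c.η by ring] at e2
  refine ⟨fun h => h2 ?_, fun h => h1 ?_, fun h => h1 ?_, fun h => h2 ?_⟩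
  · rw [h] at e2; linear_combination -e2
  · rw [h] at e1; linear_combination -e1
  · rw [h] at e1; linear_combination -e1
  · rw [h] at e2; linear_combination -e2

/-- True on the reference covector by the zero of the prefactor in `zState_rowP`. It propagates
along S because `rowP` at -(η/2 - ξ_m) commutes through the earlier factors, the `opB` terms
vanishing at both points. -/
lemma leftSt_rowP_neg_node (hc : c.SimpleSpectrum) {S : List (Fin N)} (hS : S.Nodup) {m : Fin N}
    (hm : m ∉ S) (y : ℂ) : c.leftSt y S * rowP c.Uminus (y * exp c.η) (-c.node m) 0 = 0 := by
  induction S with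
  | nil =>
    obtain ⟨Q, hQ⟩ := c.zState_rowP (sites_nodup (N := N)) _ y (-c.node m) (c.refZ_isStaircase y)
    have h := hQ 0
    rw [prod_sites, Finset.prod_eq_zero (Finset.mem_univ m), zero_smul] at h
    · rw [show c.Uminus = c.Upart (sites N) from funext c.Uminus_eq_Upart]
      exact h
    · rw [node, show -(c.η / 2 - c.ξ m) - c.ξ m + c.η / 2 = 0 by ring, Complex.sinh_zero]
  | cons k S ih =>
    rw [List.nodup_cons] at hS
    rw [List.mem_cons, not_or] at hm
    obtain ⟨s1, s2, -, -⟩ := hc.sinh_ne hm.1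
    have h := congrArg (fun X => c.leftSt y S * X)
      (c.Uminus_reflection.exchange_rowP_rowP y (-c.node m) (c.node k))
    simp only [mul_add, mul_smul_comm, ← mul_assoc, ih hS.2 hm.2, c.leftSt_opB hS.2,
      c.eigB_node hS.1, c.eigB_neg_node hm.2, zero_smul, zero_mul, smul_zero, add_zero,
      smul_smul] at h
    rw [show -c.node m - c.node k + c.η = c.ξ m + c.ξ k by simp only [node]; ring,
      show -c.node m + c.node k = c.ξ m - c.ξ k by simp only [node]; ring] at h
    exact (smul_eq_zero.1 h.symm).resolve_left (mul_ne_zero s1 s2)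

theorem leftSt_perm (hc : c.SimpleSpectrum) (y : ℂ) {S S' : List (Fin N)} (h : S.Perm S')
    (hS : S.Nodup) : c.leftSt y S = c.leftSt y S' := by
  induction h with
  | nil => rfl
  | cons n _ ih => rw [leftSt, leftSt, ih (List.nodup_cons.1 hS).2]
  | trans h1 _ ih1 ih2 => exact (ih1 hS).trans (ih2 (h1.nodup_iff.1 hS))
  | swap k m S =>
    rw [List.nodup_cons, List.nodup_cons, List.mem_cons, not_or] at hS
    obtain ⟨⟨hmk, hm⟩, hk, hS⟩ := hS
    obtain ⟨-, -, s3, s4⟩ := hc.sinh_ne hmk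
    have h := congrArg (fun X => c.leftSt y S * X)
      (c.Uminus_reflection.exchange_rowP_rowP y (c.node k) (c.node m))
    simp only [mul_add, mul_smul_comm, ← mul_assoc, c.leftSt_opB hS,
      c.eigB_node hk, c.eigB_node hm, zero_smul, zero_mul, smul_zero, add_zero,
      smul_smul] at h
    rw [show c.node k - c.node m + c.η = c.ξ m - c.ξ k + c.η by simp only [node]; ring,
      show c.node k + c.node m = -(c.ξ m + c.ξ k - c.η) by simp only [node]; ring] at h
    simp only [leftSt]
    exact (smul_right_injective _
      (mul_ne_zero s4 (by rwa [Complex.sinh_neg, neg_ne_zero]))) h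

end Chain

end

/-! ### Right states, orthogonality and comparison of scalar products -/

section

/-- If f z ≠ 0, continuity makes f nonzero near z, so the polynomial has infinitely many roots,
although its constant term a is nonzero. -/
lemma eq_zero_of_quadratic_mul {f : ℂ → ℂ} (hf : ContinuousOn f {0}ᶜ) {a b d : ℂ} (ha : a ≠ 0)
    (h : ∀ z, z ≠ 0 → (a + b * z + d * z ^ 2) * f z = 0) {z : ℂ} (hz0 : z ≠ 0) : f z = 0 := by
  by_contra hz
  have ho : IsOpen ({0}ᶜ : Set ℂ) := isOpen_compl_singleton
  have h1 : ∀ᶠ w in nhds z, f w ≠ 0 :=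
    (hf.continuousAt (ho.mem_nhds hz0)).eventually_ne hz
  have h2 : ∀ᶠ w in nhds z, w ≠ 0 := ho.mem_nhds hz0
  set p : Polynomial ℂ := .C a + .C b * .X + .C d * .X ^ 2 with hp
  have h3 : {w | p.IsRoot w} ∈ nhds z := by
    filter_upwards [h1, h2] with w hw hw0
    have := (mul_eq_zero.1 (h w hw0)).resolve_right hw
    simpa [hp, Polynomial.IsRoot] using this
  have h4 := p.eq_zero_of_infinite_isRoot (infinite_of_mem_nhds z h3)
  have h5 := congrArg (Polynomial.eval 0) h4
  simp [hp] at h5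
  exact ha h5

variable {N : ℕ}

namespace Chain

variable (c : Chain N)

/-- The right states, labelled by lists of sites. -/
def rightSt (y : ℂ) (T : List (Fin N)) : Op N :=
  (c.dual.leftSt (-(exp c.η * y)⁻¹) T).transpose

lemma dual_etaPt_zero (n : Fin N) : c.dual.etaPt n 0 = c.etaPt n 1 := by
  rw [etaPt_zero, etaPt_one, ← Complex.cosh_neg]; congr 1; simp [dual]; ring

lemma dual_etaPt_one (n : Fin N) : c.dual.etaPt n 1 = c.etaPt n 0 := by
  rw [etaPt_zero, etaPt_one, ← Complex.cosh_neg]; congr 1; simp [dual]; ring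

lemma SimpleSpectrum.dual {c : Chain N} (hc : c.SimpleSpectrum) : c.dual.SimpleSpectrum := by
  have h : ∀ p : Fin N × Fin 2, c.dual.etaPt p.1 p.2 = c.etaPt p.1 (1 - p.2) := by
    rintro ⟨n, h⟩
    fin_cases h
    · exact c.dual_etaPt_zero n
    · exact c.dual_etaPt_one n
  rintro ⟨n, i⟩ ⟨m, j⟩ hij
  have hij' : c.etaPt n (1 - i) = c.etaPt m (1 - j) :=
    (h (n, i)).symm.trans (hij.trans (h (m, j)))
  have := @hc (n, 1 - i) (m, 1 - j) hij'
  simp only [Prod.mk.injEq, sub_right_inj] at this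
  rw [this.1, this.2]

/-- The parameter -(e^η y)⁻¹ is chosen so that the gauge row of the dual chain, transposed, is
proportional to the gauge column (y e^λ, 1). -/
lemma dual_rowP {y : ℂ} (hy : y ≠ 0) (lam : ℂ) (j : Fin 2) :
    rowP c.dual.Uminus (-(exp c.η * y)⁻¹ * exp c.η) lam j =
      (exp (-lam) / y) • ((y * exp lam) • c.Uminus lam j 0 + c.Uminus lam j 1).transpose := by
  have e1 : -(exp c.η * y)⁻¹ * exp c.η = -y⁻¹ := by
    field_simp
  have e2 : exp (-lam) / y * (y * exp lam) = 1 := by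
    rw [Complex.exp_neg]; field_simp
  rw [rowP, Uminus_dual, Uminus_dual, e1, Matrix.transpose_add, Matrix.transpose_smul, smul_add,
    smul_smul, e2, one_smul, sub_eq_add_neg, ← neg_smul]
  congr 2
  ring

lemma dual_opB {y : ℂ} (hy : y ≠ 0) (lam : ℂ) :
    (opB c.η c.Uminus y lam).transpose =
      (-(exp c.η * y ^ 2)) • opB c.dual.η c.dual.Uminus (-(exp c.η * y)⁻¹) lam := by
  have e2 : exp (-lam) = (exp lam)⁻¹ := Complex.exp_neg _
  rw [opB, opB, show c.dual.η = c.η from rfl, dual_rowP _ hy, dual_rowP _ hy]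
  simp only [rowP, Matrix.transpose_add, Matrix.transpose_smul, Matrix.transpose_sub]
  rw [e2]
  have h1 := exp_ne_zero lam
  have h2 := exp_ne_zero c.η
  match_scalars <;> field_simp

lemma opB_rightSt {T : List (Fin N)} (hT : T.Nodup) {y : ℂ} (hy : y ≠ 0) (lam : ℂ) :
    opB c.η c.Uminus y lam * c.rightSt y T =
      (-(exp c.η * y ^ 2) * c.dual.eigB (-(exp c.η * y)⁻¹) T lam) •
        c.rightSt (y * exp (2 * c.η)) T := by
  have h := congrArg Matrix.transpose (c.dual.leftSt_opB hT (-(exp c.η * y)⁻¹) lam)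
  have h2 : -(exp c.η * y)⁻¹ * exp (-(2 * c.dual.η)) = -(exp c.η * (y * exp (2 * c.η)))⁻¹ := by
    rw [show c.dual.η = c.η from rfl, Complex.exp_neg]
    field_simp
  rw [h2, Matrix.transpose_mul, Matrix.transpose_smul] at h
  have h1 := congrArg Matrix.transpose (c.dual_opB hy lam)
  rw [Matrix.transpose_transpose, Matrix.transpose_smul] at h1
  rw [h1, smul_mul_assoc, rightSt, h, rightSt, smul_smul]

/-- The point ξ_n + η/2 is the node of the dual chain. Adding a site there uses the first entry of
the dual gauge row, whereas `colD` is the second entry, so `leftSt_rowP_one` for the dual chain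
converts one into the other. -/
lemma colD_rightSt {T : List (Fin N)} (hT : T.Nodup) {n : Fin N} (hn : n ∉ T) {y : ℂ}
    (hy : y ≠ 0) :
    colD c.Uminus y (c.ξ n + c.η / 2) * c.rightSt y T =
      exp (2 * c.ξ n) • c.rightSt y (n :: T) := by
  have hl : c.dual.node n = c.ξ n + c.η / 2 := by simp [node, dual]; ring
  have h := c.dual.leftSt_rowP_one hT (c.dual.eigB_node hn (-(exp c.η * y)⁻¹))
  rw [show c.dual.η = c.η from rfl] at h
  have h1 := c.dual_rowP hy (c.dual.node n) 1
  have h2 : colD c.Uminus y (c.dual.node n) = (y * exp (c.dual.node n)) •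
      (rowP c.dual.Uminus (-(exp c.η * y)⁻¹ * exp c.η) (c.dual.node n) 1).transpose := by
    rw [h1, Matrix.transpose_smul, Matrix.transpose_transpose, smul_smul, Complex.exp_neg, colD]
    have := exp_ne_zero (c.dual.node n)
    rw [show y * exp (c.dual.node n) * ((exp (c.dual.node n))⁻¹ / y) = 1 by field_simp, one_smul]
  rw [← hl, h2, smul_mul_assoc, rightSt, ← Matrix.transpose_mul, h, Matrix.transpose_neg,
    Matrix.transpose_smul, smul_neg, smul_smul, ← neg_smul, rightSt, leftSt]
  congr 1
  have e : exp (2 * c.ξ n) * exp c.η = exp (c.dual.node n) * exp (c.dual.node n) := by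
    rw [← exp_add, ← exp_add, hl]; ring_nf
  have h2 := exp_ne_zero c.η
  field_simp
  linear_combination -e

lemma boundaryFactor_eq (Y : ℂ) : c.boundaryFactor Y =
    c.minus.κ * exp c.minus.τ / sinh c.minus.ζ +
      exp (c.η / 2) * exp c.minus.ζ / sinh c.minus.ζ * Y +
      -(c.minus.κ * exp (c.η / 2) ^ 2 * exp (-c.minus.τ)) / sinh c.minus.ζ * Y ^ 2 := by
  rw [boundaryFactor]; ring

/-- As a quadratic polynomial in y the boundary factor has constant term κ e^τ / sinh ζ ≠ 0, so it
can be cancelled by continuity even at its roots. -/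
lemma op_eq_zero_of_boundaryFactor_smul (hζ : sinh c.minus.ζ ≠ 0) (hκ : c.minus.κ ≠ 0)
    {f : ℂ → Op N} (hf : ContinuousOn f {0}ᶜ)
    (h : ∀ y, y ≠ 0 → c.boundaryFactor (y * exp c.η ^ N) • f y = 0) {y : ℂ} (hy : y ≠ 0) :
    f y = 0 := by
  ext s t
  refine eq_zero_of_quadratic_mul (f := fun y => f y s t)
    (a := c.minus.κ * exp c.minus.τ / sinh c.minus.ζ)
    (b := exp (c.η / 2) * exp c.minus.ζ / sinh c.minus.ζ * exp c.η ^ N)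
    (d := -(c.minus.κ * exp (c.η / 2) ^ 2 * exp (-c.minus.τ)) / sinh c.minus.ζ *
      (exp c.η ^ N) ^ 2) ?_ ?_ (fun z hz => ?_) hy
  · rw [continuousOn_iff_continuous_domRestrict] at hf ⊢
    exact hf.matrix_elem s t
  · exact div_ne_zero (mul_ne_zero hκ (exp_ne_zero _)) hζ
  · have h1 := congrFun (congrFun (h z hz) s) t
    rw [boundaryFactor_eq] at h1
    simp only [Matrix.smul_apply, smul_eq_mul, Matrix.zero_apply] at h1
    rw [← h1]
    ring

lemma continuous_leftSt (S : List (Fin N)) : Continuous fun y => c.leftSt y S := by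
  induction S with
  | nil =>
    refine continuous_matrix fun s t => ?_
    simp only [leftSt, refState, rowOp, Matrix.of_apply, zState, prodState]
    refine continuous_finsetProd _ fun n _ => ?_
    generalize t n = x
    fin_cases x
    · exact continuous_const
    · simp only [refZ]
      simp
      fun_prop
  | cons n S ih =>
    exact ih.matrix_mul (c.continuous_rowP _ _ (by fun_prop) continuous_const 0)

lemma continuousOn_rightSt (T : List (Fin N)) : ContinuousOn (fun y => c.rightSt y T) {0}ᶜ := by
  have h1 : ContinuousOn (fun y : ℂ => -(exp c.η * y)⁻¹) {0}ᶜ := by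
    refine ContinuousOn.neg (ContinuousOn.inv₀ (by fun_prop) fun y hy => ?_)
    exact mul_ne_zero (exp_ne_zero _) hy
  exact ((c.dual.continuous_leftSt T).matrix_transpose).comp_continuousOn h1

/-- The scalar product of a left and a right state, as an operator. -/
def pairing (y : ℂ) (S T : List (Fin N)) : Op N :=
  c.leftSt (y * exp (-(2 * c.η))) S * c.rightSt y T

lemma continuousOn_pairing (S T : List (Fin N)) :
    ContinuousOn (fun y => c.pairing y S T) {0}ᶜ := by
  have h1 : Continuous fun y => c.leftSt (y * exp (-(2 * c.η))) S :=
    (c.continuous_leftSt S).comp (by fun_prop)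
  have h2 := c.continuousOn_rightSt T
  rw [continuousOn_iff_continuous_domRestrict] at h2 ⊢
  exact (h1.comp continuous_subtype_val).matrix_mul h2

lemma SimpleSpectrum.sinh_two_ne {c : Chain N} (hc : c.SimpleSpectrum) (n : Fin N) :
    sinh (2 * c.ξ n) ≠ 0 ∧ sinh c.η ≠ 0 := by
  have h1 : c.etaPt n 1 ≠ c.etaPt n 0 := fun h => by
    simpa using congrArg Prod.snd (@hc (n, 1) (n, 0) h)
  have e := two_mul_sinh_mul_sinh (c.ξ n + c.η / 2) (c.ξ n - c.η / 2)
  rw [show 2 * (c.ξ n + c.η / 2) = 2 * c.ξ n + c.η by ring,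
    show 2 * (c.ξ n - c.η / 2) = 2 * c.ξ n - c.η by ring, ← etaPt_zero, ← etaPt_one,
    show c.ξ n + c.η / 2 + (c.ξ n - c.η / 2) = 2 * c.ξ n by ring,
    show c.ξ n + c.η / 2 - (c.ξ n - c.η / 2) = c.η by ring] at e
  refine ⟨fun h => h1 ?_, fun h => h1 ?_⟩ <;> rw [h] at e <;> linear_combination -e

/-- The condition sinh(2λ - η) ≠ 0 avoids the zero of the eigenvalue that does not depend on the
label. -/
lemma exists_spectral_point (hc : c.SimpleSpectrum) (n : Fin N) (i : Fin 2) :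
    ∃ lam, cosh (2 * lam) = c.etaPt n i ∧ sinh (2 * lam - c.η) ≠ 0 := by
  have h := (hc.sinh_two_ne n).1
  fin_cases i
  · refine ⟨c.node n, c.cosh_two_node n, ?_⟩
    rwa [node, show 2 * (c.η / 2 - c.ξ n) - c.η = -(2 * c.ξ n) by ring, Complex.sinh_neg,
      neg_ne_zero]
  · refine ⟨c.ξ n + c.η / 2, ?_, ?_⟩
    · rw [show 2 * (c.ξ n + c.η / 2) = 2 * c.ξ n + c.η by ring]
      exact (c.etaPt_one n).symm
    · rwa [show 2 * (c.ξ n + c.η / 2) - c.η = 2 * c.ξ n by ring]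

lemma eigB_ne_zero (hc : c.SimpleSpectrum) {y lam : ℂ} {S : List (Fin N)} {n : Fin N}
    {i : Fin 2} (hi : i ≠ if n ∈ S then 1 else 0) (hlam : cosh (2 * lam) = c.etaPt n i)
    (hs : sinh (2 * lam - c.η) ≠ 0) (hb : c.boundaryFactor (y * exp c.η ^ N) ≠ 0) :
    c.eigB y S lam ≠ 0 := by
  refine mul_ne_zero (mul_ne_zero hs hb) (Finset.prod_ne_zero_iff.2 fun m _ => ?_)
  refine div_ne_zero (sub_ne_zero.2 fun h => ?_) two_ne_zero
  rw [hlam] at h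
  have := @hc (n, i) (m, if m ∈ S then 1 else 0) h
  rw [Prod.mk.injEq] at this
  obtain ⟨rfl, h2⟩ := this
  exact hi h2

/-- Orthogonality of the left and right states. -/
theorem pairing_eq_zero (hζ : sinh c.minus.ζ ≠ 0) (hκ : c.minus.κ ≠ 0) (hc : c.SimpleSpectrum)
    {S T : List (Fin N)} (hS : S.Nodup) (hT : T.Nodup) {n : Fin N} (h : n ∈ S ↔ n ∈ T) {y : ℂ}
    (hy : y ≠ 0) : c.pairing y S T = 0 := by
  refine c.op_eq_zero_of_boundaryFactor_smul hζ hκ (c.continuousOn_pairing S T)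
    (fun y hy => ?_) hy
  by_cases hb : c.boundaryFactor (y * exp c.η ^ N) = 0
  · rw [hb, zero_smul]
  -- The point carries the value of η_n that the left label does not have: `opB` then annihilates
  -- the right state but has a nonzero eigenvalue on the left one.
  obtain ⟨lam, h1, h2⟩ := c.exists_spectral_point hc n (if n ∈ S then 0 else 1)
  have hd : c.dual.eigB (-(exp c.η * y)⁻¹) T lam = 0 := by
    refine c.dual.eigB_eq_zero (n := n) (h1.trans ?_)
    by_cases hn : n ∈ S
    · rw [if_pos hn, if_pos (h.1 hn), dual_etaPt_one]
    · rw [if_neg hn, if_neg (fun h' => hn (h.2 h')), dual_etaPt_zero]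
  have e1 := c.leftSt_opB hS y lam
  have e2 := c.opB_rightSt hT hy lam
  rw [hd, mul_zero, zero_smul] at e2
  have e3 := congrArg (fun X => X * c.rightSt y T) e1
  simp only [mul_assoc, e2, mul_zero, smul_mul_assoc] at e3
  have e4 : c.eigB y S lam ≠ 0 :=
    c.eigB_ne_zero hc (by split_ifs <;> simp) h1 h2 hb
  rw [pairing, (smul_eq_zero.1 e3.symm).resolve_left e4, smul_zero]

/-- `∏_{a ≠ n} (x - η_a) / 2`, where `η_a` is the pseudo-spectrum labelled by `S`. -/
def specProd (S : List (Fin N)) (n : Fin N) (x : ℂ) : ℂ :=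
  ∏ a ∈ {n}ᶜ, ((x - c.etaPt a (if a ∈ S then 1 else 0)) / 2)

lemma eigB_eq_specProd {S : List (Fin N)} {n : Fin N} (hn : n ∉ S) (y lam : ℂ) :
    c.eigB y S lam = sinh (2 * lam - c.η) * c.boundaryFactor (y * exp c.η ^ N) *
      (sinh (lam - c.node n) * sinh (lam + c.node n) * c.specProd S n (cosh (2 * lam))) := by
  have h := two_mul_sinh_mul_sinh lam (c.node n)
  rw [cosh_two_node] at h
  rw [eigB, specProd, Fintype.prod_eq_mul_prod_compl n, if_neg hn, ← h]
  ring

/-- Comparison of the scalar products of neighbouring states. -/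
theorem pairing_step (hζ : sinh c.minus.ζ ≠ 0) (hκ : c.minus.κ ≠ 0) (hc : c.SimpleSpectrum)
    {S T : List (Fin N)} (hS : S.Nodup) (hT : T.Nodup) {n : Fin N} (hn : n ∉ S) (hn' : n ∉ T)
    {y : ℂ} (hy : y ≠ 0) :
    (sinh (2 * c.ξ n + c.η) * c.specProd S n (c.etaPt n 1)) • c.pairing y (n :: S) T =
      (sinh (2 * c.ξ n - c.η) * c.specProd S n (c.etaPt n 0) * exp (2 * c.ξ n)) •
        c.pairing y S (n :: T) := by
  rw [← sub_eq_zero]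
  refine c.op_eq_zero_of_boundaryFactor_smul hζ hκ (f := fun y =>
    (sinh (2 * c.ξ n + c.η) * c.specProd S n (c.etaPt n 1)) • c.pairing y (n :: S) T -
      (sinh (2 * c.ξ n - c.η) * c.specProd S n (c.etaPt n 0) * exp (2 * c.ξ n)) •
        c.pairing y S (n :: T)) ?_ (fun y hy => ?_) hy
  · exact ((continuousOn_const (c := sinh (2 * c.ξ n + c.η) * c.specProd S n (c.etaPt n 1))).smul
      (c.continuousOn_pairing _ _)).sub ((continuousOn_const
        (c := sinh (2 * c.ξ n - c.η) * c.specProd S n (c.etaPt n 0) * exp (2 * c.ξ n))).smul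
      (c.continuousOn_pairing _ _))
  by_cases hb : c.boundaryFactor (y * exp c.η ^ N) = 0
  · rw [hb, zero_smul]
  set lam := c.ξ n + c.η / 2 with hlam
  have hcl : cosh (2 * lam) = c.etaPt n 1 := by rw [etaPt_one, hlam]; congr 1; ring
  have hR : opB c.η c.Uminus y lam * c.rightSt y T = 0 := by
    have : c.dual.eigB (-(exp c.η * y)⁻¹) T lam = 0 := by
      refine c.dual.eigB_eq_zero (n := n) ?_
      rw [if_neg hn', dual_etaPt_zero, hcl]
    rw [c.opB_rightSt hT hy, this, mul_zero, zero_smul]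
  have hD := c.colD_rightSt hT hn' hy
  rw [← hlam] at hD
  set L' := c.leftSt (y * exp (-(2 * c.η))) S with hL'
  set R := c.rightSt y T with hRdef
  -- The exchange relation between the two states, with the factor sinh(μ - η/2 + ξ_n) taken out. It
  -- comes from sinh(λ + μ - η) on one side and from the eigenvalue at μ on the other, and the term
  -- with `opB` at λ on the right is killed by the right state.
  set F : ℂ → Op N := fun mu =>
    (sinh (lam - mu + c.η) * c.eigB y S lam) • (L' * rowP c.Uminus (y * exp (-c.η)) mu 0 * R) -
      (sinh (2 * mu - c.η) * c.boundaryFactor (y * exp c.η ^ N) *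
        (sinh (mu + c.node n) * c.specProd S n (cosh (2 * mu)))) •
      (L' * ((sinh c.η * sinh (lam - mu)) • (colD c.Uminus y lam * R) +
        (sinh c.η * sinh (lam + mu - c.η)) • (rowP c.Uminus (y * exp (-c.η)) lam 0 * R))) with hF
  have hspec : Continuous (c.specProd S n) := by unfold specProd; fun_prop
  have hFc : Continuous F := by
    have h1 := c.continuous_rowP (fun _ => y * exp (-c.η)) id continuous_const continuous_id 0
    have h2 : Continuous fun mu => L' * rowP c.Uminus (y * exp (-c.η)) mu 0 * R :=
      (continuous_const.matrix_mul h1).matrix_mul continuous_const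
    have h3 : Continuous fun mu => c.specProd S n (cosh (2 * mu)) := hspec.comp (by fun_prop)
    refine Continuous.sub ((show Continuous fun mu => sinh (lam - mu + c.η) * c.eigB y S lam by
      fun_prop).smul h2) (Continuous.smul
        ((show Continuous fun mu => sinh (2 * mu - c.η) * c.boundaryFactor (y * exp c.η ^ N) by
          fun_prop).mul ((show Continuous fun mu => sinh (mu + c.node n) by fun_prop).mul h3))
        (continuous_const.matrix_mul (Continuous.add ?_ ?_)))
    · exact (show Continuous fun mu => sinh c.η * sinh (lam - mu) by fun_prop).smul
        continuous_const
    · exact (show Continuous fun mu => sinh c.η * sinh (lam + mu - c.η) by fun_prop).smul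
        continuous_const
  have hF0 : ∀ mu, sinh (1 * mu + -c.node n) • F mu = 0 := by
    intro mu
    have h := congrArg (fun X => c.leftSt y S * X * R)
      (c.Uminus_reflection.exchange_opB_rowP y lam mu)
    simp only [mul_add, add_mul, mul_smul_comm, smul_mul_assoc] at h
    have e1 : ∀ X, c.leftSt y S * (opB c.η c.Uminus y lam * X) * R =
        c.eigB y S lam • (L' * X * R) := fun X => by
      rw [← mul_assoc, c.leftSt_opB hS, smul_mul_assoc, smul_mul_assoc]
    have e2 : ∀ X, c.leftSt y S * (opB c.η c.Uminus y mu * X) * R =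
        c.eigB y S mu • (L' * (X * R)) := fun X => by
      rw [← mul_assoc, c.leftSt_opB hS, smul_mul_assoc, smul_mul_assoc, mul_assoc]
    have e3 : c.leftSt y S * (rowP c.Uminus (y * exp c.η) mu 0 * opB c.η c.Uminus y lam) * R = 0 := by
      rw [mul_assoc, mul_assoc, hR, mul_zero, mul_zero]
    rw [e1, e2, e2, e3, smul_zero, zero_add, c.eigB_eq_specProd hn y mu,
      show lam + mu - c.η = mu - c.node n by simp only [hlam, node]; ring] at h
    simp only [hF, smul_sub, mul_add, mul_smul_comm, smul_add, smul_smul]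
    rw [show lam + mu - c.η = mu - c.node n by simp only [hlam, node]; ring]
    rw [smul_smul] at h
    rw [sub_eq_zero, one_mul, ← sub_eq_add_neg]
    refine Eq.trans ?_ (h.trans ?_)
    · congr 1; ring
    · rw [smul_smul, smul_smul]
      congr 2 <;> ring
  -- At μ = η/2 - ξ_n one has λ + μ = η, so the last term drops and only `rowP` at μ and `colD` at λ
  -- remain; the first adds n to S, the second adds n to T.
  have hF1 := op_eq_zero_of_sinh_mul hFc one_ne_zero _ hF0 (c.node n)
  simp only [hF] at hF1
  rw [show lam + c.node n - c.η = 0 by simp only [hlam, node]; ring, Complex.sinh_zero, mul_zero,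
    zero_smul, add_zero, hD, cosh_two_node, c.eigB_eq_specProd hn, hcl, ← exp_shift,
    show lam - c.node n + c.η = 2 * c.ξ n + c.η by simp only [hlam, node]; ring,
    show lam - c.node n = 2 * c.ξ n by simp only [hlam, node]; ring,
    show lam + c.node n = c.η by simp only [hlam, node]; ring,
    show 2 * lam - c.η = 2 * c.ξ n by simp only [hlam]; ring,
    show 2 * c.node n - c.η = -(2 * c.ξ n) by simp only [node]; ring,
    show c.node n + c.node n = -(2 * c.ξ n - c.η) by simp only [node]; ring,
    Complex.sinh_neg, Complex.sinh_neg] at hF1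
  obtain ⟨s1, s2⟩ := hc.sinh_two_ne n
  have hnz : sinh (2 * c.ξ n) ^ 2 * sinh c.η ≠ 0 := mul_ne_zero (pow_ne_zero _ s1) s2
  refine (smul_eq_zero.1 (?_ : (sinh (2 * c.ξ n) ^ 2 * sinh c.η) • (_ : Op N) = 0)).resolve_left hnz
  refine Eq.trans ?_ hF1
  simp only [pairing, leftSt, ← hL', ← hRdef, mul_smul_comm, smul_sub, smul_smul]
  congr 2 <;> ring

end Chain

end

/-! ### Identification with the pseudo-eigenstates of the statement -/

section

variable {N : ℕ}

namespace Chain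

variable (c : Chain N)

/-- The parameter `y` of the gauge transformation with parameters `α`, `β`. -/
def gaugeY (β : ℂ) : ℂ := exp (-(c.η / 2) - (c.α - β + 1) * c.η)

lemma gaugeY_ne_zero (β : ℂ) : c.gaugeY β ≠ 0 := exp_ne_zero _

lemma gaugeY_sub_two (β : ℂ) : c.gaugeY (β - 2) = c.gaugeY β * exp (-(2 * c.η)) := by
  rw [gaugeY, gaugeY, ← exp_add]; congr 1; ring

lemma exp_pow_sub (η : ℂ) (n : Fin N) :
    exp η ^ (N + 1 - (n : ℕ)) = exp (((N : ℂ) + 1 - (n : ℕ)) * η) := by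
  rw [← Complex.exp_nat_mul, Nat.cast_sub (by omega)]
  push_cast
  rfl

lemma rowOp_leftRef (β : ℂ) :
    rowOp (c.leftRef β) = (-1 : ℂ) ^ N • c.refState (c.gaugeY β) := by
  rw [refState, ← rowOp_smul]
  congr 1
  funext s
  have h : ((-1 : ℂ) ^ N) = ∏ _n : Fin N, (-1 : ℂ) := by simp
  rw [Pi.smul_apply, smul_eq_mul, h, zState, prodState, leftRef, ← Finset.prod_mul_distrib]
  refine Finset.prod_congr rfl fun n _ => ?_
  generalize s n = x
  fin_cases x
  · simp
  · simp only [Fin.mk_one, Matrix.cons_val_one, Matrix.cons_val_fin_one, refZ, exp_pow_sub, gaugeY,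
      neg_mul, one_mul, neg_neg, ← exp_add]
    congr 1; ring

/-- The product state is normalized by its first component to match `zState`. The shift -β + 2 is
what makes its parameters the reference ones of the dual chain for the gauge β. -/
lemma rowOp_rightRef (β : ℂ) :
    rowOp (c.rightRef (-β + 2)) =
      (∏ n : Fin N, exp (-c.α * c.η - ((N : ℂ) - (((n : ℕ) : ℂ) + 1) + (-β + 2)) * c.η - c.ξ n)) •
        c.dual.refState (-(exp c.η * c.gaugeY β)⁻¹) := by
  rw [refState, ← rowOp_smul]
  congr 1
  funext s
  rw [Pi.smul_apply, smul_eq_mul, zState, prodState, rightRef, ← Finset.prod_mul_distrib]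
  refine Finset.prod_congr rfl fun n _ => ?_
  generalize s n = x
  fin_cases x
  · simp
  · simp only [Fin.mk_one, Matrix.cons_val_one, Matrix.cons_val_fin_one, refZ, exp_pow_sub, gaugeY,
      neg_mul, neg_neg, ← exp_add, ← Complex.exp_neg, dual]
    refine exp_zero.symm.trans (congrArg exp ?_)
    ring

lemma exp_sub_exp_ne_zero {a b : ℂ} (h : sinh ((a - b) / 2) ≠ 0) : exp a - exp b ≠ 0 := by
  intro h0
  apply h
  have e : exp a - exp b = exp ((a + b) / 2) * (2 * sinh ((a - b) / 2)) := by
    rw [Complex.two_sinh, mul_sub, ← exp_add, ← exp_add]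
    congr 2 <;> ring
  rw [e] at h0
  simpa [exp_ne_zero] using h0

lemma Gtilde_inv (lam β : ℂ) : (c.Gtilde (lam - c.η / 2) β)⁻¹ =
    (exp (-(lam - c.η / 2 + (c.α + (β + 1)) * c.η)) - c.gaugeY β * exp c.η * exp (-lam))⁻¹ •
      !![1, -(c.gaugeY β * exp c.η * exp (-lam));
        -1, exp (-(lam - c.η / 2 + (c.α + (β + 1)) * c.η))] := by
  have e : exp (-(lam - c.η / 2 + (c.α - (β - 1)) * c.η)) =
      c.gaugeY β * exp c.η * exp (-lam) := by
    rw [gaugeY, ← exp_add, ← exp_add]; congr 1; ring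
  have hG : c.Gtilde (lam - c.η / 2) β =
      !![exp (-(lam - c.η / 2 + (c.α + (β + 1)) * c.η)), c.gaugeY β * exp c.η * exp (-lam);
        1, 1] := by
    rw [← e]
    ext i j
    fin_cases i <;> fin_cases j <;> simp [Gtilde, X, Y]
  rw [hG, Matrix.inv_def, Matrix.adjugate_fin_two_of, Matrix.det_fin_two_of, Ring.inverse_eq_inv',
    mul_one, mul_one]

lemma Ugauge_apply (lam β : ℂ) (i j : Fin 2) : c.Ugauge lam β i j =
    exp (-lam + c.η / 2) • ∑ k, ∑ l, ((c.Gtilde (lam - c.η / 2) β)⁻¹ i l *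
      c.Gtilde (c.η / 2 - lam) β k j) • c.Uminus lam l k := by
  simp only [Ugauge, Matrix.smul_apply, Matrix.mul_apply, aux, Matrix.map_apply,
    Algebra.algebraMap_eq_smul_one, smul_mul_assoc, mul_smul_comm, one_mul, mul_one]
  congr 1
  refine Finset.sum_congr rfl fun k _ => ?_
  rw [Finset.smul_sum]
  refine Finset.sum_congr rfl fun l _ => ?_
  rw [smul_smul, mul_comm]

lemma opA_eq (lam β : ℂ) : c.opA lam (β + 2) =
    (exp (-lam + c.η / 2) * (exp (-(lam - c.η / 2 + (c.α + (β + 1)) * c.η)) -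
      c.gaugeY β * exp c.η * exp (-lam))⁻¹) •
      (exp (-(c.η / 2 - lam + (c.α + (β + 1)) * c.η)) •
        rowP c.Uminus (c.gaugeY β * exp c.η) lam 0 +
        rowP c.Uminus (c.gaugeY β * exp c.η) lam 1) := by
  rw [opA, show β + 2 - 2 = β by ring, Ugauge_apply, Gtilde_inv]
  generalize exp (-(lam - c.η / 2 + (c.α + (β + 1)) * c.η)) -
      c.gaugeY β * exp c.η * exp (-lam) = D
  simp only [Fin.sum_univ_two, Gtilde, X, Y, Matrix.smul_apply, Matrix.of_apply,
    Matrix.transpose_apply, Matrix.cons_val_zero, Matrix.cons_val_one, Matrix.cons_val_fin_one,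
    Matrix.cons_val', smul_eq_mul, rowP]
  match_scalars <;> ring

lemma opD_eq (lam β : ℂ) : c.opD lam β =
    (exp (-lam + c.η / 2) * (exp (-(lam - c.η / 2 + (c.α + (β + 1)) * c.η)) -
      c.gaugeY β * exp c.η * exp (-lam))⁻¹) •
      (exp (-(lam - c.η / 2 + (c.α + (β + 1)) * c.η)) • colD c.Uminus (c.gaugeY β) lam -
        ((c.gaugeY β * exp lam) • c.Uminus lam 0 0 + c.Uminus lam 0 1)) := by
  have e : exp (-(c.η / 2 - lam + (c.α - (β - 1)) * c.η)) = c.gaugeY β * exp lam := by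
    rw [gaugeY, ← exp_add]; congr 1; ring
  rw [opD, Ugauge_apply, Gtilde_inv]
  generalize exp (-(lam - c.η / 2 + (c.α + (β + 1)) * c.η)) -
      c.gaugeY β * exp c.η * exp (-lam) = D
  simp only [Fin.sum_univ_two, Gtilde, X, Y, Matrix.smul_apply, Matrix.of_apply,
    Matrix.transpose_apply, Matrix.cons_val_zero, Matrix.cons_val_one, Matrix.cons_val_fin_one,
    Matrix.cons_val', smul_eq_mul, colD, e]
  match_scalars <;> ring

lemma gauge_det_ne_zero {β : ℂ} (hβ : sinh (β * c.η) ≠ 0) (lam : ℂ) :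
    exp (-(lam - c.η / 2 + (c.α + (β + 1)) * c.η)) - c.gaugeY β * exp c.η * exp (-lam) ≠ 0 := by
  rw [gaugeY, ← exp_add, ← exp_add]
  refine exp_sub_exp_ne_zero ?_
  rwa [← neg_ne_zero, ← Complex.sinh_neg, show -((-(lam - c.η / 2 + (c.α + (β + 1)) * c.η) -
    (-(c.η / 2) - (c.α - β + 1) * c.η + c.η + -lam)) / 2) = β * c.η by ring]

/-- The operator A has the same gauge row as `opB` but another column. Since `opB` vanishes here,
changing the column changes only a scalar, in which the determinant of the gauge matrix cancels. -/
lemma leftSt_opA {β : ℂ} (hβ : sinh (β * c.η) ≠ 0) {S : List (Fin N)} (hS : S.Nodup) {n : Fin N}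
    (hn : n ∉ S) : c.leftSt (c.gaugeY β) S * c.opA (c.node n) (β + 2) =
      exp (-c.ξ n) • c.leftSt (c.gaugeY β) (n :: S) := by
  have hD := c.gauge_det_ne_zero hβ (c.node n)
  have h1 := c.leftSt_rowP_one hS (c.eigB_node hn (c.gaugeY β))
  rw [opA_eq, mul_smul_comm, mul_add, h1, mul_smul_comm, ← sub_eq_add_neg, ← sub_smul, smul_smul,
    leftSt]
  congr 1
  have e : exp (-(c.η / 2 - c.node n + (c.α + (β + 1)) * c.η)) - c.gaugeY β * exp (c.node n) =
      exp (2 * c.node n - c.η) * (exp (-(c.node n - c.η / 2 + (c.α + (β + 1)) * c.η)) -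
        c.gaugeY β * exp c.η * exp (-c.node n)) := by
    rw [gaugeY, mul_sub]
    simp only [← exp_add]
    congr 2 <;> ring
  rw [e, mul_assoc, mul_comm (exp (2 * c.node n - c.η)), ← mul_assoc (_⁻¹), inv_mul_cancel₀ hD,
    one_mul, ← exp_add]
  congr 1
  simp only [node]
  ring

lemma opB_eq_col (y lam : ℂ) : opB c.η c.Uminus y lam =
    ((y * exp lam) • c.Uminus lam 0 0 + c.Uminus lam 0 1) -
      (y * exp c.η * exp (-lam)) • colD c.Uminus y lam := by
  rw [opB, rowP, rowP, colD]
  match_scalars <;> ring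

/-- D has the gauge column of `opB` but another row. The vanishing of `opB` on the right state again
leaves only `colD`, up to the determinant of the gauge matrix. -/
lemma opD_rightSt {β : ℂ} (hβ : sinh (β * c.η) ≠ 0) {T : List (Fin N)} (hT : T.Nodup) {n : Fin N}
    (hn : n ∉ T) : c.opD (c.ξ n + c.η / 2) β * c.rightSt (c.gaugeY β) T =
      exp (c.ξ n) • c.rightSt (c.gaugeY β) (n :: T) := by
  have hy := c.gaugeY_ne_zero β
  set lam := c.ξ n + c.η / 2 with hlam
  have hD := c.gauge_det_ne_zero hβ lam
  have hR : opB c.η c.Uminus (c.gaugeY β) lam * c.rightSt (c.gaugeY β) T = 0 := by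
    have : c.dual.eigB (-(exp c.η * c.gaugeY β)⁻¹) T lam = 0 := by
      refine c.dual.eigB_eq_zero (n := n) ?_
      rw [if_neg hn, dual_etaPt_zero, etaPt_one, hlam]
      congr 1; ring
    rw [c.opB_rightSt hT hy, this, mul_zero, zero_smul]
  rw [opB_eq_col, sub_mul, sub_eq_zero, smul_mul_assoc] at hR
  rw [opD_eq, smul_mul_assoc, sub_mul, smul_mul_assoc, hR, ← sub_smul, smul_smul, mul_assoc,
    inv_mul_cancel₀ hD, mul_one, c.colD_rightSt hT hn hy, smul_smul, ← exp_add]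
  congr 2
  rw [hlam]; ring

lemma leftSt_mul_prod {y : ℂ} (M : Fin N → Op N) (k : Fin N → ℂ)
    (hM : ∀ S : List (Fin N), S.Nodup → ∀ n ∉ S, c.leftSt y S * M n = k n • c.leftSt y (n :: S))
    (h : Fin N → Fin 2) {l S : List (Fin N)} (hl : (l.reverse ++ S).Nodup) :
    c.leftSt y S * (l.map fun n => M n ^ (h n : ℕ)).prod =
      (l.map fun n => k n ^ (h n : ℕ)).prod •
        c.leftSt y ((l.filter fun n => h n = 1).reverse ++ S) := by
  induction l generalizing S with
  | nil => simp
  | cons n l ih =>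
    have hnl : (l.reverse ++ n :: S).Nodup := by simpa using hl
    have hsub : (l.reverse ++ S).Nodup := hnl.sublist (by simp)
    have hS : S.Nodup := hnl.sublist (by simp)
    have hn : n ∉ S := (List.nodup_cons.1 (List.nodup_append.1 hnl).2.1).1
    rw [List.map_cons, List.prod_cons, ← mul_assoc]
    obtain h0 | h1 : h n = 0 ∨ h n = 1 := by omega
    · simp [h0, ih hsub]
    · simp [h1, hM S hS n hn, ih hnl, smul_smul]

lemma prod_mul_rightSt {y : ℂ} (M : Fin N → Op N) (k : Fin N → ℂ)
    (hM : ∀ T : List (Fin N), T.Nodup → ∀ n ∉ T, M n * c.rightSt y T = k n • c.rightSt y (n :: T))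
    (h : Fin N → Fin 2) {l : List (Fin N)} (hl : l.Nodup) :
    (l.map fun n => M n ^ (1 - (h n : ℕ))).prod * c.rightSt y [] =
      (l.map fun n => k n ^ (1 - (h n : ℕ))).prod • c.rightSt y (l.filter fun n => h n = 0) := by
  induction l with
  | nil => simp
  | cons n l ih =>
    rw [List.nodup_cons] at hl
    rw [List.map_cons, List.prod_cons, mul_assoc, ih hl.2, mul_smul_comm]
    obtain h0 | h1 : h n = 0 ∨ h n = 1 := by omega
    · simp [h0, hM _ (hl.2.filter _) n (by simp [hl.1]), smul_smul, mul_comm]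
    · simp [h1]

/-- The sites `n` with `hₙ = i`. -/
def level (h : Fin N → Fin 2) (i : Fin 2) : List (Fin N) :=
  (List.finRange N).filter fun n => h n = i

lemma mem_level {h : Fin N → Fin 2} {i : Fin 2} {n : Fin N} : n ∈ level h i ↔ h n = i := by
  simp [level]

lemma nodup_level (h : Fin N → Fin 2) (i : Fin 2) : (level h i).Nodup :=
  (List.nodup_finRange N).filter _

lemma prod_map_finRange (f : Fin N → ℂ) : ((List.finRange N).map f).prod = ∏ n, f n := by
  rw [← List.ofFn_eq_map, List.prod_ofFn]

theorem rowOp_leftState (hc : c.SimpleSpectrum) {β : ℂ} (hβ : sinh (β * c.η) ≠ 0)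
    (h : Fin N → Fin 2) : rowOp (c.leftState β h) =
      ((-1) ^ N * ∏ n, (exp (-c.ξ n) / c.AFun (c.η / 2 - c.ξ n)) ^ (h n : ℕ)) •
        c.leftSt (c.gaugeY β) (level h 1) := by
  have hr := c.leftSt_mul_prod (y := c.gaugeY β)
    (fun n => (c.AFun (c.η / 2 - c.ξ n))⁻¹ • c.opA (c.η / 2 - c.ξ n) (β + 2))
    (fun n => exp (-c.ξ n) / c.AFun (c.η / 2 - c.ξ n)) (fun S hS n hn => by
      rw [mul_smul_comm, ← node, c.leftSt_opA hβ hS hn, smul_smul, div_eq_inv_mul, node]) h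
    (l := List.finRange N) (S := []) (by simp [List.nodup_finRange])
  rw [leftState, ← rowOp_mul, rowOp_leftRef, smul_mul_assoc, ← smul_smul, ← prod_map_finRange,
    List.ofFn_eq_map]
  -- The operators act on a covector in increasing order, each putting its site in front, so the
  -- list comes out reversed; the states do not depend on this order.
  have hp := c.leftSt_perm hc (c.gaugeY β) (List.reverse_perm (level h 1))
    (List.nodup_reverse.2 (nodup_level h 1))
  rw [leftSt] at hr
  rw [level] at hp
  rw [hr, List.append_nil, hp, level]

theorem rowOp_rightState {β : ℂ} (hβ : sinh (β * c.η) ≠ 0)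
    (h : Fin N → Fin 2) : (rowOp (c.rightState β h)).transpose =
      ((∏ n : Fin N,
        exp (-c.α * c.η - ((N : ℂ) - (((n : ℕ) : ℂ) + 1) + (-β + 2)) * c.η - c.ξ n)) *
        ∏ n, (exp (c.ξ n) / (c.fConst n * c.AFun (c.η / 2 - c.ξ n))) ^ (1 - (h n : ℕ))) •
        c.rightSt (c.gaugeY β) (level h 0) := by
  have hr := c.prod_mul_rightSt (y := c.gaugeY β)
    (fun n => (c.fConst n * c.AFun (c.η / 2 - c.ξ n))⁻¹ • c.opD (c.ξ n + c.η / 2) β)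
    (fun n => exp (c.ξ n) / (c.fConst n * c.AFun (c.η / 2 - c.ξ n))) (fun S hS n hn => by
      rw [smul_mul_assoc, c.opD_rightSt hβ hS hn, smul_smul, div_eq_inv_mul (exp (c.ξ n))]) h
    (List.nodup_finRange N)
  rw [rightState, ← Matrix.vecMul_transpose, ← rowOp_mul, rowOp_rightRef, smul_mul_assoc,
    Matrix.transpose_smul, Matrix.transpose_mul, Matrix.transpose_transpose, ← smul_smul,
    ← prod_map_finRange (fun n => (exp (c.ξ n) / (c.fConst n * c.AFun (c.η / 2 - c.ξ n))) ^
      (1 - (h n : ℕ))), List.ofFn_eq_map]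
  rw [rightSt, leftSt] at hr
  rw [hr, level]

end Chain

end

/-! ### Norms, Vandermonde factors and the determinant formula -/

section

variable {N : ℕ}

lemma prod_Iio_eq_det_vandermonde (x : Fin N → ℂ) :
    ∏ a : Fin N, ∏ b ∈ Finset.Iio a, (x a - x b) = (Matrix.vandermonde x).det := by
  rw [Matrix.det_vandermonde]
  exact Finset.prod_comm' (by simp)

/-- Comparison of the Vandermonde products of two families which differ at one place. -/
lemma prod_Iio_mul_prod_compl (x x' : Fin N → ℂ) (n : Fin N) (h : ∀ a, a ≠ n → x a = x' a) :
    (∏ a : Fin N, ∏ b ∈ Finset.Iio a, (x a - x b)) * ∏ a ∈ {n}ᶜ, (x' n - x a) =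
      (∏ a : Fin N, ∏ b ∈ Finset.Iio a, (x' a - x' b)) * ∏ a ∈ {n}ᶜ, (x n - x a) := by
  -- The variable z_n is isolated: everything else is a sign depending only on n and the differences
  -- not involving n.
  have key : ∀ z : Fin N → ℂ, ∏ a : Fin N, ∏ b ∈ Finset.Iio a, (z a - z b) =
      ((∏ a ∈ {n}ᶜ, if n < a then (-1 : ℂ) else 1) *
        ∏ a ∈ {n}ᶜ, ∏ b ∈ {n}ᶜ, if b < a then z a - z b else 1) * ∏ a ∈ {n}ᶜ, (z n - z a) := by
    intro z
    have e : ∀ a, ∏ b ∈ Finset.Iio a, (z a - z b) = ∏ b, if b < a then z a - z b else 1 := by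
      intro a
      rw [Finset.prod_ite, Finset.prod_const_one, mul_one]
      refine Finset.prod_congr ?_ fun _ _ => rfl
      ext; simp
    simp only [e]
    rw [Fintype.prod_eq_mul_prod_compl n]
    simp only [fun a => Fintype.prod_eq_mul_prod_compl n fun b => if b < a then z a - z b else 1]
    have hp : (∏ a ∈ {n}ᶜ, if a < n then z n - z a else 1) *
        (∏ a ∈ {n}ᶜ, if n < a then z a - z n else 1) =
        (∏ a ∈ {n}ᶜ, if n < a then (-1 : ℂ) else 1) * ∏ a ∈ {n}ᶜ, (z n - z a) := by
      rw [← Finset.prod_mul_distrib, ← Finset.prod_mul_distrib]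
      refine Finset.prod_congr rfl fun a ha => ?_
      have han : a ≠ n := by simpa using ha
      obtain h1 | h1 := lt_or_gt_of_ne han
      · simp [h1, h1.not_gt]
      · simp [h1, h1.not_gt]
    rw [if_neg (lt_irrefl n), one_mul, Finset.prod_mul_distrib, ← mul_assoc, hp, mul_right_comm]
  rw [key x, key x', mul_assoc, mul_assoc, mul_assoc, mul_assoc]
  congr 1
  rw [mul_comm (∏ a ∈ {n}ᶜ, (x n - x a))]
  have hW : ∏ a ∈ {n}ᶜ, ∏ b ∈ {n}ᶜ, (if b < a then x a - x b else 1) =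
      ∏ a ∈ {n}ᶜ, ∏ b ∈ {n}ᶜ, if b < a then x' a - x' b else 1 :=
    Finset.prod_congr rfl fun a ha => Finset.prod_congr rfl fun b hb => by
      rw [h a (by simpa using ha), h b (by simpa using hb)]
  have hV : ∀ t, ∏ a ∈ {n}ᶜ, (t - x a) = ∏ a ∈ {n}ᶜ, (t - x' a) := fun t =>
    Finset.prod_congr rfl fun a ha => by rw [h a (by simpa using ha)]
  rw [hW, hV (x' n)]

namespace Chain

variable (c : Chain N)

lemma vdm_eq_det (h : Fin N → Fin 2) :
    c.vdm h = (Matrix.vandermonde fun a => c.etaPt a (h a)).det :=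
  prod_Iio_eq_det_vandermonde _

lemma rowOp_mul_transpose (u v : Vec N) :
    rowOp u * (rowOp v).transpose = Matrix.of fun _ _ => u ⬝ᵥ v := by
  ext s t
  simp [rowOp, Matrix.mul_apply, dotProduct]

lemma dotProduct_eq_zero_of_rowOp {u v : Vec N} (h : rowOp u * (rowOp v).transpose = 0) :
    u ⬝ᵥ v = 0 := by
  rw [rowOp_mul_transpose] at h
  exact congrFun (congrFun h fun _ => 0) fun _ => 0

lemma leftState_dotProduct_rightState_of_ne (hc : c.GenericMinus) {β : ℂ}
    (hβ : sinh (β * c.η) ≠ 0) (hβ' : sinh ((β - 2) * c.η) ≠ 0) {h h' : Fin N → Fin 2}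
    (hne : h ≠ h') : c.leftState (β - 2) h ⬝ᵥ c.rightState β h' = 0 := by
  obtain ⟨n, hn⟩ := Function.ne_iff.1 hne
  apply dotProduct_eq_zero_of_rowOp
  rw [c.rowOp_leftState hc.2.1 hβ', c.rowOp_rightState hβ, gaugeY_sub_two, smul_mul_assoc,
    mul_smul_comm, ← pairing, c.pairing_eq_zero hc.1.1 hc.1.2.1 hc.2.1 (nodup_level _ _)
    (nodup_level _ _) (n := n) _ (c.gaugeY_ne_zero β), smul_zero, smul_zero]
  rw [mem_level, mem_level]
  omega

lemma rightState_one (β : ℂ) : c.rightState β (fun _ => 1) = c.rightRef (-β + 2) := by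
  simp [rightState, List.ofFn_const]

lemma level_update_of_eq {h : Fin N → Fin 2} {n : Fin N} {i j : Fin 2} (hn : h n = j)
    (hij : i ≠ j) : (level (Function.update h n i) i).Perm (n :: level h i) := by
  refine (List.perm_ext_iff_of_nodup (nodup_level _ _)
    (List.nodup_cons.2 ⟨by rw [mem_level, hn]; exact hij.symm, nodup_level _ _⟩)).2 fun m => ?_
  rw [List.mem_cons, mem_level, mem_level]
  by_cases hm : m = n
  · simp [hm]
  · simp [hm]

/-- The quotient of the two Vandermonde products is the quotient of the `specProd` factors in
`pairing_step`; this is why the products weighted by `vdm` do not depend on h. -/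
lemma vdm_update (h : Fin N → Fin 2) {n : Fin N} (hn : h n = 0) :
    c.vdm h * c.specProd (level h 1) n (c.etaPt n 1) =
      c.vdm (Function.update h n 1) * c.specProd (level h 1) n (c.etaPt n 0) := by
  have hs : ∀ x, c.specProd (level h 1) n x =
      (∏ a ∈ {n}ᶜ, (x - c.etaPt a (h a))) * ∏ a ∈ ({n}ᶜ : Finset (Fin N)), (2 : ℂ)⁻¹ := by
    intro x
    rw [specProd, ← Finset.prod_mul_distrib]
    refine Finset.prod_congr rfl fun a _ => ?_
    simp only [mem_level, div_eq_mul_inv]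
    congr 3
    split_ifs with h1
    · exact h1.symm
    · omega
  have := prod_Iio_mul_prod_compl (fun a => c.etaPt a (h a))
    (fun a => c.etaPt a (Function.update h n 1 a)) n (fun a ha => by
      simp [Function.update_of_ne ha])
  simp only [Function.update_self, hn] at this
  rw [hs, hs, ← mul_assoc, ← mul_assoc]
  congr 1

lemma specProd_ne_zero (hc : c.SimpleSpectrum) (S : List (Fin N)) (n : Fin N) (i : Fin 2) :
    c.specProd S n (c.etaPt n i) ≠ 0 := by
  refine Finset.prod_ne_zero_iff.2 fun a ha => div_ne_zero (sub_ne_zero.2 fun h => ?_) two_ne_zero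
  have := @hc (n, i) (a, if a ∈ S then 1 else 0) h
  rw [Prod.mk.injEq] at this
  exact (Finset.mem_compl.1 ha) (Finset.mem_singleton.2 this.1.symm)

/-- With S and T the sites of level 1 of h and of level 0 of the updated label, the two sides
involve the pairings (S, n :: T) and (n :: S, T) of `pairing_step`. The constants `fConst` and the
exponentials from `opA` and `opD` absorb its remaining scalars. -/
lemma vdm_mul_dotProduct_update (hc : c.GenericMinus) {β : ℂ} (hβ : sinh (β * c.η) ≠ 0)
    (hβ' : sinh ((β - 2) * c.η) ≠ 0) (h : Fin N → Fin 2) {n : Fin N} (hn : h n = 0) :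
    c.vdm h * (c.leftState (β - 2) h ⬝ᵥ c.rightState β h) =
      c.vdm (Function.update h n 1) * (c.leftState (β - 2) (Function.update h n 1) ⬝ᵥ
        c.rightState β (Function.update h n 1)) := by
  set h' := Function.update h n 1 with hh'
  have hS : (level h' 1).Perm (n :: level h 1) := level_update_of_eq hn (by simp)
  have hh : h = Function.update h' n 0 := by
    rw [hh', Function.update_idem, ← hn, Function.update_eq_self]
  have hT : (level h 0).Perm (n :: level h' 0) := by
    conv_lhs => rw [hh]
    exact level_update_of_eq (j := 1) (by simp [hh']) (by simp)
  have hstep := c.pairing_step hc.1.1 hc.1.2.1 hc.2.1 (S := level h 1) (T := level h' 0)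
    (nodup_level _ _) (nodup_level _ _) (n := n) (by simp [mem_level, hn])
    (by simp [mem_level, hh']) (c.gaugeY_ne_zero β)
  have p1 := rowOp_mul_transpose (c.leftState (β - 2) h) (c.rightState β h)
  rw [c.rowOp_leftState hc.2.1 hβ', c.rowOp_rightState hβ, gaugeY_sub_two, smul_mul_assoc,
    mul_smul_comm, smul_smul, rightSt, c.dual.leftSt_perm (SimpleSpectrum.dual hc.2.1) _ hT (nodup_level _ _),
    ← rightSt, ← pairing] at p1
  have p2 := rowOp_mul_transpose (c.leftState (β - 2) h') (c.rightState β h')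
  rw [c.rowOp_leftState hc.2.1 hβ', c.rowOp_rightState hβ, gaugeY_sub_two, smul_mul_assoc,
    mul_smul_comm, smul_smul, c.leftSt_perm hc.2.1 _ hS (nodup_level _ _), ← pairing] at p2
  have q1 := congrFun (congrFun p1 fun _ => 0) fun _ => 0
  have q2 := congrFun (congrFun p2 fun _ => 0) fun _ => 0
  have q3 := congrFun (congrFun hstep fun _ => 0) fun _ => 0
  have hv := c.vdm_update h hn
  have s0 := c.specProd_ne_zero hc.2.1 (level h 1) n 0
  have s1 := c.specProd_ne_zero hc.2.1 (level h 1) n 1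
  have hA := (hc.2.2 n).1
  have hsh := (hc.2.2 n).2
  simp only [Matrix.of_apply, Matrix.smul_apply, smul_eq_mul] at q1 q2 q3
  rw [← q1, ← q2]
  simp only [Fintype.prod_eq_mul_prod_compl n fun m =>
      (exp (-c.ξ m) / c.AFun (c.η / 2 - c.ξ m)) ^ (h m : ℕ),
    Fintype.prod_eq_mul_prod_compl n fun m =>
      (exp (-c.ξ m) / c.AFun (c.η / 2 - c.ξ m)) ^ (h' m : ℕ),
    Fintype.prod_eq_mul_prod_compl n fun m =>
      (exp (c.ξ m) / (c.fConst m * c.AFun (c.η / 2 - c.ξ m))) ^ (1 - (h m : ℕ)),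
    Fintype.prod_eq_mul_prod_compl n fun m =>
      (exp (c.ξ m) / (c.fConst m * c.AFun (c.η / 2 - c.ξ m))) ^ (1 - (h' m : ℕ))]
  have t1 : ∏ m ∈ {n}ᶜ, (exp (-c.ξ m) / c.AFun (c.η / 2 - c.ξ m)) ^ (h' m : ℕ) =
      ∏ m ∈ {n}ᶜ, (exp (-c.ξ m) / c.AFun (c.η / 2 - c.ξ m)) ^ (h m : ℕ) :=
    Finset.prod_congr rfl fun m hm => by rw [hh', Function.update_of_ne (by simpa using hm)]
  have t2 : ∏ m ∈ {n}ᶜ, (exp (c.ξ m) / (c.fConst m * c.AFun (c.η / 2 - c.ξ m))) ^ (1 - (h' m : ℕ)) =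
      ∏ m ∈ {n}ᶜ, (exp (c.ξ m) / (c.fConst m * c.AFun (c.η / 2 - c.ξ m))) ^ (1 - (h m : ℕ)) :=
    Finset.prod_congr rfl fun m hm => by rw [hh', Function.update_of_ne (by simpa using hm)]
  rw [t1, t2, hn, show h' n = 1 by simp [hh']]
  generalize ∏ m ∈ {n}ᶜ, (exp (-c.ξ m) / c.AFun (c.η / 2 - c.ξ m)) ^ (h m : ℕ) = K1
  generalize ∏ m ∈ {n}ᶜ, (exp (c.ξ m) / (c.fConst m * c.AFun (c.η / 2 - c.ξ m))) ^
    (1 - (h m : ℕ)) = K2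
  generalize (∏ n : Fin N,
    exp (-c.α * c.η - ((N : ℂ) - (((n : ℕ) : ℂ) + 1) + (-β + 2)) * c.η - c.ξ n)) = K0
  generalize c.AFun (c.η / 2 - c.ξ n) = A at *
  -- `fConst n` occurs only through its inverse sinh(2ξ_n - η) / sinh(2ξ_n + η), so a zero of
  -- sinh(2ξ_n - η) needs no separate case.
  simp only [Fin.val_zero, Fin.val_one, pow_zero, pow_one, one_mul, Nat.sub_zero, Nat.sub_self,
    div_eq_mul_inv, mul_inv, fConst, inv_inv]
  have e : exp (2 * c.ξ n) = exp (c.ξ n) * exp (c.ξ n) := by rw [← exp_add]; ring_nf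
  rw [e] at q3
  rw [Complex.exp_neg]
  have hx := exp_ne_zero (c.ξ n)
  generalize exp (c.ξ n) = x at *
  generalize c.specProd (level h 1) n (c.etaPt n 0) = σ0 at *
  generalize c.specProd (level h 1) n (c.etaPt n 1) = σ1 at *
  generalize sinh (2 * c.ξ n + c.η) = f1 at *
  generalize sinh (2 * c.ξ n - c.η) = f0 at *
  generalize c.pairing (c.gaugeY β) (level h 1) (n :: level h' 0) (fun _ => 0) (fun _ => 0) = π0 at *
  generalize c.pairing (c.gaugeY β) (n :: level h 1) (level h' 0) (fun _ => 0) (fun _ => 0) = π1 at *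
  generalize c.vdm h = v0 at *
  generalize c.vdm h' = v1 at *
  field_simp
  have : f0 * x ^ 2 * π0 * v0 * σ0 = f1 * π1 * v1 * σ0 := by
    linear_combination (-v0) * q3 + f1 * π1 * hv
  have := mul_right_cancel₀ s0 this
  linear_combination K0 * K1 * K2 * this

/-- The scalar products of the dual pseudo-eigenstates. -/
theorem vdm_mul_dotProduct (hc : c.GenericMinus) {β : ℂ} (hβ : sinh (β * c.η) ≠ 0)
    (hβ' : sinh ((β - 2) * c.η) ≠ 0) (h : Fin N → Fin 2) :
    c.vdm h * (c.leftState (β - 2) h ⬝ᵥ c.rightState β h) = c.Z (β - 2) := by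
  -- Induction on the number of sites with label 0. At zero the right state is the reference state
  -- and the product is Z by definition.
  obtain ⟨k, hk⟩ : ∃ k, (level h 0).length = k := ⟨_, rfl⟩
  induction k generalizing h with
  | zero =>
    have h1 : h = fun _ => 1 := by
      funext n
      by_contra hn
      have : n ∈ level h 0 := mem_level.2 (by omega)
      rw [List.length_eq_zero_iff.1 hk] at this
      simp at this
    rw [h1, rightState_one, Z, neg_sub, neg_add_eq_sub]
  | succ k ih =>
    obtain ⟨n, l, hl⟩ := List.exists_cons_of_length_eq_add_one hk
    have hn : h n = 0 := mem_level.1 (by rw [hl]; simp)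
    rw [c.vdm_mul_dotProduct_update hc hβ hβ' h hn]
    refine ih _ ?_
    have hh : h = Function.update (Function.update h n 1) n 0 := by
      rw [Function.update_idem, ← hn, Function.update_eq_self]
    have hT : (level h 0).Perm (n :: level (Function.update h n 1) 0) := by
      conv_lhs => rw [hh]
      exact level_update_of_eq (j := 1) (by simp) (by simp)
    have := hT.length_eq
    rw [hk, List.length_cons] at this
    omega

/-- Each row is a sum over h of a scalar times a row of powers of η_a^{(h)}; multilinearity turns
the determinant into a sum of Vandermonde determinants. -/
lemma det_scalarMatrix (ω ρ : Fin N → ℂ → ℂ) : (c.scalarMatrix ω ρ).det =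
    ∑ h : Fin N → Fin 2, (∏ a, ω a (c.zetaPt a (h a))) * (∏ a, ρ a (c.zetaPt a (h a))) *
      c.vdm h := by
  have e : c.scalarMatrix ω ρ = fun a => ∑ i : Fin 2,
      (ω a (c.zetaPt a i) * ρ a (c.zetaPt a i)) • fun b : Fin N => c.etaPt a i ^ (b : ℕ) := by
    funext a b
    simp [scalarMatrix]
  have h1 := (Matrix.detRowAlternating (n := Fin N) (R := ℂ)).toMultilinearMap.map_sum
    fun a (i : Fin 2) =>
      (ω a (c.zetaPt a i) * ρ a (c.zetaPt a i)) • fun b : Fin N => c.etaPt a i ^ (b : ℕ)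
  rw [e]
  refine h1.trans (Finset.sum_congr rfl fun h _ => ?_)
  rw [MultilinearMap.map_smul_univ, Finset.prod_mul_distrib, vdm_eq_det]
  rfl

/-- Scalar products of covectors and vectors of separate form. -/
theorem sepCovector_dotProduct_sepVector (hc : c.GenericMinus) {β : ℂ} (hβ : sinh (β * c.η) ≠ 0)
    (hβ' : sinh ((β - 2) * c.η) ≠ 0) (ω ρ : Fin N → ℂ → ℂ) :
    c.sepCovector (β - 2) ω ⬝ᵥ c.sepVector β ρ = c.Z (β - 2) * (c.scalarMatrix ω ρ).det := by
  rw [sepCovector, sepVector, sum_dotProduct, det_scalarMatrix, Finset.mul_sum]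
  refine Finset.sum_congr rfl fun h _ => ?_
  rw [dotProduct_sum, Finset.sum_eq_single h]
  · rw [smul_dotProduct, dotProduct_smul, smul_eq_mul, smul_eq_mul,
      ← c.vdm_mul_dotProduct hc hβ hβ' h]
    ring
  · intro h' _ hne
    rw [smul_dotProduct, dotProduct_smul,
      c.leftState_dotProduct_rightState_of_ne hc hβ hβ' hne.symm, smul_zero, smul_zero]
  · simp

end Chain

end

/-! ### Nonvanishing of Z and the dual bases -/

section

variable {N : ℕ}

lemma Boundary.Admissible.exp_zeta {B : Boundary} (hB : B.Admissible) :
    exp B.ζ = 2 * B.κ * sinh (B.a + B.b) := by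
  obtain ⟨_, hκ, h1, h2⟩ := hB
  rw [← Complex.cosh_add_sinh, Complex.sinh_add, h1, h2]
  field_simp
  ring

lemma Boundary.Admissible.sinh_ne {B : Boundary} (hB : B.Admissible) :
    sinh B.a * cosh B.b ≠ 0 := by
  rw [hB.2.2.1]
  exact div_ne_zero hB.1 (mul_ne_zero two_ne_zero hB.2.1)

/-- Both sides are quadratic in sinh² x. Their coefficients agree because cosh² ζ - sinh² ζ = 1
becomes 4κ² (cosh² b - 1 - sinh² a) = 1. -/
lemma Boundary.Admissible.det_eq {B : Boundary} (hB : B.Admissible) (x : ℂ) :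
    (sinh (B.ζ + x) * sinh (B.ζ - x) - B.κ ^ 2 * sinh (2 * x) ^ 2) / sinh B.ζ ^ 2 =
      (sinh (B.a + x) * cosh (B.b + x) / (sinh B.a * cosh B.b)) *
        (sinh (B.a - x) * cosh (B.b - x) / (sinh B.a * cosh B.b)) := by
  obtain ⟨hζ, hκ, h1, h2⟩ := id hB
  have h0 := hB.sinh_ne
  have g1 : sinh B.ζ = 2 * B.κ * (sinh B.a * cosh B.b) := by rw [h1]; field_simp
  have g2 : cosh B.ζ = 2 * B.κ * (cosh B.a * sinh B.b) := by rw [h2]; field_simp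
  have e1 := Complex.cosh_sq B.ζ
  have e2 := Complex.cosh_sq B.a
  have e3 := Complex.cosh_sq B.b
  have e4 := Complex.cosh_sq x
  have e5 : 4 * B.κ ^ 2 * (cosh B.b ^ 2 - 1 - sinh B.a ^ 2) = 1 := by
    rw [g1, g2] at e1
    linear_combination e1 - 4 * B.κ ^ 2 * sinh B.b ^ 2 * e2 +
      4 * B.κ ^ 2 * (1 + sinh B.a ^ 2) * e3
  rw [div_mul_div_comm, div_eq_div_iff (pow_ne_zero _ hζ) (mul_ne_zero h0 h0)]
  simp only [Complex.sinh_add, Complex.sinh_sub, Complex.cosh_add, Complex.cosh_sub,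
    Complex.sinh_two_mul]
  have f1 : (sinh B.ζ * cosh x + cosh B.ζ * sinh x) * (sinh B.ζ * cosh x - cosh B.ζ * sinh x) =
      sinh B.ζ ^ 2 - sinh x ^ 2 := by
    linear_combination sinh B.ζ ^ 2 * e4 - sinh x ^ 2 * e1
  have f2 : (sinh B.a * cosh x + cosh B.a * sinh x) * (sinh B.a * cosh x - cosh B.a * sinh x) =
      sinh B.a ^ 2 - sinh x ^ 2 := by
    linear_combination sinh B.a ^ 2 * e4 - sinh x ^ 2 * e2
  have f3 : (cosh B.b * cosh x + sinh B.b * sinh x) * (cosh B.b * cosh x - sinh B.b * sinh x) =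
      cosh B.b ^ 2 + sinh x ^ 2 := by
    linear_combination cosh B.b ^ 2 * e4 + sinh x ^ 2 * e3
  rw [f1, mul_mul_mul_comm (_ + _) (_ + _) (_ - _) (_ - _), f2, f3, g1]
  linear_combination (-4 * B.κ ^ 2 * (sinh B.a * cosh B.b) ^ 2 * sinh x ^ 2) * e4 +
    (sinh B.a * cosh B.b) ^ 2 * sinh x ^ 2 * e5

namespace Chain

variable (c : Chain N)

lemma unitarityFactor_node (hc : c.minus.Admissible) (n : Fin N) :
    c.unitarityFactor (sites N) (c.node n) =
      c.AFun (c.ξ n + c.η / 2) * c.AFun (-c.ξ n + c.η / 2) := by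
  have hg : (sinh (c.minus.ζ + (c.node n - c.η / 2)) * sinh (c.minus.ζ - (c.node n - c.η / 2)) -
      c.minus.κ ^ 2 * sinh (2 * c.node n - c.η) ^ 2) / sinh c.minus.ζ ^ 2 =
      c.g c.minus (c.ξ n + c.η / 2) * c.g c.minus (-c.ξ n + c.η / 2) := by
    rw [show c.node n - c.η / 2 = -c.ξ n by simp only [node]; ring,
      show 2 * c.node n - c.η = 2 * -c.ξ n by simp only [node]; ring, hc.det_eq (-c.ξ n), g, g,
      mul_comm]
    congr 3 <;> congr 1 <;> ring
  have hp : (∏ m, sinh (c.η + (c.node n - c.ξ m - c.η / 2)) *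
      sinh (c.η - (c.node n - c.ξ m - c.η / 2)) * (sinh (c.η + (c.node n + c.ξ m - c.η / 2)) *
        sinh (c.η - (c.node n + c.ξ m - c.η / 2)))) =
      c.aFun (c.ξ n + c.η / 2) * c.dFun (-(c.ξ n + c.η / 2)) *
        (c.aFun (-c.ξ n + c.η / 2) * c.dFun (-(-c.ξ n + c.η / 2))) := by
    simp only [dFun, aFun, ← Finset.prod_mul_distrib]
    refine Finset.prod_congr rfl fun m _ => ?_
    rw [node, show c.η + (c.η / 2 - c.ξ n - c.ξ m - c.η / 2) =
        -c.ξ n + c.η / 2 - c.ξ m + c.η / 2 by ring,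
      show c.η - (c.η / 2 - c.ξ n - c.ξ m - c.η / 2) =
        -(-(c.ξ n + c.η / 2) - c.η - c.ξ m + c.η / 2) by ring,
      show c.η + (c.η / 2 - c.ξ n + c.ξ m - c.η / 2) =
        -(-(-c.ξ n + c.η / 2) - c.η - c.ξ m + c.η / 2) by ring,
      show c.η - (c.η / 2 - c.ξ n + c.ξ m - c.η / 2) =
        c.ξ n + c.η / 2 - c.ξ m + c.η / 2 by ring, Complex.sinh_neg, Complex.sinh_neg]
    ring
  rw [unitarityFactor, prod_sites, hg, hp, AFun, AFun]
  ring

/-- If adding n annihilated a state, the whole gauge row of U would annihilate it, since its second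
entry is proportional to the first. Multiplying by U(η - λ) gives back the original state times the
unitarity scalar, which is nonzero at λ = η/2 - ξ_n. -/
lemma leftSt_ne_zero (hc : c.GenericMinus) (hq : ∀ n, c.AFun (c.ξ n + c.η / 2) ≠ 0) {y : ℂ}
    (S : List (Fin N)) (hS : S.Nodup) : c.leftSt y S ≠ 0 := by
  induction S with
  | nil =>
    intro h
    have h1 := congrFun (congrFun h fun _ => 0) fun _ => 0
    simp [leftSt, refState, rowOp, zState, prodState] at h1
  | cons n S ih =>
    obtain ⟨hn, hS⟩ := List.nodup_cons.1 hS
    intro h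
    rw [leftSt] at h
    have h1 := c.leftSt_rowP_one hS (c.eigB_node hn y)
    rw [h, smul_zero, neg_zero] at h1
    have hu := c.Uminus_mul_Uminus (c.node n)
    have h00 := congrFun (congrFun hu 0) 0
    have h10 := congrFun (congrFun hu 1) 0
    simp only [Matrix.mul_apply, Fin.sum_univ_two, Matrix.smul_apply, Matrix.one_apply_eq,
      Matrix.one_apply_ne (one_ne_zero : (1 : Fin 2) ≠ 0), smul_zero] at h00 h10
    have key : rowP c.Uminus (y * exp c.η) (c.node n) 0 * c.Uminus (c.η - c.node n) 0 0 +
        rowP c.Uminus (y * exp c.η) (c.node n) 1 * c.Uminus (c.η - c.node n) 1 0 =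
        c.unitarityFactor (sites N) (c.node n) • (1 : Op N) := by
      simp only [rowP, sub_mul, smul_mul_assoc]
      rw [← h00]
      have h10' := congrArg (fun X => (y * exp c.η * exp (-c.node n)) • X) h10
      simp only [smul_add, smul_zero] at h10'
      rw [← sub_eq_zero, ← neg_eq_zero, ← h10']
      abel
    have key2 := congrArg (fun X => c.leftSt y S * X) key
    simp only [mul_add, ← mul_assoc, h, h1, zero_mul, add_zero, mul_smul_comm, mul_one] at key2
    refine (ih hS) ((smul_eq_zero.1 key2.symm).resolve_left ?_)
    rw [c.unitarityFactor_node hc.1]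
    refine mul_ne_zero (hq n) ?_
    rw [neg_add_eq_sub]
    exact (hc.2.2 n).1

lemma boundaryFactor_ne_zero (hc : c.minus.Admissible) {β : ℂ} (hβ : c.NonNilpotent β)
    (j : Fin N) : c.boundaryFactor
      (c.gaugeY (β - 2) * exp (-(2 * c.η)) ^ (j : ℕ) * exp c.η ^ N) ≠ 0 := by
  set u : ℂ := ((N : ℂ) - 1) * c.η - (c.α - β + 2 + 2 * ((j : ℕ) : ℂ)) * c.η with hu
  have hY : c.gaugeY (β - 2) * exp (-(2 * c.η)) ^ (j : ℕ) * exp c.η ^ N * exp (c.η / 2) =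
      exp u := by
    rw [gaugeY, ← Complex.exp_nat_mul, ← Complex.exp_nat_mul, ← exp_add, ← exp_add, ← exp_add]
    congr 1
    rw [hu]; ring
  intro h
  rw [boundaryFactor, hY, div_eq_zero_iff, or_iff_left hc.1, hc.exp_zeta] at h
  have e1 : exp u = exp (u - c.minus.τ) * exp c.minus.τ := by rw [← exp_add]; ring_nf
  have e2 : exp c.minus.τ * exp (-c.minus.τ) = 1 := by rw [← exp_add]; simp
  have e3 : exp (c.minus.a + c.minus.b) * exp (-(c.minus.a + c.minus.b)) = 1 := by
    rw [← exp_add]; simp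
  have e4 := Complex.two_sinh (c.minus.a + c.minus.b)
  -- Using exp ζ = 2κ sinh(a + b), the boundary factor splits into linear factors in e^{u-τ}; the
  -- roots e^{a+b} and -e^{-(a+b)} are the even and odd integers k in `NonNilpotent`.
  have h2 : (exp (u - c.minus.τ) - exp (c.minus.a + c.minus.b)) *
      (exp (u - c.minus.τ) + exp (-(c.minus.a + c.minus.b))) = 0 := by
    refine (mul_eq_zero.1 (?_ : -(c.minus.κ * exp c.minus.τ) * _ = 0)).resolve_left
      (neg_ne_zero.2 (mul_ne_zero hc.2.1 (exp_ne_zero _)))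
    rw [e1] at h
    linear_combination h + c.minus.κ * exp (u - c.minus.τ) ^ 2 * exp c.minus.τ * e2 +
      c.minus.κ * exp c.minus.τ * e3 - c.minus.κ * exp (u - c.minus.τ) * exp c.minus.τ * e4
  rcases mul_eq_zero.1 h2 with h3 | h3
  · rw [sub_eq_zero, Complex.exp_eq_exp_iff_exists_int] at h3
    obtain ⟨m, hm⟩ := h3
    refine hβ j (-(2 * m)) ?_
    rw [Even.neg_one_zpow (by simp)]
    push_cast
    rw [hu] at hm
    linear_combination -hm
  · rw [← sub_neg_eq_add, sub_eq_zero, ← mul_neg_one, ← Complex.exp_pi_mul_I, ← exp_add,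
      Complex.exp_eq_exp_iff_exists_int] at h3
    obtain ⟨m, hm⟩ := h3
    refine hβ j (-(2 * m + 1)) ?_
    rw [Odd.neg_one_zpow ⟨-m - 1, by ring⟩]
    push_cast
    rw [hu] at hm
    linear_combination -hm

/-- Each action of `opB` lowers y by e^{-2η}, so successive factors use shifted gauges, but the
point λ may be chosen afresh each time. -/
lemma sum_leftSt_opB {y : ℂ} {a : (Fin N → Fin 2) → ℂ} (lam : ℕ → ℂ)
    (h : ∑ h, a h • c.leftSt y (level h 1) = 0) (k : ℕ) :
    ∑ h, (a h * ∏ j ∈ Finset.range k,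
      c.eigB (y * exp (-(2 * c.η)) ^ j) (level h 1) (lam j)) •
        c.leftSt (y * exp (-(2 * c.η)) ^ k) (level h 1) = 0 := by
  induction k with
  | zero => simpa using h
  | succ k ih =>
    have := congrArg (fun X => X * opB c.η c.Uminus (y * exp (-(2 * c.η)) ^ k) (lam k)) ih
    simp only [Finset.sum_mul, smul_mul_assoc, zero_mul, c.leftSt_opB (nodup_level _ _),
      smul_smul] at this
    rw [← this]
    refine Finset.sum_congr rfl fun h _ => ?_
    rw [Finset.prod_range_succ, pow_succ, mul_assoc, mul_assoc]

theorem leftSt_linearIndependent (hc : c.GenericMinus) {β : ℂ}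
    (hq : ∀ n, c.AFun (c.ξ n + c.η / 2) ≠ 0) (hβ : c.NonNilpotent β) {a : (Fin N → Fin 2) → ℂ}
    (ha : ∑ h, a h • c.leftSt (c.gaugeY (β - 2)) (level h 1) = 0) : a = 0 := by
  funext h0
  -- The j-th action of `opB` is taken at the value of η_j opposite to the label h0, which removes
  -- every state differing from h0 at site j. After N actions only h0 is left.
  have hex : ∀ n, ∃ lam, cosh (2 * lam) = c.etaPt n (1 - h0 n) ∧ sinh (2 * lam - c.η) ≠ 0 :=
    fun n => c.exists_spectral_point hc.2.1 n _
  choose lam h1 h2 using hex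
  set lam' : ℕ → ℂ := fun j => if hj : j < N then lam ⟨j, hj⟩ else 0 with hlam'
  have hl : ∀ n : Fin N, lam' n = lam n := fun n => by simp [hlam']
  have key := c.sum_leftSt_opB lam' ha N
  have hlev : ∀ (h : Fin N → Fin 2) (n : Fin N), (if n ∈ level h 1 then (1 : Fin 2) else 0) = h n := by
    intro h n
    simp only [mem_level]
    split_ifs with h3
    · exact h3.symm
    · omega
  rw [Finset.sum_eq_single h0] at key
  · have h3 := (smul_eq_zero.1 key).resolve_right
      (c.leftSt_ne_zero hc hq _ (nodup_level _ _))
    refine (mul_eq_zero.1 h3).resolve_right (Finset.prod_ne_zero_iff.2 fun j hj => ?_)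
    have hj' : j < N := Finset.mem_range.1 hj
    refine c.eigB_ne_zero hc.2.1 (n := ⟨j, hj'⟩) (i := 1 - h0 ⟨j, hj'⟩) ?_ ?_ ?_ ?_
    · rw [hlev]
      omega
    · rw [hl ⟨j, hj'⟩, h1]
    · rw [hl ⟨j, hj'⟩]
      exact h2 _
    · exact c.boundaryFactor_ne_zero hc.1 hβ ⟨j, hj'⟩
  · intro h _ hne
    obtain ⟨n, hn⟩ := Function.ne_iff.1 hne
    rw [Finset.prod_eq_zero (Finset.mem_range.2 n.isLt), mul_zero, zero_smul]
    refine c.eigB_eq_zero (n := n) ?_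
    rw [hl, h1, hlev]
    congr 1
    omega
  · simp

theorem Z_ne_zero (hc : c.GenericMinus) {β : ℂ} (hs : sinh (β * c.η) ≠ 0)
    (hs' : sinh ((β - 2) * c.η) ≠ 0) (hq : ∀ n, c.AFun (c.ξ n + c.η / 2) ≠ 0)
    (hβ : c.NonNilpotent β) : c.Z (β - 2) ≠ 0 := by
  intro hZ
  have hsp := hc.2.1
  have hv : ∀ h, c.vdm h ≠ 0 := fun h => by
    rw [vdm_eq_det, Matrix.det_vandermonde_ne_zero_iff]
    intro a b hab
    exact congrArg Prod.fst (@hsp (a, h a) (b, h b) hab)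
  -- If Z were zero, the right reference state would be orthogonal to a full basis of covectors, yet
  -- one of its components is 1.
  have hdot : ∀ h, c.leftState (β - 2) h ⬝ᵥ c.rightState β (fun _ => 1) = 0 := by
    intro h
    by_cases h1 : h = fun _ => 1
    · rw [h1]
      have := c.vdm_mul_dotProduct hc hs hs' fun _ => 1
      rw [hZ] at this
      exact (mul_eq_zero.1 this).resolve_left (hv _)
    · exact c.leftState_dotProduct_rightState_of_ne hc hs hs' h1
  have hli : LinearIndependent ℂ (c.leftState (β - 2)) := by
    rw [Fintype.linearIndependent_iff]
    intro a ha h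
    have h1 := congrArg rowOp ha
    have h2 : rowOp (∑ h, a h • c.leftState (β - 2) h) =
        ∑ h, a h • rowOp (c.leftState (β - 2) h) := by
      ext s t
      simp [rowOp, Matrix.sum_apply]
    have h3 : rowOp (0 : Vec N) = 0 := rfl
    rw [h2, h3] at h1
    simp only [c.rowOp_leftState hc.2.1 hs', smul_smul] at h1
    have h4 := congrFun (c.leftSt_linearIndependent hc hq hβ h1) h
    refine (mul_eq_zero.1 h4).resolve_right (mul_ne_zero (pow_ne_zero _ (by simp))
      (Finset.prod_ne_zero_iff.2 fun n _ => pow_ne_zero _ (div_ne_zero (exp_ne_zero _)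
        (hc.2.2 n).1)))
  have hP : LinearIndependent ℂ (Matrix.of (c.leftState (β - 2))).row := hli
  have hu := (Matrix.linearIndependent_rows_iff_isUnit.1 hP)
  have hmul : (Matrix.of (c.leftState (β - 2))).mulVec (c.rightState β fun _ => 1) = 0 := by
    funext h
    exact hdot h
  have h0 : c.rightState β (fun _ => 1) = 0 := by
    have := congrArg ((Matrix.of (c.leftState (β - 2)))⁻¹.mulVec) hmul
    rwa [Matrix.mulVec_mulVec, Matrix.nonsing_inv_mul _ ((Matrix.isUnit_iff_isUnit_det _).1 hu),
      Matrix.one_mulVec, Matrix.mulVec_zero] at this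
  rw [rightState_one] at h0
  have h1 := congrFun h0 fun _ => 1
  simp [rightRef] at h1

/-- Expansion of covectors and vectors in the dual pseudo-eigenbases. -/
theorem expansion (hc : c.GenericMinus) {β : ℂ} (hs : sinh (β * c.η) ≠ 0)
    (hs' : sinh ((β - 2) * c.η) ≠ 0) (hZ : c.Z (β - 2) ≠ 0) :
    (∀ w : Vec N, w = ∑ h, ((w ⬝ᵥ c.rightState β h) * (c.vdm h / c.Z (β - 2))) •
      c.leftState (β - 2) h) ∧
    ∀ v : Vec N, v = ∑ h, ((c.leftState (β - 2) h ⬝ᵥ v) * (c.vdm h / c.Z (β - 2))) •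
      c.rightState β h := by
  set P : Op N := Matrix.of (c.leftState (β - 2))
  set Q : Op N := (Matrix.of (c.rightState β)).transpose
  set D : Op N := Matrix.diagonal fun h => c.vdm h / c.Z (β - 2)
  have h1 : D * (P * Q) = 1 := by
    ext h h'
    rw [Matrix.diagonal_mul, Matrix.one_apply]
    change c.vdm h / c.Z (β - 2) * (c.leftState (β - 2) h ⬝ᵥ c.rightState β h') = _
    split_ifs with hh
    · rw [← hh, div_mul_eq_mul_div, c.vdm_mul_dotProduct hc hs hs', div_self hZ]
    · rw [c.leftState_dotProduct_rightState_of_ne hc hs hs' hh, mul_zero]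
  -- For square matrices a left inverse is a right inverse: the diagonal duality relation becomes
  -- the resolution of the identity.
  rw [← mul_assoc, mul_eq_one_comm, ← mul_assoc] at h1
  constructor
  · intro w
    have h2 := congrArg (Matrix.vecMul w) h1
    rw [Matrix.vecMul_one, ← Matrix.vecMul_vecMul, ← Matrix.vecMul_vecMul] at h2
    conv_lhs => rw [← h2]
    rw [Matrix.vecMul_eq_sum]
    refine Finset.sum_congr rfl fun h _ => ?_
    rw [Matrix.vecMul_diagonal]
    rfl
  · intro v
    have h2 := congrArg (fun X => Matrix.mulVec X v) h1
    simp only [Matrix.one_mulVec, ← Matrix.mulVec_mulVec] at h2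
    conv_lhs => rw [← h2]
    rw [Matrix.mulVec_eq_sum]
    refine Finset.sum_congr rfl fun h _ => ?_
    rw [Matrix.mulVec_diagonal, mul_comm, op_smul_eq_smul]
    rfl

end Chain

end

/-! ### Action of the transfer matrix and separation of its eigenstates -/

section

variable {N : ℕ}

lemma sinh_mul_exp_sub (x z : ℂ) :
    sinh (x + z) * exp (-x) - sinh (z - x) * exp x = exp (-z) * sinh (2 * x) := by
  simp only [Complex.sinh, sub_eq_add_neg, neg_add, exp_add, neg_neg, two_mul]
  have h1 := Complex.exp_neg x
  have h2 := Complex.exp_neg z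
  have h3 := exp_ne_zero x
  have h4 := exp_ne_zero z
  rw [h1, h2]
  field_simp
  ring

lemma sinh_mul_sinh_add (x X z : ℂ) :
    sinh (x + X) * sinh (x + z) + sinh (x - X) * sinh (z - x) = sinh (2 * x) * sinh (X + z) := by
  simp only [Complex.sinh_add, Complex.sinh_sub, Complex.sinh_two_mul]
  ring

lemma sinh_mul_exp_add (x X : ℂ) :
    sinh (x + X) * exp (2 * X - x) - sinh (x - X) * exp (-x) = exp X * sinh (2 * X) := by
  simp only [Complex.sinh, sub_eq_add_neg, neg_add, exp_add, neg_neg, two_mul]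
  have h1 := Complex.exp_neg x
  have h2 := Complex.exp_neg X
  have h3 := exp_ne_zero x
  have h4 := exp_ne_zero X
  rw [h1, h2]
  field_simp
  ring

lemma Boundary.Admissible.exp_neg_zeta {B : Boundary} (hB : B.Admissible) :
    exp (-B.ζ) = 2 * B.κ * sinh (B.b - B.a) := by
  obtain ⟨_, hκ, h1, h2⟩ := hB
  rw [← Complex.cosh_sub_sinh, Complex.sinh_sub, mul_comm (sinh B.b), mul_comm (cosh B.b), h1, h2]
  field_simp

/-- `W` solves the quadratic equation which makes the boundary matrix triangular. -/
def Boundary.IsTriangularRoot (B : Boundary) (W : ℂ) : Prop :=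
  W = exp (B.b - B.a) ∨ W = -exp (B.a - B.b)

lemma Boundary.IsTriangularRoot.eq {B : Boundary} (hB : B.Admissible) {W : ℂ}
    (hW : B.IsTriangularRoot W) : W * exp (-B.ζ) + B.κ - B.κ * W ^ 2 = 0 := by
  have e1 := Complex.two_sinh (B.b - B.a)
  rw [neg_sub] at e1
  have e2 : exp (B.b - B.a) * exp (B.a - B.b) = 1 := by rw [← exp_add]; simp
  rw [hB.exp_neg_zeta]
  rcases hW with rfl | rfl
  · linear_combination B.κ * exp (B.b - B.a) * e1 - B.κ * e2
  · linear_combination -B.κ * exp (B.a - B.b) * e1 - B.κ * e2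

/-- For either root the expression is 2κ e^X times one of the two halves of the product in `hX`. -/
lemma Boundary.IsTriangularRoot.sinh_sub_ne_zero {B : Boundary} (hB : B.Admissible) {W X : ℂ}
    (hW : B.IsTriangularRoot W)
    (hX : sinh (B.a - X) * cosh (B.b + X) * (sinh (B.a + X) * cosh (B.b - X)) ≠ 0) :
    sinh (X + B.ζ) - B.κ * W * exp X * sinh (2 * X) ≠ 0 := by
  have e0 := Complex.two_sinh (X + B.ζ)
  rw [neg_add, exp_add, exp_add, hB.exp_zeta, hB.exp_neg_zeta] at e0
  have hk := hB.2.1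
  have hE := exp_ne_zero X
  have hA := exp_ne_zero B.a
  have hb := exp_ne_zero B.b
  rcases hW with rfl | rfl
  · have : sinh (X + B.ζ) - B.κ * exp (B.b - B.a) * exp X * sinh (2 * X) =
        2 * B.κ * exp X * (sinh (B.a - X) * cosh (B.b + X)) := by
      refine mul_left_cancel₀ (two_ne_zero (α := ℂ)) ?_
      rw [mul_sub, e0]
      simp only [Complex.sinh, Complex.cosh, sub_eq_add_neg, neg_add, exp_add, neg_neg, two_mul,
        Complex.exp_neg]
      field_simp
      ring
    rw [this]
    exact mul_ne_zero (mul_ne_zero (mul_ne_zero two_ne_zero hk) hE) (left_ne_zero_of_mul hX)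
  · have : sinh (X + B.ζ) - B.κ * -exp (B.a - B.b) * exp X * sinh (2 * X) =
        2 * B.κ * exp X * (sinh (B.a + X) * cosh (B.b - X)) := by
      refine mul_left_cancel₀ (two_ne_zero (α := ℂ)) ?_
      rw [mul_sub, e0]
      simp only [Complex.sinh, Complex.cosh, sub_eq_add_neg, neg_add, exp_add, neg_neg, two_mul,
        Complex.exp_neg]
      field_simp
      ring
    rw [this]
    exact mul_ne_zero (mul_ne_zero (mul_ne_zero two_ne_zero hk) hE) (right_ne_zero_of_mul hX)

namespace Chain

variable (c : Chain N)

lemma transfer_eq (lam : ℂ) : c.transfer lam =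
    c.Kplus lam 0 0 • c.Uminus lam 0 0 + c.Kplus lam 0 1 • c.Uminus lam 1 0 +
      (c.Kplus lam 1 0 • c.Uminus lam 0 1 + c.Kplus lam 1 1 • c.Uminus lam 1 1) := by
  simp only [transfer, Matrix.trace, Matrix.diag, Fin.sum_univ_two, Matrix.mul_apply, aux,
    Matrix.map_apply, Algebra.algebraMap_eq_smul_one, smul_mul_assoc, one_mul]

/-- The transfer matrix in a gauge in which `K₊` is triangular. -/
lemma transfer_eq_rowP_colD (hB : c.plus.Admissible) {V : ℂ}
    (hV : c.plus.IsTriangularRoot (V * exp (c.η / 2) * exp (-c.plus.τ))) (lam : ℂ) :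
    c.transfer lam = c.Kplus lam 0 0 • rowP c.Uminus V lam 0 +
      c.Kplus lam 1 0 • rowP c.Uminus V lam 1 +
      (c.Kplus lam 1 0 * (V * exp (-lam)) + c.Kplus lam 1 1) •
        colD c.Uminus (V * exp c.η) lam := by
  have h1 := hV.eq hB
  have e1 : exp c.plus.τ * exp (-c.plus.τ) = 1 := by rw [← exp_add]; simp
  have e2 := sinh_mul_exp_sub (lam + c.η / 2) c.plus.ζ
  have e3 : exp c.η = exp (c.η / 2) * exp (c.η / 2) := by rw [← exp_add]; ring_nf
  have e4 : exp (lam + c.η / 2) = exp lam * exp (c.η / 2) := exp_add _ _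
  have e5 : exp (-(lam + c.η / 2)) * exp (c.η / 2) = exp (-lam) := by rw [← exp_add]; ring_nf
  have e6 : exp (-lam) * exp lam = 1 := by rw [← exp_add]; simp
  -- The four entries of U must be recombined into only three operators. This is the single
  -- compatibility condition, and it is the quadratic equation for the triangular root.
  have key : c.Kplus lam 0 0 * (V * exp (-lam)) + c.Kplus lam 0 1 =
      (c.Kplus lam 1 0 * (V * exp (-lam)) + c.Kplus lam 1 1) * (V * exp c.η * exp lam) := by
    simp only [Kplus, Kmat, Matrix.smul_apply, Matrix.of_apply, Matrix.cons_val', smul_eq_mul,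
      Matrix.cons_val_zero, Matrix.cons_val_one, Matrix.cons_val_fin_one]
    rw [show lam + c.η - c.η / 2 + c.plus.ζ = lam + c.η / 2 + c.plus.ζ by ring,
      show c.plus.ζ - (lam + c.η) + c.η / 2 = c.plus.ζ - (lam + c.η / 2) by ring,
      show 2 * (lam + c.η) - c.η = 2 * (lam + c.η / 2) by ring]
    linear_combination (-(sinh c.plus.ζ)⁻¹ * sinh (lam + c.η / 2 + c.plus.ζ) * V) * e5 +
      (sinh c.plus.ζ)⁻¹ * V * exp (c.η / 2) * e2 +
      (sinh c.plus.ζ)⁻¹ * sinh (2 * (lam + c.η / 2)) * exp c.plus.τ * h1 -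
      ((sinh c.plus.ζ)⁻¹ * c.plus.κ * exp (-c.plus.τ) * sinh (2 * (lam + c.η / 2)) * V ^ 2 *
        exp (-lam) * exp lam + (sinh c.plus.ζ)⁻¹ * sinh (c.plus.ζ - (lam + c.η / 2)) * V *
        exp lam) * e3 -
      ((sinh c.plus.ζ)⁻¹ * c.plus.κ * exp (-c.plus.τ) * sinh (2 * (lam + c.η / 2)) * V ^ 2 *
        exp (c.η / 2) ^ 2) * e6 +
      (sinh c.plus.ζ)⁻¹ * sinh (c.plus.ζ - (lam + c.η / 2)) * V * exp (c.η / 2) * e4 -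
      (sinh c.plus.ζ)⁻¹ * sinh (2 * (lam + c.η / 2)) * (V * exp (c.η / 2) * exp (-c.plus.ζ) -
        c.plus.κ * exp (-c.plus.τ) * V ^ 2 * exp (c.η / 2) ^ 2) * e1
  rw [transfer_eq, rowP, rowP, colD]
  match_scalars
  · ring
  · linear_combination key
  · ring
  · ring

/-- The coefficient of the action of the transfer matrix on the left states. -/
def transferCoeff (y : ℂ) (n : Fin N) : ℂ :=
  sinh (2 * c.η - 2 * c.ξ n) / sinh c.plus.ζ *
    (sinh (-c.ξ n + c.plus.ζ) - c.plus.κ *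
      (y * exp c.η * exp (c.η / 2) * exp (-c.plus.τ)) * exp (-c.ξ n) * sinh (2 * -c.ξ n))

/-- Action of the transfer matrix on the left states. -/
theorem leftSt_transfer (hc : c.SimpleSpectrum) (hB : c.plus.Admissible) {y : ℂ}
    (hy : c.plus.IsTriangularRoot (y * exp c.η * exp (c.η / 2) * exp (-c.plus.τ)))
    {S : List (Fin N)} (hS : S.Nodup) {n : Fin N} (hn : n ∉ S) :
    sinh (2 * c.node n) • (c.leftSt y S * c.transfer (c.node n)) =
      c.transferCoeff y n • c.leftSt y (n :: S) := by
  have h1 := c.leftSt_rowP_one hS (c.eigB_node hn y)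
  have h2 := congrArg (fun X => c.leftSt y S * X)
    (c.Uminus_parity.rowP_neg (y * exp c.η) (c.node n))
  simp only [mul_smul_comm, mul_sub, c.leftSt_rowP_neg_node hc hS hn, smul_zero] at h2
  have h3 := sub_eq_zero.1 h2.symm
  rw [c.transfer_eq_rowP_colD hB hy, mul_add, mul_add, mul_smul_comm, mul_smul_comm, mul_smul_comm,
    h1, smul_add, smul_comm (sinh (2 * c.node n)) (_ + _ : ℂ), h3, leftSt]
  generalize c.leftSt y S * rowP c.Uminus (y * exp c.η) (c.node n) 0 = χ
  match_scalars
  have e1 := sinh_mul_sinh_add (c.η - c.ξ n) (-c.ξ n) c.plus.ζ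
  have e2 := sinh_mul_exp_add (c.η - c.ξ n) (-c.ξ n)
  simp only [transferCoeff, Kplus, Kmat, Matrix.smul_apply, Matrix.of_apply, Matrix.cons_val',
    smul_eq_mul, Matrix.cons_val_zero, Matrix.cons_val_one, Matrix.cons_val_fin_one, node]
  rw [show c.η / 2 - c.ξ n + c.η - c.η / 2 + c.plus.ζ = c.η - c.ξ n + c.plus.ζ by ring,
    show c.plus.ζ - (c.η / 2 - c.ξ n + c.η) + c.η / 2 = c.plus.ζ - (c.η - c.ξ n) by ring,
    show 2 * (c.η / 2 - c.ξ n + c.η) - c.η = 2 * (c.η - c.ξ n) by ring,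
    show 2 * c.η - 2 * c.ξ n = 2 * (c.η - c.ξ n) by ring,
    show 2 * (c.η / 2 - c.ξ n) = c.η - c.ξ n + -c.ξ n by ring]
  rw [show c.η - c.ξ n - -c.ξ n = c.η by ring] at e1 e2
  have f1 : exp (c.η / 2 - c.ξ n) =
      exp c.η * exp (c.η / 2) * exp (2 * -c.ξ n - (c.η - c.ξ n)) := by
    rw [← exp_add, ← exp_add]; ring_nf
  have f2 : exp (-(c.η / 2 - c.ξ n)) = exp (c.η / 2) * exp (-(c.η - c.ξ n)) := by
    rw [← exp_add]; ring_nf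
  rw [f1, f2]
  linear_combination (sinh c.plus.ζ)⁻¹ * e1 - (sinh c.plus.ζ)⁻¹ * c.plus.κ * exp (-c.plus.τ) *
    sinh (2 * (c.η - c.ξ n)) * y * exp c.η * exp (c.η / 2) * e2

lemma leftSt_mul_eigen (hc : c.SimpleSpectrum) (hB : c.plus.Admissible) {y : ℂ}
    (hy : c.plus.IsTriangularRoot (y * exp c.η * exp (c.η / 2) * exp (-c.plus.τ)))
    (hC : ∀ n, c.transferCoeff y n ≠ 0) {X : Op N} {t : ℂ → ℂ}
    (hX : ∀ lam, c.transfer lam * X = t lam • X) :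
    ∃ r : Fin N → ℂ, ∀ S : List (Fin N), S.Nodup →
      c.leftSt y S * X = (S.map r).prod • (c.leftSt y [] * X) := by
  -- Adding n multiplies the component of the eigenvector by the eigenvalue at η/2 - ξ_n divided by
  -- the transfer coefficient.
  refine ⟨fun n => sinh (2 * c.node n) * t (c.node n) / c.transferCoeff y n, fun S hS => ?_⟩
  induction S with
  | nil => simp
  | cons n S ih =>
    obtain ⟨hn, hS⟩ := List.nodup_cons.1 hS
    have h := congrArg (fun Y => Y * X) (c.leftSt_transfer hc hB hy hS hn)
    simp only [smul_mul_assoc, mul_assoc, hX, mul_smul_comm, ih hS, smul_smul] at h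
    refine smul_right_injective _ (hC n) ?_
    dsimp only
    rw [← h, smul_smul, List.map_cons, List.prod_cons]
    congr 1
    have := hC n
    field_simp

lemma transferCoeff_ne_zero (hB : c.plus.Admissible) {y : ℂ}
    (hy : c.plus.IsTriangularRoot (y * exp c.η * exp (c.η / 2) * exp (-c.plus.τ))) {n : Fin N}
    (h1 : sinh (2 * c.η - 2 * c.ξ n) ≠ 0)
    (h2 : c.g c.plus (c.ξ n + c.η / 2) * c.g c.plus (-c.ξ n + c.η / 2) ≠ 0) :
    c.transferCoeff y n ≠ 0 := by
  refine mul_ne_zero (div_ne_zero h1 hB.1) (hy.sinh_sub_ne_zero hB ?_)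
  rw [g, g, div_mul_div_comm, div_ne_zero_iff] at h2
  have h3 := h2.1
  rw [show c.ξ n + c.η / 2 + c.plus.a - c.η / 2 = c.plus.a - -c.ξ n by ring,
    show c.ξ n + c.η / 2 + c.plus.b - c.η / 2 = c.plus.b - -c.ξ n by ring,
    show -c.ξ n + c.η / 2 + c.plus.a - c.η / 2 = c.plus.a + -c.ξ n by ring,
    show -c.ξ n + c.η / 2 + c.plus.b - c.η / 2 = c.plus.b + -c.ξ n by ring] at h3
  rw [mul_assoc, mul_left_comm (cosh _), ← mul_assoc]
  simp only [mul_ne_zero_iff] at h3 ⊢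
  tauto

lemma prod_map_level (h : Fin N → Fin 2) (i : Fin 2) (r : Fin N → ℂ) :
    ((level h i).map r).prod = ∏ n, if h n = i then r n else 1 := by
  rw [← prod_map_finRange, level]
  induction List.finRange N with
  | nil => rfl
  | cons n l ih =>
    by_cases hn : h n = i
    · simp [hn, ih]
    · simp [hn, ih]

lemma exists_wave_functions (hc : c.SimpleSpectrum) (hN : 1 ≤ N) (K : ℂ) (u : Fin N → Fin 2 → ℂ) :
    ∃ ρ : Fin N → ℂ → ℂ, ∀ h : Fin N → Fin 2,
      ∏ a, ρ a (c.zetaPt a (h a)) = K * ∏ a, u a (h a) := by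
  have hne : ∀ a, c.zetaPt a 1 ≠ c.zetaPt a 0 := by
    intro a h
    have : c.etaPt a 1 = c.etaPt a 0 := by rw [etaPt, etaPt, h]
    simpa using congrArg Prod.snd (@hc (a, 1) (a, 0) this)
  -- The overall constant is put into the wave function of the first site, which is why N ≥ 1 is
  -- needed. The test on z works because the two points of each site differ.
  refine ⟨fun a z => (if a = ⟨0, hN⟩ then K else 1) * if z = c.zetaPt a 0 then u a 0 else u a 1,
    fun h => ?_⟩
  rw [Finset.prod_mul_distrib, Finset.prod_ite_eq' Finset.univ, if_pos (Finset.mem_univ _)]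
  congr 1
  refine Finset.prod_congr rfl fun a _ => ?_
  obtain h0 | h1 : h a = 0 ∨ h a = 1 := by omega
  · rw [h0, if_pos rfl]
  · rw [h1, if_neg (hne a)]

lemma TriangularGauge.isTriangularRoot {c : Chain N} {β : ℂ} (h : c.TriangularGauge β) :
    c.plus.IsTriangularRoot
      (c.gaugeY (β - 2) * exp c.η * exp (c.η / 2) * exp (-c.plus.τ)) := by
  obtain ⟨k, hk⟩ := h
  rw [gaugeY, ← exp_add, ← exp_add, ← exp_add,
    show -(c.η / 2) - (c.α - (β - 2) + 1) * c.η + c.η + c.η / 2 + -c.plus.τ =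
      -((c.α - β + 2) * c.η) - c.plus.τ by ring, hk]
  -- The parity of k selects which of the two roots of the quadratic equation occurs.
  rcases Int.even_or_odd' k with ⟨m, rfl | rfl⟩
  · left
    rw [Even.neg_one_zpow (by simp), Complex.exp_eq_exp_iff_exists_int]
    refine ⟨-m, ?_⟩
    push_cast
    ring
  · right
    have hneg : -exp (c.plus.a - c.plus.b) = exp (c.plus.a - c.plus.b + Real.pi * I) := by
      rw [exp_add, Complex.exp_pi_mul_I, mul_neg_one]
    rw [Odd.neg_one_zpow ⟨m, rfl⟩, hneg, Complex.exp_eq_exp_iff_exists_int]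
    refine ⟨-m - 1, ?_⟩
    push_cast
    ring

/-- The dual gauge replaces the root W by -W⁻¹, which exchanges the two roots. -/
lemma TriangularGauge.isTriangularRoot_dual {c : Chain N} {β : ℂ} (h : c.TriangularGauge β) :
    c.dual.plus.IsTriangularRoot
      (-(exp c.η * c.gaugeY β)⁻¹ * exp c.dual.η * exp (c.dual.η / 2) *
        exp (-c.dual.plus.τ)) := by
  have h1 := h.isTriangularRoot
  have e : -(exp c.η * c.gaugeY β)⁻¹ * exp c.dual.η * exp (c.dual.η / 2) * exp (-c.dual.plus.τ) =
      -(c.gaugeY (β - 2) * exp c.η * exp (c.η / 2) * exp (-c.plus.τ))⁻¹ := by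
    rw [gaugeY_sub_two]
    simp only [dual, neg_mul, gaugeY, ← exp_add, ← Complex.exp_neg]
    congr 2
    ring
  rw [e]
  rcases h1 with h1 | h1
  · right
    rw [h1, ← Complex.exp_neg, neg_sub]
    rfl
  · left
    rw [h1, inv_neg, neg_neg, ← Complex.exp_neg, neg_sub]
    rfl

lemma leftState_dotProduct_eigenstate (hc : c.GenericMinus) {β : ℂ}
    (hs' : sinh ((β - 2) * c.η) ≠ 0) (hB : c.plus.Admissible) (hT : c.TriangularGauge β)
    (hq : ∀ n, c.qdetKplus (c.ξ n) * c.qdetUminus (c.ξ n) ≠ 0) {v : Vec N}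
    (hv : c.IsRightEigenstate v) : ∃ (K : ℂ) (u : Fin N → Fin 2 → ℂ), ∀ h,
      c.leftState (β - 2) h ⬝ᵥ v = K * ∏ a, u a (h a) := by
  obtain ⟨_, t, ht⟩ := hv
  have hX : ∀ lam, c.transfer lam * (rowOp v).transpose = t lam • (rowOp v).transpose := by
    intro lam
    rw [← Matrix.transpose_transpose (c.transfer lam), ← Matrix.transpose_mul, rowOp_mul,
      Matrix.vecMul_transpose, ht, rowOp_smul, Matrix.transpose_smul]
  have hr := hT.isTriangularRoot
  -- The factor sinh(2ξ_n - 2η) needed here is part of the quantum determinant of U_-; for the dual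
  -- chain below its role is played by sinh(2ξ_n + 2η), from the quantum determinant of K_+.
  obtain ⟨r, hr⟩ := c.leftSt_mul_eigen hc.2.1 hB hr (fun n => by
    have h := hq n
    simp only [qdetKplus, qdetUminus, mul_ne_zero_iff, neg_ne_zero] at h
    refine c.transferCoeff_ne_zero hB hr ?_ (mul_ne_zero h.1.1.2 h.1.2)
    rw [← neg_sub, Complex.sinh_neg, neg_ne_zero]
    exact h.2.1.1) hX
  refine ⟨(-1) ^ N * (c.leftSt (c.gaugeY (β - 2)) [] * (rowOp v).transpose) (fun _ => 0) fun _ => 0,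
    fun a i => (exp (-c.ξ a) / c.AFun (c.η / 2 - c.ξ a)) ^ (i : ℕ) * if i = 1 then r a else 1,
    fun h => ?_⟩
  have h1 := rowOp_mul_transpose (c.leftState (β - 2) h) v
  rw [c.rowOp_leftState hc.2.1 hs', smul_mul_assoc, hr _ (nodup_level _ _), prod_map_level] at h1
  have h2 := congrFun (congrFun h1 fun _ => 0) fun _ => 0
  simp only [Matrix.of_apply, Matrix.smul_apply, smul_eq_mul] at h2
  rw [← h2, Finset.prod_mul_distrib]
  ring

lemma eigenstate_dotProduct_rightState (hc : c.GenericMinus) {β : ℂ}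
    (hs : sinh (β * c.η) ≠ 0) (hB : c.plus.Admissible) (hT : c.TriangularGauge β)
    (hq : ∀ n, c.qdetKplus (c.ξ n) * c.qdetUminus (c.ξ n) ≠ 0) {w : Vec N}
    (hw : c.IsLeftEigenstate w) : ∃ (K : ℂ) (u : Fin N → Fin 2 → ℂ), ∀ h,
      w ⬝ᵥ c.rightState β h = K * ∏ a, u a (h a) := by
  obtain ⟨_, t, ht⟩ := hw
  have hX : ∀ lam, c.dual.transfer lam * (rowOp w).transpose = t lam • (rowOp w).transpose := by
    intro lam
    rw [transfer_dual, ← Matrix.transpose_mul, rowOp_mul, ht, rowOp_smul, Matrix.transpose_smul]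
  have hr := hT.isTriangularRoot_dual
  have hB' : c.dual.plus.Admissible := hB
  obtain ⟨r, hr⟩ := c.dual.leftSt_mul_eigen (SimpleSpectrum.dual hc.2.1) hB' hr (fun n => by
    have h := hq n
    simp only [qdetKplus, mul_ne_zero_iff, neg_ne_zero] at h
    refine c.dual.transferCoeff_ne_zero hB' hr ?_ ?_
    · have e : 2 * c.dual.η - 2 * c.dual.ξ n = 2 * c.ξ n + 2 * c.η := by simp [dual]; ring
      rw [e]
      exact h.1.1.1
    · have e1 : c.dual.g c.dual.plus (c.dual.ξ n + c.dual.η / 2) =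
          c.g c.plus (-c.ξ n + c.η / 2) := rfl
      have e2 : c.dual.g c.dual.plus (-c.dual.ξ n + c.dual.η / 2) =
          c.g c.plus (c.ξ n + c.η / 2) := by simp [dual, g]
      rw [e1, e2]
      exact mul_ne_zero h.1.2 h.1.1.2) hX
  refine ⟨(∏ n : Fin N,
        exp (-c.α * c.η - ((N : ℂ) - (((n : ℕ) : ℂ) + 1) + (-β + 2)) * c.η - c.ξ n)) *
      (c.dual.leftSt (-(exp c.η * c.gaugeY β)⁻¹) [] * (rowOp w).transpose) (fun _ => 0)
        fun _ => 0,
    fun a i => (exp (c.ξ a) / (c.fConst a * c.AFun (c.η / 2 - c.ξ a))) ^ (1 - (i : ℕ)) *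
      if i = 0 then r a else 1,
    fun h => ?_⟩
  have h1 := rowOp_mul_transpose w (c.rightState β h)
  have h3 := congrArg Matrix.transpose h1
  rw [c.rowOp_rightState hs, mul_smul_comm, Matrix.transpose_smul, Matrix.transpose_mul, rightSt,
    Matrix.transpose_transpose, hr _ (nodup_level _ _), prod_map_level] at h3
  have h2 := congrFun (congrFun h3 fun _ => 0) fun _ => 0
  simp only [Matrix.of_apply, Matrix.smul_apply, smul_eq_mul, Matrix.transpose_apply] at h2
  rw [← h2, Finset.prod_mul_distrib]
  ring

theorem eigenstates_separate (hc : c.GenericMinus) {β : ℂ} (hs : sinh (β * c.η) ≠ 0)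
    (hs' : sinh ((β - 2) * c.η) ≠ 0) (hN : 1 ≤ N) (hB : c.plus.Admissible)
    (hT : c.TriangularGauge β) (hβ : c.NonNilpotent β)
    (hq : ∀ n, c.qdetKplus (c.ξ n) * c.qdetUminus (c.ξ n) ≠ 0) {w v : Vec N}
    (hw : c.IsLeftEigenstate w) (hv : c.IsRightEigenstate v) :
    ∃ ω ρ : Fin N → ℂ → ℂ, w = c.sepCovector (β - 2) ω ∧ v = c.sepVector β ρ := by
  have hZ := c.Z_ne_zero hc hs hs' (fun n => by
    have h := hq n
    simp only [qdetUminus, mul_ne_zero_iff] at h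
    exact h.2.1.2) hβ
  obtain ⟨hew, hev⟩ := c.expansion hc hs hs' hZ
  obtain ⟨K1, u1, h1⟩ := c.eigenstate_dotProduct_rightState hc hs hB hT hq hw
  obtain ⟨K2, u2, h2⟩ := c.leftState_dotProduct_eigenstate hc hs' hB hT hq hv
  obtain ⟨ω, hω⟩ := c.exists_wave_functions hc.2.1 hN (K1 / c.Z (β - 2)) u1
  obtain ⟨ρ, hρ⟩ := c.exists_wave_functions hc.2.1 hN (K2 / c.Z (β - 2)) u2
  refine ⟨ω, ρ, (hew w).trans ?_, (hev v).trans ?_⟩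
  · refine Finset.sum_congr rfl fun h _ => ?_
    rw [h1, hω]
    congr 1
    ring
  · refine Finset.sum_congr rfl fun h _ => ?_
    rw [h2, hρ]
    congr 1
    ring

end Chain

end

end OpenXXZ

end

theorem mainTheorem8 {N : ℕ} (c : OpenXXZ.Chain N) (β : ℂ)
    (hgen : c.GenericMinus)
    (hβ : Complex.sinh (β * c.η) ≠ 0) (hβ' : Complex.sinh ((β - 2) * c.η) ≠ 0) :
    (∀ ω ρ : Fin N → ℂ → ℂ,
      c.sepCovector (β - 2) ω ⬝ᵥ c.sepVector β ρ = c.Z (β - 2) * (c.scalarMatrix ω ρ).det) ∧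
    (1 ≤ N → c.plus.Admissible → c.TriangularGauge β → c.NonNilpotent β →
      (∀ n, c.qdetKplus (c.ξ n) * c.qdetUminus (c.ξ n) ≠ 0) →
      ∀ w v : OpenXXZ.Vec N, c.IsLeftEigenstate w → c.IsRightEigenstate v →
        ∃ ω ρ : Fin N → ℂ → ℂ,
          w = c.sepCovector (β - 2) ω ∧ v = c.sepVector β ρ ∧
          w ⬝ᵥ v = c.Z (β - 2) * (c.scalarMatrix ω ρ).det) := by
  refine ⟨c.sepCovector_dotProduct_sepVector hgen hβ hβ',
    fun hN hB hT hNil hq w v hw hv => ?_⟩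
  obtain ⟨ω, ρ, h1, h2⟩ := c.eigenstates_separate hgen hβ hβ' hN hB hT hNil hq hw hv
  refine ⟨ω, ρ, h1, h2, ?_⟩
  rw [h1, h2]
  exact c.sepCovector_dotProduct_sepVector hgen hβ hβ' ω ρ
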